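/- **Notation.** Let $\mathbb K$ be a field and $x$ an indeterminate over $\mathbb K$. For finite sets $X,Y$ put $\mathcal R(X,Y)=\prod_{x\in X,\,y\in Y}(x-y)$ (equal to $1$ if $X$ or $Y$ is empty), and $\mathcal R(x,Y)=\prod_{y\in Y}(x-y)$. For finite $A,B\subset\mathbb K$ with $|A|=m$ the Sylvester single sum is $$\operatorname{Syl}_{d,0}(A,B)(x)=\sum_{\substack{A_1\sqcup A_2=A\\|A_1|=d,\ |A_2|=m-d}}\frac{\mathcal R(A_2,B)\,\mathcal R(x,A_1)}{\mathcal R(A_1,A_2)}\in\mathbb K[x].$$ For a finite multiset $X$ of $r$ elements (counted with multiplicity) of a field and $k\ge r$, let $V_k(X)$ be the confluent Vandermonde matrix of size $k\times r$: each element $y$ of multiplicity $j$ in $X$ contributes the $j$ consecutive columns numbered $l=0,\dots,j-1$, whose entry in row $i$ $(1\le i\le k)$ is the $l$-th derivative of $t^{k-i}$ at $t=y$. Put $V(X)=V_r(X)$. For $R\subseteq\{1,\dots,k\}$ with $|R|=k-r$ let $V^{(R)}_k(X)$ be the square matrix obtained from $V_k(X)$ by removing the rows indexed by $R$, and let $S_k^{(R)}(X)=\det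 V_k^{(R)}(X)/\det V(X)$ (for a set $X$ this is a Schur polynomial). Inside the arguments of $S_k^{(R)}$, unions are unions of multisets, i.e. multiplicities are added. For a partition $R=(R_1,\dots,R_\ell)$ of $\{1,\dots,r\}$ into disjoint, possibly empty subsets, $\operatorname{sg}(R)=\operatorname{sg}(R_1,\dots,R_\ell)=\pm1$ is the sign of the permutation that sorts the sequence obtained by writing $R_1,\dots,R_\ell$ one after the other, each in increasing order. **Theorem.** Let $A,B\subset\mathbb K$ be finite sets with $|A|=m$, $|B|=n$, and let $\overline A\subseteq A$, $\overline B\subseteq B$ be non-empty subsets with $|\overline A|=\overline m$, $|\overline B|=\overline n$. Put $m'=m-\overline m$ and $n'=n-\overline n$. Let $d\ge 0$ be an integer with $d\le\min\{m,n\}$ if $m\neq n$ and $d<m$ if $m=n$, and assume $d<m'+n'$. For $A'\subseteq\overline A$ and $B'\subseteq\overline B$ put $$Q_{A',B'}(x)=\frac{\mathcal R(A\setminus\overline A,\overline B\setminus B')\,\mathcal R(\overline A\setminus A',B\setminus B')\,\mathcal R(x,A')\,\mathcal R(x,B')}{\mathcal R(A',\overline A\setminus A')\,\mathcal R(B',\overline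 B\setminus B')}.$$ (1) If $d<\overline m+\overline n$, then $$\operatorname{Syl}_{d,0}(A,B)(x)=\sum_{R}(-1)^{\sigma_R}\sum_{\substack{A'\subseteq\overline A\\|A'|=r_2-(m'-d)}}\ \sum_{\substack{B'\subseteq\overline B\\|B'|=r_3-(n'-d)}}Q_{A',B'}(x)\;S^{(R_2)}_{m+n-d}\big((\overline A\setminus A')\cup B\big)\,S^{(R_3)}_{m+n-d}\big(A\cup(\overline B\setminus B')\big),$$ where $R=(R_2,R_3)$ runs over the partitions $R_2\sqcup R_3=\{1,\dots,m'+n'-d\}$ for which $r_2=|R_2|$ and $r_3=|R_3|$ satisfy $m'-d\le r_2\le m-d$ and $n'-d\le r_3\le n-d$, and $$(-1)^{\sigma_R}=(-1)^{m'(m-d)+r_2(\overline m-1)+r_3(m'+n'-d-1)+r_2r_3}\operatorname{sg}(R_2,R_3).$$ (2) If $\overline m+\overline n\le d$, then $$\operatorname{Syl}_{d,0}(A,B)(x)=\sum_{R}(-1)^{\sigma_R}\sum_{\substack{A'\subseteq\overline A\\|A'|=r_2-(m'-d)}}\ \sum_{\substack{B'\subseteq\overline B\\|B'|=r_3-(n'-d)}}Q_{A',B'}(x)\;S^{(\widetilde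 R_1)}_{d+1}\big(A'\cup B'\cup\{x\}\big)\,S^{(R_2)}_{m+n-d}\big((\overline A\setminus A')\cup B\big)\,S^{(R_3)}_{m+n-d}\big(A\cup(\overline B\setminus B')\big),$$ where $R=(R_1,R_2,R_3)$ runs over the partitions $R_1\sqcup R_2\sqcup R_3=\{1,\dots,m'+n'-d\}$ with $R_1\subseteq\{m+n-2d,\dots,m'+n'-d\}$ for which $r_i=|R_i|$ satisfy $r_1\le d-(\overline m+\overline n)+1$, $m'-d\le r_2\le m-d$ and $n'-d\le r_3\le n-d$; here $\widetilde R_1=\{i-(m+n-2d-1):i\in R_1\}$ and $$(-1)^{\sigma_R}=(-1)^{m'(m-d)+r_1(n-d+r_2+r_3)+r_2(\overline m-1)+r_3(m'+n'-d-1)+r_2r_3}\operatorname{sg}(R_1,R_2,R_3).$$ -/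

import Mathlib

open Polynomial

/-- `R(X, Y) = ∏_{x ∈ X} ∏_{y ∈ Y} (x - y)`; it equals `1` if `X` or `Y` is empty. -/
def resProd {F : Type*} [CommRing F] (X Y : Finset F) : F :=
  ∏ x ∈ X, ∏ y ∈ Y, (x - y)

/-- `R(x, Y) = ∏_{y ∈ Y} (x - y)` for the indeterminate `x`, as a polynomial in `x`. -/
noncomputable def resProdX {F : Type*} [CommRing F] (Y : Finset F) : F[X] :=
  ∏ y ∈ Y, (X - C y)

/-- The Sylvester single sum `Syl_{d,0}(A, B)(x)`: the sum of
`R(A₂, B) R(x, A₁) / R(A₁, A₂)` over all `A₁ ⊔ A₂ = A` with `|A₁| = d`, a polynomial in `x`. -/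
noncomputable def sylSingle {F : Type*} [Field F] [DecidableEq F] (A B : Finset F) (d : ℕ) : F[X] :=
  ∑ A₁ ∈ A.powersetCard d,
    C (resProd (A \ A₁) B / resProd A₁ (A \ A₁)) * resProdX A₁

/-- The columns of a confluent Vandermonde matrix of the multiset `X`: for every element `x` of
multiplicity `j` there are `j` columns `(x, 0), …, (x, j - 1)`. They are listed in a fixed order;
the quotient `schurS` below does not depend on it. -/
noncomputable def confluentCols {F : Type*} [DecidableEq F] (X : Multiset F) (b : Fin X.card) :
    F × ℕ :=
  ((X.toEnumFinset.equivFinOfCardEq (Multiset.card_toEnumFinset X)).symm b : F × ℕ)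

/-- The entry in row `i` (rows are numbered `1, …, k` from the top) and column `(x, j)` of the
confluent Vandermonde matrix with `k` rows: the `j`-th derivative of `t ^ (k - i)` at `t = x`,
that is `(k-i) (k-i-1) ⋯ (k-i-j+1) x ^ (k-i-j)`, which is `0` for `j > k - i`. -/
def confluentEntry {F : Type*} [CommRing F] (k i : ℕ) (c : F × ℕ) : F :=
  ((k - i).descFactorial c.2 : F) * c.1 ^ (k - i - c.2)

/-- `V_k^{(R)}(X)`: the square matrix obtained from the confluent Vandermonde matrix `V_k(X)` by
removing the rows whose indices are in `R`. -/
noncomputable def confluentVandermonde {F : Type*} [CommRing F] [DecidableEq F] (k : ℕ)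
    (R : Finset ℕ) (X : Multiset F) (h : (Finset.Icc 1 k \ R).card = X.card) :
    Matrix (Fin X.card) (Fin X.card) F :=
  Matrix.of fun a b =>
    confluentEntry k ((Finset.Icc 1 k \ R).orderEmbOfFin h a) (confluentCols X b)

open Classical in
/-- The (confluent) Schur polynomial `S_k^{(R)}(X) = det V_k^{(R)}(X) / det V(X)` of a multiset `X`,
for `R ⊆ {1, …, k}` with `|R| = k - |X|`. Here `V(X)` is the square matrix `V_{|X|}(X)`.
For other `R` (where `V_k^{(R)}(X)` is not square) the value is set to `0`. -/
noncomputable def schurS {F : Type*} [Field F] (k : ℕ) (R : Finset ℕ) (X : Multiset F) : F :=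
  if h : (Finset.Icc 1 k \ R).card = X.card then
    (confluentVandermonde k R X h).det / (confluentVandermonde X.card ∅ X (by simp)).det
  else 0

/-- `sg(R₁, …, R_ℓ)`: the sign of the permutation that sorts the sequence obtained by writing
`R₁, …, R_ℓ` one after the other, each of them in increasing order. -/
def partSign (L : List (Finset ℕ)) : ℤˣ :=
  Equiv.Perm.sign (Tuple.sort (L.flatMap fun R => R.sort (· ≤ ·)).get)

/-- The ordered partitions `R₂ ⊔ R₃ = {1, …, r}` (parts may be empty). -/
def partitions₂ (r : ℕ) : Finset (Finset ℕ × Finset ℕ) :=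
  ((Finset.Icc 1 r).powerset ×ˢ (Finset.Icc 1 r).powerset).filter fun R =>
    Disjoint R.1 R.2 ∧ R.1 ∪ R.2 = Finset.Icc 1 r

/-- The ordered partitions `R₁ ⊔ R₂ ⊔ R₃ = {1, …, r}` (parts may be empty). -/
def partitions₃ (r : ℕ) : Finset (Finset ℕ × Finset ℕ × Finset ℕ) :=
  ((Finset.Icc 1 r).powerset ×ˢ (Finset.Icc 1 r).powerset ×ˢ (Finset.Icc 1 r).powerset).filter
    fun R => Disjoint R.1 R.2.1 ∧ Disjoint R.1 R.2.2 ∧ Disjoint R.2.1 R.2.2 ∧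
      R.1 ∪ R.2.1 ∪ R.2.2 = Finset.Icc 1 r

/-- `R(A ∖ Ā, B̄ ∖ B') R(Ā ∖ A', B ∖ B') R(x, A') R(x, B') / (R(A', Ā ∖ A') R(B', B̄ ∖ B'))`,
a polynomial in `x`; `Ab`, `Bb` stand for `Ā`, `B̄`. -/
noncomputable def quotTerm {F : Type*} [Field F] [DecidableEq F] (A B Ab Bb A' B' : Finset F) :
    F[X] :=
  C (resProd (A \ Ab) (Bb \ B') * resProd (Ab \ A') (B \ B') /
      (resProd A' (Ab \ A') * resProd B' (Bb \ B'))) *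
    resProdX A' * resProdX B'

/-! ### Determinants indexed by sums of `Fin`s, and Vandermonde factorizations. -/

section Determinants

variable {R : Type*} [CommRing R]

/-! The work takes place in K(x). For A₁ ⊆ A with d elements put f(t) = ∏_{a ∈ A₁} (t - a).
Symmetric Lagrange interpolation (`sum_powersetCard_eq_eval`) on a set S of more than d nodes writes
f(x) as a sum over the d-element subsets S' of S, with numerators ∏_{c ∈ S'} (x - c) · ∏_{c ∈ S ∖
S'} f(c). Take S = Ā ∪ B̄ and S' = A' ∪ B', and put U = Ā ∖ A', W = B̄ ∖ B'. After summation over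
A₁, the values of f on U kill every A₁ meeting U, and the values on W complete products already
present; so the sum over A₁ collapses to an explicit factor times the coefficient of x^d in the
Sylvester sum of A ∖ U and B ∖ W (`sylSum_mul_diffProd`, `pairTerm_eq`).

If |Ā| + |B̄| = k + 1 ≤ d, there are too few nodes for f. With p the monic polynomial with roots Ā ∪
B̄, the remainder of f modulo (t - x) p, corrected by a multiple of p, has degree at most k and can
be interpolated. The pairs with |A'| + |B'| = k come from the interpolation, and the correction is
the term of the pair (Ā, B̄).

Interpolation needs distinct nodes, but A and B may meet. The expanded identity has denominators
only from differences inside A and inside B, so after a translation of B by e it is polynomial in e;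
it holds for all but finitely many e, hence for e = 0.

On the other side, that coefficient of x^d is, up to sign, a determinant of coefficients of t^j ∏_{B
∖ W} and t^j ∏_{A ∖ U} (`sylDet_eq_sum`). Multiplying both families by ∏_U ∏_W changes nothing
(`det_coeff_monic_mul`) and yields the root multisets U ∪ B and A ∪ W. Laplace expansion along
blocks of columns (`sum_partitions₃_rowMinor`) produces the sum over R, and by complementary minors
(`det_confluentVandermonde_mul`) each minor is a Schur polynomial up to sign. In (2) a third block
consists of the shifts of (t - x) ∏_{A'} ∏_{B'}: for |A'| + |B'| = k it splits off as a
unitriangular block (`det_shifts₃_of_monic`), and for (Ā, B̄) it generates the remainder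
coefficients (`det_shifts₃_eq_sum`). What is left is a comparison of signs modulo 2. -/

lemma det_eq_sum_fiberwise {n β : Type*} [Fintype n] [DecidableEq n] [DecidableEq β]
    (M : n → n → R) (g : Equiv.Perm n → β) (t : Finset β) (hg : ∀ σ, g σ ∈ t)
    (mask : β → n → n → Prop) [∀ y i j, Decidable (mask y i j)]
    (hmask : ∀ σ, ∀ y ∈ t, (∀ j, mask y (σ j) j) ↔ g σ = y) :
    (Matrix.of M).det = ∑ y ∈ t, (Matrix.of fun i j => if mask y i j then M i j else 0).det := by
  simp only [Matrix.det_apply, Matrix.of_apply]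
  rw [Finset.sum_comm]
  refine Finset.sum_congr rfl fun σ _ => ?_
  -- The Leibniz term of σ survives in exactly one masked matrix, that of y = g σ.
  rw [Finset.sum_eq_single (g σ)]
  · congr 1
    refine Finset.prod_congr rfl fun j _ => ?_
    rw [if_pos ((hmask σ _ (hg σ)).2 rfl j)]
  · intro y hy hne
    have : ¬ ∀ j, mask y (σ j) j := fun h => hne ((hmask σ y hy).1 h).symm
    push Not at this
    obtain ⟨j, hj⟩ := this
    rw [Finset.prod_eq_zero (Finset.mem_univ j) (if_neg hj), smul_zero]
  · exact fun h => (h (hg σ)).elim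

lemma exists_perm_comp {n ι : Type*} [Finite n] {v w : n → ι} (hv : Function.Injective v)
    (h : ∀ i, ∃ j, w j = v i) : ∃ π : Equiv.Perm n, ∀ i, w (π i) = v i := by
  choose f hf using h
  have hinj : Function.Injective f := fun i j hij => hv (by rw [← hf, ← hf, hij])
  exact ⟨Equiv.ofBijective f (Finite.injective_iff_bijective.1 hinj), hf⟩

lemma det_of_perm_rows {n ι : Type*} [Fintype n] [DecidableEq n] {v w : n → ι}
    {π : Equiv.Perm n} (h : ∀ i, w (π i) = v i) (M : ι → n → R) :
    (Matrix.of fun i j => M (v i) j).det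
      = (Equiv.Perm.sign π : ℤ) * (Matrix.of fun i j => M (w i) j).det := by
  rw [← Matrix.det_permute π]
  congr 1
  ext i j
  simp [h]

lemma det_of_sum_zero₂₁ {m n : Type*} [Fintype m] [Fintype n] [DecidableEq m] [DecidableEq n]
    (M : m ⊕ n → m ⊕ n → R) (h : ∀ i j, M (.inr i) (.inl j) = 0) :
    (Matrix.of M).det = (Matrix.of fun i j => M (.inl i) (.inl j)).det *
      (Matrix.of fun i j => M (.inr i) (.inr j)).det := by
  rw [← Matrix.det_fromBlocks_zero₂₁ _ (Matrix.of fun i j => M (.inl i) (.inr j))]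
  congr 1
  ext (i | i) (j | j) <;> simp [h]

lemma det_of_sum_zero₁₂ {m n : Type*} [Fintype m] [Fintype n] [DecidableEq m] [DecidableEq n]
    (M : m ⊕ n → m ⊕ n → R) (h : ∀ i j, M (.inl i) (.inr j) = 0) :
    (Matrix.of M).det = (Matrix.of fun i j => M (.inl i) (.inl j)).det *
      (Matrix.of fun i j => M (.inr i) (.inr j)).det := by
  rw [← Matrix.det_fromBlocks_zero₁₂ _ (Matrix.of fun i j => M (.inr i) (.inl j))]
  congr 1
  ext (i | i) (j | j) <;> simp [h]

lemma det_of_reindex {m n : Type*} [Fintype m] [Fintype n] [DecidableEq m] [DecidableEq n]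
    (e : m ≃ n) (M : n → n → R) :
    (Matrix.of fun i j => M (e i) (e j)).det = (Matrix.of M).det :=
  Matrix.det_submatrix_equiv_self e (Matrix.of M)

lemma det_of_mul_left {n : Type*} [Fintype n] [DecidableEq n] (c : n → R) (M : n → n → R) :
    (Matrix.of fun i j => c i * M i j).det = (∏ i, c i) * (Matrix.of M).det :=
  Matrix.det_mul_column c (Matrix.of M)

/-- The position of an element of `Fin a ⊕ Fin b` in the concatenated order. -/
def pos₂ {a b : ℕ} : Fin a ⊕ Fin b → ℕ := Sum.elim (fun i => i) (fun j => a + j)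

/-- The position of an element of `Fin a ⊕ Fin b ⊕ Fin c` in the concatenated order. -/
def pos₃ {a b c : ℕ} : Fin a ⊕ Fin b ⊕ Fin c → ℕ := Sum.elim (fun i => i) (fun j => a + pos₂ j)

@[simp] lemma pos₂_inl {a b : ℕ} (i : Fin a) : pos₂ (.inl i : Fin a ⊕ Fin b) = i := rfl
@[simp] lemma pos₂_inr {a b : ℕ} (i : Fin b) : pos₂ (.inr i : Fin a ⊕ Fin b) = a + i := rfl
@[simp] lemma pos₃_inl {a b c : ℕ} (i : Fin a) :
    pos₃ (.inl i : Fin a ⊕ Fin b ⊕ Fin c) = i := rfl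
@[simp] lemma pos₃_inr {a b c : ℕ} (i : Fin b ⊕ Fin c) :
    pos₃ (.inr i : Fin a ⊕ Fin b ⊕ Fin c) = a + pos₂ i := rfl

lemma coe_finSumFinEquiv {a b : ℕ} (i : Fin a ⊕ Fin b) : (finSumFinEquiv i : ℕ) = pos₂ i := by
  rcases i with i | i <;> simp

lemma pos₂_lt {a b : ℕ} (i : Fin a ⊕ Fin b) : pos₂ i < a + b := by
  rw [← coe_finSumFinEquiv]; exact (finSumFinEquiv i).2

/-- The bijection `Fin a ⊕ Fin b ⊕ Fin c ≃ Fin (a + (b + c))` given by `pos₃`. -/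
def finSumEquiv₃ (a b c : ℕ) : Fin a ⊕ Fin b ⊕ Fin c ≃ Fin (a + (b + c)) :=
  ((Equiv.refl _).sumCongr finSumFinEquiv).trans finSumFinEquiv

lemma coe_finSumEquiv₃ {a b c : ℕ} (i : Fin a ⊕ Fin b ⊕ Fin c) :
    (finSumEquiv₃ a b c i : ℕ) = pos₃ i := by
  rcases i with i | i | i <;> simp [finSumEquiv₃]

lemma pos₃_lt {a b c : ℕ} (i : Fin a ⊕ Fin b ⊕ Fin c) : pos₃ i < a + (b + c) := by
  rw [← coe_finSumEquiv₃]; exact (finSumEquiv₃ a b c i).2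

/-- The Vandermonde determinant with rows and columns indexed by `Fin a ⊕ Fin b`. -/
def vdmSum {a b : ℕ} (w : Fin a ⊕ Fin b → R) : R :=
  (Matrix.of fun i j : Fin a ⊕ Fin b => w i ^ pos₂ j).det

lemma vdmSum_eq_vandermonde {a b : ℕ} (w : Fin a ⊕ Fin b → R) :
    vdmSum w = (Matrix.vandermonde fun i => w (finSumFinEquiv.symm i)).det := by
  rw [vdmSum, ← Matrix.det_submatrix_equiv_self finSumFinEquiv]
  congr 1
  ext i j
  simp [Matrix.vandermonde_apply, coe_finSumFinEquiv]

lemma vdmSum_ne_zero [IsDomain R] {a b : ℕ} {w : Fin a ⊕ Fin b → R}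
    (hw : Function.Injective w) : vdmSum w ≠ 0 := by
  rw [vdmSum_eq_vandermonde, Matrix.det_vandermonde_ne_zero_iff]
  exact hw.comp finSumFinEquiv.symm.injective

lemma vdmSum_eq_det_eval [Nontrivial R] {a b : ℕ} (w : Fin a ⊕ Fin b → R)
    (p : Fin a ⊕ Fin b → R[X])
    (hp : ∀ j, (p j).Monic) (hd : ∀ j, (p j).natDegree = pos₂ j) :
    (Matrix.of fun i j => (p j).eval (w i)).det = vdmSum w := by
  rw [vdmSum_eq_vandermonde,
    Matrix.det_eval_matrixOfPolynomials_eq_det_vandermonde _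
      (fun j => p (finSumFinEquiv.symm j)) _ (fun j => hp _),
    ← Matrix.det_submatrix_equiv_self finSumFinEquiv.symm]
  · rfl
  · intro i
    rw [hd, ← coe_finSumFinEquiv, Equiv.apply_symm_apply]

/-- Column operations replace t ^ (a + j) by t ^ j q, where q is the monic polynomial vanishing at
the first a points. The matrix becomes block triangular, and the values of q factor out of the rows
of the second block. -/
lemma vdmSum_eq_mul {a b : ℕ} (w : Fin a ⊕ Fin b → R) :
    vdmSum w = (Matrix.vandermonde fun i => w (.inl i)).det *
      (Matrix.vandermonde fun i => w (.inr i)).det *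
      ∏ i, ∏ j, (w (.inr j) - w (.inl i)) := by
  nontriviality R
  set q : R[X] := ∏ i, (X - C (w (.inl i))) with hq
  have hqm : q.Monic := monic_prod_of_monic _ _ fun i _ => monic_X_sub_C _
  have hqd : q.natDegree = a := by
    rw [hq, natDegree_prod_of_monic _ _ fun i _ => monic_X_sub_C _]
    simp
  rw [← vdmSum_eq_det_eval w
    (Sum.elim (fun i => X ^ (i : ℕ)) (fun j => q * X ^ (j : ℕ)))]
  · rw [det_of_sum_zero₁₂]
    · have h1 : (Matrix.of fun i j : Fin b => ((Sum.elim (fun i : Fin a => (X : R[X]) ^ (i : ℕ))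
          (fun j : Fin b => q * X ^ (j : ℕ))) (.inr j)).eval (w (.inr i))).det =
          (∏ i, q.eval (w (.inr i))) * (Matrix.vandermonde fun i => w (.inr i)).det := by
        rw [Matrix.vandermonde, ← det_of_mul_left]
        congr 1
        ext i j
        simp
      rw [h1, Finset.prod_comm]
      simp only [hq, eval_prod, eval_sub, eval_X, eval_C]
      have h2 : (Matrix.of fun i j : Fin a => ((Sum.elim (fun i : Fin a => (X : R[X]) ^ (i : ℕ))
          (fun j : Fin b => q * X ^ (j : ℕ))) (.inl j)).eval (w (.inl i))).det =
          (Matrix.vandermonde fun i => w (.inl i)).det := by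
        congr 1
        ext i j
        simp [Matrix.vandermonde_apply]
      rw [← hq, h2]
      ring
    · intro i j
      simp [hq, eval_prod, Finset.prod_eq_zero (Finset.mem_univ i)]
  · rintro (j | j)
    · exact monic_X_pow _
    · exact hqm.mul (monic_X_pow _)
  · rintro (j | j)
    · simp
    · simp [hqm.natDegree_mul (monic_X_pow _), hqd]

lemma vdmSum_swap {a b : ℕ} (z : Fin a ⊕ Fin b → R) :
    vdmSum (fun i : Fin b ⊕ Fin a => z i.swap) = (-1) ^ (a * b) * vdmSum z := by
  rw [vdmSum_eq_mul, vdmSum_eq_mul z]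
  have : ∏ i, ∏ j, (z (Sum.swap (.inr j : Fin b ⊕ Fin a)) - z (Sum.swap (.inl i : Fin b ⊕ Fin a)))
      = (-1) ^ (a * b) * ∏ i, ∏ j, (z (.inr j) - z (.inl i)) := by
    rw [Finset.prod_comm]
    have h : ∀ (i : Fin a) (j : Fin b),
        z (Sum.swap (.inr i : Fin b ⊕ Fin a)) - z (Sum.swap (.inl j : Fin b ⊕ Fin a))
          = (-1) * (z (.inr j) - z (.inl i)) := by
      intro i j; simp
    simp only [h, Finset.prod_mul_distrib, Finset.prod_const, Finset.card_univ, Fintype.card_fin]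
    rw [← pow_mul, mul_comm b a]
  rw [this]
  simp only [Sum.swap_inl, Sum.swap_inr]
  ring

lemma pos₂_injective {a b : ℕ} : Function.Injective (pos₂ : Fin a ⊕ Fin b → ℕ) := by
  intro i j h
  rw [← coe_finSumFinEquiv, ← coe_finSumFinEquiv] at h
  exact finSumFinEquiv.injective (Fin.ext h)

lemma pos₃_injective {a b c : ℕ} : Function.Injective (pos₃ : Fin a ⊕ Fin b ⊕ Fin c → ℕ) := by
  intro i j h
  rw [← coe_finSumEquiv₃, ← coe_finSumEquiv₃] at h
  exact (finSumEquiv₃ a b c).injective (Fin.ext h)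

lemma exists_pos₂_eq {a b c : ℕ} (h : c < a + b) : ∃ i : Fin a ⊕ Fin b, pos₂ i = c :=
  ⟨finSumFinEquiv.symm ⟨c, h⟩, by rw [← coe_finSumFinEquiv, Equiv.apply_symm_apply]⟩

lemma exists_pos₃_eq {a b c k : ℕ} (h : k < a + (b + c)) :
    ∃ i : Fin a ⊕ Fin b ⊕ Fin c, pos₃ i = k :=
  ⟨(finSumEquiv₃ a b c).symm ⟨k, h⟩, by rw [← coe_finSumEquiv₃, Equiv.apply_symm_apply]⟩

/-- The permutation is kept explicit and independent of the matrix, so that its sign can be read off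
from a single integer matrix. -/
lemma det_swap_columns_of_perm {a b : ℕ} {π : Equiv.Perm (Fin a ⊕ Fin b)}
    (hπ : ∀ i, pos₂ (π i) = pos₂ (i.swap : Fin b ⊕ Fin a)) (M : ℕ → Fin a ⊕ Fin b → R) :
    (Matrix.of fun i j : Fin b ⊕ Fin a => M (pos₂ i) j.swap).det =
      (Equiv.Perm.sign π : ℤ) * (Matrix.of fun i j : Fin a ⊕ Fin b => M (pos₂ i) j).det := by
  rw [← det_of_perm_rows hπ, ← det_of_reindex (Equiv.sumComm (Fin a) (Fin b))]
  simp

/-- Interchanging two blocks of columns. -/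
lemma det_block_swap {a b : ℕ} (M : ℕ → Fin a ⊕ Fin b → R) :
    (Matrix.of fun i j : Fin b ⊕ Fin a => M (pos₂ i) j.swap).det =
      (-1) ^ (a * b) * (Matrix.of fun i j : Fin a ⊕ Fin b => M (pos₂ i) j).det := by
  obtain ⟨π, hπ⟩ := exists_perm_comp
    (v := fun i : Fin a ⊕ Fin b => pos₂ (i.swap : Fin b ⊕ Fin a)) (w := pos₂)
    (fun i j h => Sum.swap_leftInverse.injective (pos₂_injective h))
    (fun i => exists_pos₂_eq (by rw [add_comm]; exact pos₂_lt _))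
  rw [det_swap_columns_of_perm hπ]
  -- Test matrix: the Vandermonde matrix with distinct integer nodes, whose nonzero determinant can
  -- be cancelled.
  let z : Fin a ⊕ Fin b → ℤ := fun i => pos₂ i
  have hz : vdmSum z ≠ 0 := vdmSum_ne_zero (Nat.cast_injective.comp pos₂_injective)
  have h := det_swap_columns_of_perm hπ (fun i j => z j ^ i)
  have h1 : (Matrix.of fun i j : Fin b ⊕ Fin a => z j.swap ^ pos₂ i).det
      = vdmSum (fun i : Fin b ⊕ Fin a => z i.swap) := by
    rw [vdmSum, ← Matrix.det_transpose]; rfl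
  have h2 : (Matrix.of fun i j : Fin a ⊕ Fin b => z j ^ pos₂ i).det = vdmSum z := by
    rw [vdmSum, ← Matrix.det_transpose]; rfl
  rw [h1, h2, vdmSum_swap] at h
  have h3 := mul_right_cancel₀ hz h
  simp only [Int.cast_id] at h3
  rw [← h3]
  push_cast
  rfl

end Determinants

/-! ### Laplace expansion along three blocks of columns. -/

section Partitions

variable {F : Type*} [CommRing F]

/-- The minor of the matrix `M` formed by the rows in `R`, in increasing order. -/
def rowMinor {r : ℕ} (R : Finset ℕ) (M : ℕ → Fin r → F) : F :=
  if h : R.card = r then (Matrix.of fun i j => M (R.orderEmbOfFin h i) j).det else 0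

lemma rowMinor_of_card {r : ℕ} {R : Finset ℕ} (h : R.card = r) (M : ℕ → Fin r → F) :
    rowMinor R M = (Matrix.of fun i j => M (R.orderEmbOfFin h i) j).det := dif_pos h

lemma orderEmbOfFin_Icc {n : ℕ} (h : (Finset.Icc 1 n).card = n) (i : Fin n) :
    (Finset.Icc 1 n).orderEmbOfFin h i = 1 + (i : ℕ) := by
  have := Finset.orderEmbOfFin_unique h (f := fun i : Fin n => 1 + (i : ℕ))
    (fun i => by rw [Finset.mem_Icc]; omega) (fun i j hij => by simpa using hij)
  exact (congrFun this i).symm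

/-- The rows of a partition, listed part by part. -/
def partRows {r₁ r₂ r₃ : ℕ} (R : Finset ℕ × Finset ℕ × Finset ℕ) (h₁ : R.1.card = r₁)
    (h₂ : R.2.1.card = r₂) (h₃ : R.2.2.card = r₃) : Fin r₁ ⊕ Fin r₂ ⊕ Fin r₃ → ℕ :=
  Sum.elim (R.1.orderEmbOfFin h₁) (Sum.elim (R.2.1.orderEmbOfFin h₂) (R.2.2.orderEmbOfFin h₃))

lemma mem_partitions₃ {r : ℕ} {R : Finset ℕ × Finset ℕ × Finset ℕ} :
    R ∈ partitions₃ r ↔ Disjoint R.1 R.2.1 ∧ Disjoint R.1 R.2.2 ∧ Disjoint R.2.1 R.2.2 ∧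
      R.1 ∪ R.2.1 ∪ R.2.2 = Finset.Icc 1 r := by
  simp only [partitions₃, Finset.mem_filter, Finset.mem_product, Finset.mem_powerset,
    and_iff_right_iff_imp]
  rintro ⟨-, -, -, h⟩
  rw [← h]
  exact ⟨fun x hx => by simp [hx], fun x hx => by simp [hx], fun x hx => by simp [hx]⟩

lemma partRows_injective {r₁ r₂ r₃ : ℕ} {R : Finset ℕ × Finset ℕ × Finset ℕ} {r : ℕ}
    (hR : R ∈ partitions₃ r) (h₁ : R.1.card = r₁)
    (h₂ : R.2.1.card = r₂) (h₃ : R.2.2.card = r₃) :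
    Function.Injective (partRows R h₁ h₂ h₃) := by
  obtain ⟨h12, h13, h23, -⟩ := mem_partitions₃.1 hR
  have m1 := fun i => Finset.orderEmbOfFin_mem R.1 h₁ i
  have m2 := fun i => Finset.orderEmbOfFin_mem R.2.1 h₂ i
  have m3 := fun i => Finset.orderEmbOfFin_mem R.2.2 h₃ i
  rw [Finset.disjoint_left] at h12 h13 h23
  rintro (i | i | i) (j | j | j) h <;> simp only [partRows, Sum.elim_inl, Sum.elim_inr] at h
  · rw [(R.1.orderEmbOfFin h₁).injective h]
  · exact (h12 (m1 i) (h ▸ m2 j)).elim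
  · exact (h13 (m1 i) (h ▸ m3 j)).elim
  · exact (h12 (m1 j) (h ▸ m2 i)).elim
  · rw [(R.2.1.orderEmbOfFin h₂).injective h]
  · exact (h23 (m2 i) (h ▸ m3 j)).elim
  · exact (h13 (m1 j) (h ▸ m3 i)).elim
  · exact (h23 (m2 j) (h ▸ m3 i)).elim
  · rw [(R.2.2.orderEmbOfFin h₃).injective h]

lemma partRows_mem {r₁ r₂ r₃ : ℕ} {R : Finset ℕ × Finset ℕ × Finset ℕ} {r : ℕ}
    (hR : R ∈ partitions₃ r) (h₁ : R.1.card = r₁)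
    (h₂ : R.2.1.card = r₂) (h₃ : R.2.2.card = r₃) (i) :
    partRows R h₁ h₂ h₃ i ∈ Finset.Icc 1 r := by
  obtain ⟨-, -, -, hu⟩ := mem_partitions₃.1 hR
  rw [← hu]
  rcases i with i | i | i <;> simp [partRows]

lemma card_of_mem_partitions₃ {R : Finset ℕ × Finset ℕ × Finset ℕ} {r : ℕ}
    (hR : R ∈ partitions₃ r) : R.1.card + (R.2.1.card + R.2.2.card) = r := by
  obtain ⟨h12, h13, h23, hu⟩ := mem_partitions₃.1 hR
  have := congrArg Finset.card hu
  rw [Finset.card_union_of_disjoint (Finset.disjoint_union_left.2 ⟨h13, h23⟩),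
    Finset.card_union_of_disjoint h12, Nat.card_Icc] at this
  omega

/-- `partSign` is the sign of the permutation of rows that lists a partition part by part. -/
lemma det_eq_partSign_mul {r₁ r₂ r₃ : ℕ} {R : Finset ℕ × Finset ℕ × Finset ℕ}
    (hR : R ∈ partitions₃ (r₁ + (r₂ + r₃))) (h₁ : R.1.card = r₁)
    (h₂ : R.2.1.card = r₂) (h₃ : R.2.2.card = r₃)
    (M : ℕ → Fin r₁ ⊕ Fin r₂ ⊕ Fin r₃ → F) :
    (Matrix.of fun i j => M (1 + pos₃ i) j).det =
      ((partSign [R.1, R.2.1, R.2.2] : ℤˣ) : ℤ) *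
        (Matrix.of fun i j => M (partRows R h₁ h₂ h₃ i) j).det := by
  -- The concatenated list is generalized to l because the type of `Tuple.sort l.get` depends on its
  -- length.
  have key : ∀ l : List ℕ,
      l = R.1.sort (· ≤ ·) ++ (R.2.1.sort (· ≤ ·) ++ R.2.2.sort (· ≤ ·)) →
      (Matrix.of fun i j => M (1 + pos₃ i) j).det =
      ((Equiv.Perm.sign (Tuple.sort l.get) : ℤˣ) : ℤ) *
        (Matrix.of fun i j => M (partRows R h₁ h₂ h₃ i) j).det := by
    intro l hl
    have hlen : l.length = r₁ + (r₂ + r₃) := by simp [hl, h₁, h₂, h₃]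
    let e : Fin r₁ ⊕ Fin r₂ ⊕ Fin r₃ ≃ Fin l.length :=
      (finSumEquiv₃ r₁ r₂ r₃).trans (finCongr hlen.symm)
    have hev : ∀ i, (e i : ℕ) = pos₃ i := fun i => by simp [e, coe_finSumEquiv₃]
    have hget : ∀ i, l.get (e i) = partRows R h₁ h₂ h₃ i := by
      intro i
      have h0 : l.get (e i) = l[pos₃ i]'(by rw [hlen]; exact pos₃_lt i) := by
        simp [List.get_eq_getElem, hev]
      rw [h0]
      subst hl
      rcases i with i | i | i
      · simp [partRows, Finset.orderEmbOfFin_apply, h₁]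
      · simp [partRows, Finset.orderEmbOfFin_apply, h₁, h₂]
      · simp [partRows, Finset.orderEmbOfFin_apply, h₁, h₂]
    have hinj : Function.Injective l.get := by
      intro i j hij
      obtain ⟨i, rfl⟩ := e.surjective i
      obtain ⟨j, rfl⟩ := e.surjective j
      rw [hget, hget] at hij
      rw [partRows_injective hR h₁ h₂ h₃ hij]
    have hmem : ∀ i, l.get i ∈ Finset.Icc 1 l.length := by
      intro i
      obtain ⟨i, rfl⟩ := e.surjective i
      rw [hget, hlen]
      exact partRows_mem hR h₁ h₂ h₃ i
    -- The sorted list is strictly increasing with values in {1, …, |l|}, hence it is the standard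
    -- enumeration.
    have hsort : ∀ i, l.get (Tuple.sort l.get i) = 1 + (i : ℕ) := by
      intro i
      have hs : StrictMono (l.get ∘ Tuple.sort l.get) :=
        (Tuple.monotone_sort l.get).strictMono_of_injective
          (hinj.comp (Tuple.sort l.get).injective)
      have hc : (Finset.Icc 1 l.length).card = l.length := by simp
      have := Finset.orderEmbOfFin_unique hc (f := l.get ∘ Tuple.sort l.get)
        (fun i => hmem _) hs
      have h2 := congrFun this i
      rw [orderEmbOfFin_Icc hc] at h2
      exact h2
    have := det_of_perm_rows (v := fun i : Fin l.length => 1 + (i : ℕ)) (w := l.get)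
      (π := Tuple.sort l.get) hsort (fun i j => M i (e.symm j))
    rw [← det_of_reindex e, ← det_of_reindex e (fun i j => M (l.get i) (e.symm j))] at this
    simpa only [hev, hget, Equiv.symm_apply_apply] using this
  have := key ([R.1, R.2.1, R.2.2].flatMap fun R => R.sort (· ≤ ·)) (by simp)
  rw [this, partSign]

/-- The Laplace expansion of a determinant along three blocks of columns. -/
lemma sum_partitions₃_rowMinor {r₁ r₂ r₃ : ℕ} (M : ℕ → Fin r₁ ⊕ Fin r₂ ⊕ Fin r₃ → F) :
    ∑ R ∈ (partitions₃ (r₁ + (r₂ + r₃))).filter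
        (fun R => R.1.card = r₁ ∧ R.2.1.card = r₂ ∧ R.2.2.card = r₃),
      ((partSign [R.1, R.2.1, R.2.2] : ℤˣ) : ℤ) *
        (rowMinor R.1 (fun i j => M i (.inl j)) *
        rowMinor R.2.1 (fun i j => M i (.inr (.inl j))) *
        rowMinor R.2.2 (fun i j => M i (.inr (.inr j))))
      = (Matrix.of fun i j => M (1 + pos₃ i) j).det := by
  classical
  let part : Finset ℕ × Finset ℕ × Finset ℕ → Fin r₁ ⊕ Fin r₂ ⊕ Fin r₃ → Finset ℕ :=
    fun R => Sum.elim (fun _ => R.1) (Sum.elim (fun _ => R.2.1) (fun _ => R.2.2))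
  let row : Fin r₁ ⊕ Fin r₂ ⊕ Fin r₃ → ℕ := fun i => 1 + pos₃ i
  have hrow : Function.Injective row := fun i j h => pos₃_injective (Nat.add_left_cancel h)
  -- g σ records the rows that σ assigns to each block of columns; the permutations with a given g
  -- add up to one product of three minors.
  let g : Equiv.Perm (Fin r₁ ⊕ Fin r₂ ⊕ Fin r₃) → Finset ℕ × Finset ℕ × Finset ℕ := fun σ =>
    (Finset.univ.image fun j => row (σ (.inl j)), Finset.univ.image fun j => row (σ (.inr (.inl j))),
      Finset.univ.image fun j => row (σ (.inr (.inr j))))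
  have hg1 : ∀ σ, (g σ).1.card = r₁ := fun σ => by
    rw [Finset.card_image_of_injective _ fun i j h => ?_, Finset.card_univ, Fintype.card_fin]
    simpa using hrow h
  have hg2 : ∀ σ, (g σ).2.1.card = r₂ := fun σ => by
    rw [Finset.card_image_of_injective _ fun i j h => ?_, Finset.card_univ, Fintype.card_fin]
    simpa using hrow h
  have hg3 : ∀ σ, (g σ).2.2.card = r₃ := fun σ => by
    rw [Finset.card_image_of_injective _ fun i j h => ?_, Finset.card_univ, Fintype.card_fin]
    simpa using hrow h
  rw [det_eq_sum_fiberwise _ g _ _ (fun R i j => row i ∈ part R j)]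
  · refine Finset.sum_congr rfl fun R hR => ?_
    obtain ⟨hR, h₁, h₂, h₃⟩ := Finset.mem_filter.1 hR
    have := det_eq_partSign_mul hR h₁ h₂ h₃ (fun i j => if i ∈ part R j then M i j else 0)
    rw [this]
    congr 1
    obtain ⟨h12, h13, h23, -⟩ := mem_partitions₃.1 hR
    have m1 := fun i => Finset.orderEmbOfFin_mem R.1 h₁ i
    have m2 := fun i => Finset.orderEmbOfFin_mem R.2.1 h₂ i
    have m3 := fun i => Finset.orderEmbOfFin_mem R.2.2 h₃ i
    rw [Finset.disjoint_left] at h12 h13 h23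
    rw [det_of_sum_zero₂₁, det_of_sum_zero₂₁, rowMinor_of_card h₁, rowMinor_of_card h₂,
      rowMinor_of_card h₃, mul_assoc]
    · simp [part, partRows]
    · intro i j
      simp only [partRows, part, Sum.elim_inl, Sum.elim_inr]
      exact if_neg fun h => h23 h (m3 i)
    · rintro (i | i) j
      · simp only [partRows, part, Sum.elim_inl, Sum.elim_inr]
        exact if_neg fun h => h12 h (m2 i)
      · simp only [partRows, part, Sum.elim_inl, Sum.elim_inr]
        exact if_neg fun h => h13 h (m3 i)
  swap
  · intro σ
    have hinj : Function.Injective fun j => row (σ j) := hrow.comp σ.injective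
    rw [Finset.mem_filter, mem_partitions₃]
    refine ⟨⟨?_, ?_, ?_, ?_⟩, hg1 σ, hg2 σ, hg3 σ⟩
    · simp only [g, Finset.disjoint_left, Finset.mem_image, Finset.mem_univ, true_and]
      rintro _ ⟨j, rfl⟩ ⟨i, hi⟩
      simpa using hinj hi
    · simp only [g, Finset.disjoint_left, Finset.mem_image, Finset.mem_univ, true_and]
      rintro _ ⟨j, rfl⟩ ⟨i, hi⟩
      simpa using hinj hi
    · simp only [g, Finset.disjoint_left, Finset.mem_image, Finset.mem_univ, true_and]
      rintro _ ⟨j, rfl⟩ ⟨i, hi⟩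
      simpa using hinj hi
    · ext x
      simp only [g, Finset.mem_union, Finset.mem_image, Finset.mem_univ, true_and, Finset.mem_Icc]
      constructor
      · have : ∀ j, 1 ≤ row j ∧ row j ≤ r₁ + (r₂ + r₃) := fun j => by
          have := pos₃_lt j
          simp only [row]; omega
        rintro ((⟨j, rfl⟩ | ⟨j, rfl⟩) | ⟨j, rfl⟩) <;> exact this _
      · rintro ⟨hx1, hx2⟩
        obtain ⟨i, hi⟩ := exists_pos₃_eq (a := r₁) (b := r₂) (c := r₃) (k := x - 1) (by omega)
        have hi' : row (σ (σ.symm i)) = x := by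
          rw [Equiv.apply_symm_apply]
          simp only [row]
          omega
        rcases h : σ.symm i with j | j | j
        · exact .inl (.inl ⟨j, h ▸ hi'⟩)
        · exact .inl (.inr ⟨j, h ▸ hi'⟩)
        · exact .inr ⟨j, h ▸ hi'⟩
  · intro σ R hR
    obtain ⟨hR, h₁, h₂, h₃⟩ := Finset.mem_filter.1 hR
    constructor
    · intro h
      refine Prod.ext ?_ (Prod.ext ?_ ?_)
      · exact Finset.eq_of_subset_of_card_le
          (Finset.image_subset_iff.2 fun j _ => h (.inl j)) (by rw [hg1, h₁])
      · exact Finset.eq_of_subset_of_card_le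
          (Finset.image_subset_iff.2 fun j _ => h (.inr (.inl j))) (by rw [hg2, h₂])
      · exact Finset.eq_of_subset_of_card_le
          (Finset.image_subset_iff.2 fun j _ => h (.inr (.inr j))) (by rw [hg3, h₃])
    · rintro rfl (j | j | j)
      · exact Finset.mem_image_of_mem (fun j => row (σ (.inl j))) (Finset.mem_univ j)
      · exact Finset.mem_image_of_mem (fun j => row (σ (.inr (.inl j)))) (Finset.mem_univ j)
      · exact Finset.mem_image_of_mem (fun j => row (σ (.inr (.inr j)))) (Finset.mem_univ j)

end Partitions

/-! ### The sign of listing a set of rows before its complement. -/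

section ComplementaryMinors

lemma prod_orderEmbOfFin {S : Type*} [CommMonoid S] {r : ℕ} {R : Finset ℕ} (h : R.card = r)
    (f : ℕ → S) : ∏ i, f (R.orderEmbOfFin h i) = ∏ a ∈ R, f a := by
  conv_rhs => rw [← Finset.map_orderEmbOfFin_univ R h, Finset.prod_map]
  rfl

lemma sign_vandermonde_of_strictMono {n : ℕ} {v : Fin n → ℤ} (hv : StrictMono v) :
    SignType.sign (Matrix.vandermonde v).det = 1 := by
  rw [sign_eq_one_iff, Matrix.det_vandermonde]
  exact Finset.prod_pos fun i _ => Finset.prod_pos fun j hj =>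
    sub_pos.2 (hv (Finset.mem_Ioi.1 hj))

lemma sign_vandermonde_of_strictAnti {n : ℕ} {v : Fin n → ℤ} (hv : StrictAnti v) :
    SignType.sign (Matrix.vandermonde v).det =
      ∏ i : Fin n, ∏ _j ∈ Finset.Ioi i, (-1 : SignType) := by
  rw [Matrix.det_vandermonde]
  change signHom _ = _
  rw [map_prod]
  refine Finset.prod_congr rfl fun i _ => ?_
  rw [map_prod]
  exact Finset.prod_congr rfl fun j hj =>
    sign_eq_neg_one_iff.2 (sub_neg.2 (hv (Finset.mem_Ioi.1 hj)))

/-- Permutation signs are found by comparing the signs of two integer Vandermonde determinants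
instead of counting inversions. -/
lemma units_eq_neg_one_pow_of_sign {u : ℤˣ} {E : ℕ} {a b : ℤ} (hb : b ≠ 0) (h : a = u * b)
    (hs : SignType.sign a = (-1) ^ E * SignType.sign b) : (u : ℤ) = (-1) ^ E := by
  rw [h, sign_mul] at hs
  have hb' : SignType.sign b ≠ 0 := by rwa [Ne, sign_eq_zero_iff]
  have := mul_right_cancel₀ hb' hs
  rcases Int.units_eq_one_or u with rfl | rfl <;> rcases neg_one_pow_eq_or ℤ E with hE | hE
  · simp [hE]
  · have h2 : (-1 : SignType) ^ E = -1 := by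
      rcases Nat.even_or_odd E with he | ho
      · rw [he.neg_one_pow] at hE; norm_num at hE
      · exact ho.neg_one_pow
    rw [h2] at this; simp at this
  · have h2 : (-1 : SignType) ^ E = 1 := by
      rcases Nat.even_or_odd E with he | ho
      · exact he.neg_one_pow
      · rw [ho.neg_one_pow] at hE; norm_num at hE
    rw [h2] at this; simp at this
  · simp [hE]

/-- A set of rows followed by the complementary set of rows. -/
def complRows {r x : ℕ} (k : ℕ) (R : Finset ℕ) (hr : R.card = r)
    (hx : (Finset.Icc 1 k \ R).card = x) : Fin r ⊕ Fin x → ℕ :=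
  Sum.elim (R.orderEmbOfFin hr) ((Finset.Icc 1 k \ R).orderEmbOfFin hx)

/-- Exponents `x, x + 1, …, x + r - 1` followed by `x - 1, x - 2, …, 0`. -/
def shiftExp (r x : ℕ) : Fin r ⊕ Fin x → ℕ := Sum.elim (fun j => x + j) (fun j => x - 1 - j)

variable {r x k : ℕ} {R : Finset ℕ}

lemma shiftExp_injective : Function.Injective (shiftExp r x) := by
  rintro (i | i) (j | j) h <;> simp only [shiftExp, Sum.elim_inl, Sum.elim_inr] at h
  · congr 1; ext; omega
  · omega
  · omega
  · congr 1; ext; omega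

lemma complRows_mem (hRk : R ⊆ Finset.Icc 1 k) (hr : R.card = r)
    (hx : (Finset.Icc 1 k \ R).card = x) (s : Fin r ⊕ Fin x) : complRows k R hr hx s ∈ Finset.Icc 1 k := by
  rcases s with i | i
  · exact hRk (Finset.orderEmbOfFin_mem R hr i)
  · exact (Finset.mem_sdiff.1 (Finset.orderEmbOfFin_mem (Finset.Icc 1 k \ R) hx i)).1

lemma complRows_injective (hr : R.card = r)
    (hx : (Finset.Icc 1 k \ R).card = x) : Function.Injective (complRows k R hr hx) := by
  have m2 := fun i => (Finset.mem_sdiff.1 (Finset.orderEmbOfFin_mem (Finset.Icc 1 k \ R) hx i)).2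
  rintro (i | i) (j | j) h <;> simp only [complRows, Sum.elim_inl, Sum.elim_inr] at h
  · rw [(R.orderEmbOfFin hr).injective h]
  · exact (m2 j (h ▸ Finset.orderEmbOfFin_mem R hr i)).elim
  · exact (m2 i (h ▸ Finset.orderEmbOfFin_mem R hr j)).elim
  · rw [((Finset.Icc 1 k \ R).orderEmbOfFin hx).injective h]

lemma card_add_card_compl (hRk : R ⊆ Finset.Icc 1 k) (hr : R.card = r)
    (hx : (Finset.Icc 1 k \ R).card = x) :
    r + x = k := by
  rw [Finset.card_sdiff_of_subset hRk, Nat.card_Icc] at hx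
  have := Finset.card_le_card hRk
  rw [Nat.card_Icc] at this
  omega

/-- On the left, each a ∈ R contributes one factor -1 for every b in {1, …, k} with b > a, whether b
lies in R or not; that makes k - a factors (`c4`, `c5`). Pairs inside the complement are inverted on
both sides alike and cancel. On the right only the x * r mixed pairs remain. -/
lemma sign_vdmSum_complRows (hRk : R ⊆ Finset.Icc 1 k) (hr : R.card = r)
    (hx : (Finset.Icc 1 k \ R).card = x) :
    SignType.sign (vdmSum fun s => ((k - complRows k R hr hx s : ℕ) : ℤ)) =
      (-1) ^ (∑ i ∈ R, (i + 1)) * SignType.sign (vdmSum fun s => (shiftExp r x s : ℤ)) := by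
  have hk := card_add_card_compl hRk hr hx
  have hb := fun s => Finset.mem_Icc.1 (complRows_mem hRk hr hx s)
  have e1 : StrictAnti fun i : Fin r => ((k - complRows k R hr hx (.inl i) : ℕ) : ℤ) := by
    intro i j hij
    have h1 : complRows k R hr hx (.inl i) < complRows k R hr hx (.inl j) :=
      (R.orderEmbOfFin hr).strictMono hij
    have := hb (.inl i); have := hb (.inl j)
    simp only []
    omega
  have e2 : StrictAnti fun i : Fin x => ((k - complRows k R hr hx (.inr i) : ℕ) : ℤ) := by
    intro i j hij
    have h1 : complRows k R hr hx (.inr i) < complRows k R hr hx (.inr j) :=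
      ((Finset.Icc 1 k \ R).orderEmbOfFin hx).strictMono hij
    have := hb (.inr i); have := hb (.inr j)
    simp only []
    omega
  have e3 : StrictMono fun i : Fin r => (shiftExp r x (.inl i) : ℤ) := by
    intro i j hij
    have : (i : ℕ) < j := hij
    simp only [shiftExp, Sum.elim_inl]
    omega
  have e4 : StrictAnti fun i : Fin x => (shiftExp r x (.inr i) : ℤ) := by
    intro i j hij
    have : (i : ℕ) < j := hij
    simp only [shiftExp, Sum.elim_inr]
    omega
  rw [vdmSum_eq_mul, vdmSum_eq_mul, sign_mul, sign_mul, sign_mul, sign_mul,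
    sign_vandermonde_of_strictAnti e1, sign_vandermonde_of_strictAnti e2,
    sign_vandermonde_of_strictMono e3, sign_vandermonde_of_strictAnti e4]
  have c1 : SignType.sign (∏ i : Fin r, ∏ j : Fin x,
      ((shiftExp r x (.inr j) : ℤ) - (shiftExp r x (.inl i) : ℤ))) = (-1) ^ (x * r) := by
    change signHom _ = _
    rw [map_prod]
    have : ∀ i : Fin r, signHom (∏ j : Fin x,
      ((shiftExp r x (.inr j) : ℤ) - (shiftExp r x (.inl i) : ℤ))) = (-1) ^ x := by
      intro i
      rw [map_prod, Finset.prod_congr rfl fun j _ => ?_, Finset.prod_const, Finset.card_univ,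
        Fintype.card_fin]
      refine sign_eq_neg_one_iff.2 ?_
      simp only [shiftExp, Sum.elim_inl, Sum.elim_inr]
      omega
    simp only [this, Finset.prod_const, Finset.card_univ, Fintype.card_fin, pow_mul]
  have c2 : SignType.sign (∏ i : Fin r, ∏ j : Fin x,
      (((k - complRows k R hr hx (.inr j) : ℕ) : ℤ) -
        ((k - complRows k R hr hx (.inl i) : ℕ) : ℤ))) =
      ∏ i : Fin r, ∏ b ∈ Finset.Icc 1 k \ R,
        if R.orderEmbOfFin hr i < b then (-1 : SignType) else 1 := by
    change signHom _ = _
    rw [map_prod]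
    refine Finset.prod_congr rfl fun i _ => ?_
    rw [map_prod, ← prod_orderEmbOfFin hx]
    refine Finset.prod_congr rfl fun j _ => ?_
    have h1 := hb (.inl i); have h2 := hb (.inr j)
    have h3 : complRows k R hr hx (.inl i) ≠ complRows k R hr hx (.inr j) :=
      fun h => by simpa using complRows_injective hr hx h
    simp only [complRows, Sum.elim_inl, Sum.elim_inr] at h1 h2 h3 ⊢
    split_ifs with h
    · exact sign_eq_neg_one_iff.2 (by omega)
    · exact sign_eq_one_iff.2 (by omega)
  have c3 : ∏ i : Fin r, ∏ _j ∈ Finset.Ioi i, (-1 : SignType) =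
      ∏ i : Fin r, ∏ b ∈ R, if R.orderEmbOfFin hr i < b then (-1 : SignType) else 1 := by
    refine Finset.prod_congr rfl fun i _ => ?_
    rw [← prod_orderEmbOfFin hr, Finset.prod_ite, Finset.prod_const_one, mul_one]
    refine Finset.prod_congr ?_ fun _ _ => rfl
    ext j
    simp
  have c4 : ∀ a ∈ R, ∏ b ∈ Finset.Icc 1 k, (if a < b then (-1 : SignType) else 1) =
      (-1) ^ (k - a) := by
    intro a ha
    rw [Finset.prod_ite, Finset.prod_const_one, mul_one, Finset.prod_const]
    congr 1
    have : Finset.filter (fun b => a < b) (Finset.Icc 1 k) = Finset.Ioc a k := by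
      ext b; simp only [Finset.mem_filter, Finset.mem_Icc, Finset.mem_Ioc]; omega
    rw [this, Nat.card_Ioc]
  have c5 : (∏ i : Fin r, ∏ b ∈ Finset.Icc 1 k \ R,
        if R.orderEmbOfFin hr i < b then (-1 : SignType) else 1) *
      (∏ i : Fin r, ∏ b ∈ R, if R.orderEmbOfFin hr i < b then (-1 : SignType) else 1) =
      ∏ a ∈ R, (-1) ^ (k - a) := by
    rw [← Finset.prod_mul_distrib, ← Finset.prod_congr rfl c4, ← prod_orderEmbOfFin hr]
    exact Finset.prod_congr rfl fun i _ => Finset.prod_sdiff hRk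
  have c6 : ∏ a ∈ R, (-1 : SignType) ^ (k - a) = (-1) ^ (∑ i ∈ R, (i + 1)) * (-1) ^ (x * r) := by
    -- With k = r + x, the parities of k - a and (a + 1) + x differ by r + 1, and r factors (-1) ^
    -- (r + 1) multiply to 1.
    have h1 : ∏ a ∈ R, (-1 : SignType) ^ (r + 1) = 1 := by
      rw [Finset.prod_const, hr, ← pow_mul, mul_comm]
      exact (Nat.even_mul_succ_self r).neg_one_pow
    have h2 : ∏ a ∈ R, (-1 : SignType) ^ x = (-1) ^ (x * r) := by
      rw [Finset.prod_const, hr, pow_mul]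
    have h3 : ∏ a ∈ R, (-1 : SignType) ^ (k - a) =
        (∏ a ∈ R, (-1 : SignType) ^ (k - a)) * ∏ a ∈ R, (-1 : SignType) ^ (r + 1) := by
      rw [h1, mul_one]
    rw [h3, ← h2, ← Finset.prod_pow_eq_pow_sum, ← Finset.prod_mul_distrib,
      ← Finset.prod_mul_distrib]
    refine Finset.prod_congr rfl fun a ha => ?_
    rw [← pow_add, ← pow_add]
    have := Finset.mem_Icc.1 (hRk ha)
    refine neg_one_pow_congr ?_
    rw [← hk]
    have h3 : a ≤ r + x := by omega
    simp only [Nat.even_add, Nat.even_sub h3, Nat.not_even_one, iff_false]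
    tauto
  rw [c1, c2, c3, one_mul, mul_comm, mul_comm _ ((-1 : SignType) ^ (x * r)), ← mul_assoc,
    ← mul_assoc, ← c6, ← c5]

/-- The sign of the listing of a set of rows followed by the complementary rows. -/
lemma det_complRows {F : Type*} [CommRing F] (hRk : R ⊆ Finset.Icc 1 k) (hr : R.card = r)
    (hx : (Finset.Icc 1 k \ R).card = x)
    (M : ℕ → Fin r ⊕ Fin x → F) :
    (Matrix.of fun s j => M (k - complRows k R hr hx s) j).det =
      (-1) ^ (∑ i ∈ R, (i + 1)) * (Matrix.of fun s j => M (shiftExp r x s) j).det := by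
  have hk := card_add_card_compl hRk hr hx
  have hb := fun s => Finset.mem_Icc.1 (complRows_mem hRk hr hx s)
  obtain ⟨π, hπ⟩ := exists_perm_comp (v := fun s => k - complRows k R hr hx s)
    (w := shiftExp r x)
    (fun s t h => complRows_injective hr hx (by
      have := hb s; have := hb t; simp only [] at h; omega))
    (fun s => by
      have := hb s
      by_cases h : k - complRows k R hr hx s < x
      · exact ⟨.inr ⟨x - 1 - (k - complRows k R hr hx s), by omega⟩, by simp [shiftExp]; omega⟩
      · exact ⟨.inl ⟨k - complRows k R hr hx s - x, by omega⟩, by simp [shiftExp]; omega⟩)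
  rw [det_of_perm_rows hπ]
  have h := det_of_perm_rows hπ (fun i j => (i : ℤ) ^ pos₂ j)
  have hne : vdmSum (fun s => (shiftExp r x s : ℤ)) ≠ 0 :=
    vdmSum_ne_zero (Nat.cast_injective.comp shiftExp_injective)
  rw [units_eq_neg_one_pow_of_sign hne h (sign_vdmSum_complRows hRk hr hx)]
  push_cast
  rfl

end ComplementaryMinors

/-! ### Schur polynomials of multisets as minors of coefficient matrices. -/

section ConfluentSchur

lemma det_coeff_of_monic {F : Type*} [CommRing F] {n x : ℕ} (p : Fin n → F[X])
    (hm : ∀ j, (p j).Monic) (hd : ∀ j, (p j).natDegree = x + j) :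
    (Matrix.of fun i j : Fin n => (p j).coeff (x + i)).det = 1 := by
  rw [Matrix.det_of_isUpperTriangular]
  · refine Finset.prod_eq_one fun i _ => ?_
    rw [Matrix.of_apply, ← hd i]
    exact hm i
  · intro i j hij
    have : (j : ℕ) < i := hij
    exact coeff_eq_zero_of_natDegree_lt (by rw [hd]; omega)

variable {F : Type*} [Field F]

/-- The functional on polynomials belonging to a column of a confluent Vandermonde matrix. -/
noncomputable def evalDeriv (c : F × ℕ) (p : F[X]) : F := (derivative^[c.2] p).eval c.1

lemma evalDeriv_sum {ι : Type*} (c : F × ℕ) (s : Finset ι) (p : ι → F[X]) :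
    evalDeriv c (∑ i ∈ s, p i) = ∑ i ∈ s, evalDeriv c (p i) := by
  rw [evalDeriv, iterate_derivative_sum, eval_finsetSum]; rfl

lemma evalDeriv_C_mul (c : F × ℕ) (a : F) (p : F[X]) :
    evalDeriv c (C a * p) = a * evalDeriv c p := by
  rw [evalDeriv, iterate_derivative_C_mul, eval_mul, eval_C]; rfl

lemma evalDeriv_X_pow (c : F × ℕ) (k i : ℕ) :
    evalDeriv c (X ^ (k - i)) = confluentEntry k i c := by
  rw [evalDeriv, iterate_derivative_X_pow_eq_C_mul, confluentEntry]
  simp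

lemma evalDeriv_eq_zero {c : F × ℕ} {p : F[X]} {m : ℕ} (hc : c.2 < m)
    (hp : (X - C c.1) ^ m ∣ p) : evalDeriv c p = 0 := by
  have h := pow_sub_dvd_iterate_derivative_of_pow_dvd c.2 hp
  have h2 := (dvd_pow_self (X - C c.1) (by omega : m - c.2 ≠ 0)).trans h
  exact dvd_iff_isRoot.1 h2

lemma evalDeriv_eq_sum (c : F × ℕ) {p : F[X]} {k : ℕ} (hp : p.natDegree < k) :
    evalDeriv c p = ∑ i ∈ Finset.range k, p.coeff i * evalDeriv c (X ^ i) := by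
  conv_lhs => rw [p.as_sum_range' k hp]
  rw [evalDeriv_sum]
  refine Finset.sum_congr rfl fun i _ => ?_
  rw [← C_mul_X_pow_eq_monomial, evalDeriv_C_mul]

/-- `∏ (t - y)` over the elements `y` of a multiset. -/
noncomputable def rootPoly (X' : Multiset F) : F[X] := (X'.map fun y => X - C y).prod

lemma rootPoly_monic (Y : Multiset F) : (rootPoly Y).Monic :=
  monic_multisetProd_X_sub_C Y

lemma natDegree_rootPoly (Y : Multiset F) : (rootPoly Y).natDegree = Y.card :=
  natDegree_multiset_prod_X_sub_C_eq_card Y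

lemma pow_count_dvd_rootPoly [DecidableEq F] (Y : Multiset F) (y : F) :
    (X - C y) ^ Y.count y ∣ rootPoly Y := by
  rw [rootPoly, ← Multiset.prod_replicate]
  refine Multiset.prod_dvd_prod_of_le ?_
  rw [← Multiset.map_replicate (fun y => X - C y)]
  exact Multiset.map_le_map (Multiset.le_count_iff_replicate_le.1 le_rfl)

lemma confluentCols_lt [DecidableEq F] (Y : Multiset F) (b : Fin Y.card) :
    (confluentCols Y b).2 < Y.count (confluentCols Y b).1 :=
  (Multiset.mem_toEnumFinset _ _).1
    ((Y.toEnumFinset.equivFinOfCardEq (Multiset.card_toEnumFinset Y)).symm b).2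

lemma exists_confluentCols [DecidableEq F] (Y : Multiset F) {c : F × ℕ} (hc : c.2 < Y.count c.1) :
    ∃ b, confluentCols Y b = c := by
  refine ⟨Y.toEnumFinset.equivFinOfCardEq (Multiset.card_toEnumFinset Y)
    ⟨c, (Multiset.mem_toEnumFinset _ _).2 hc⟩, ?_⟩
  simp [confluentCols]

lemma evalDeriv_confluentCols_mul [DecidableEq F] (Y : Multiset F) (b : Fin Y.card) (s : F[X]) :
    evalDeriv (confluentCols Y b) (s * rootPoly Y) = 0 :=
  evalDeriv_eq_zero (confluentCols_lt Y b)
    ((pow_count_dvd_rootPoly Y (confluentCols Y b).1).mul_left s)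

lemma orderEmbOfFin_Icc_sdiff_empty {x : ℕ} (h : (Finset.Icc 1 x \ ∅).card = x) (i : Fin x) :
    (Finset.Icc 1 x \ ∅).orderEmbOfFin h i = 1 + (i : ℕ) := by
  have := Finset.orderEmbOfFin_unique h (f := fun i : Fin x => 1 + (i : ℕ))
    (fun i => by rw [Finset.sdiff_empty, Finset.mem_Icc]; omega)
    (fun i j hij => by simpa using hij)
  exact (congrFun this i).symm

/-- Confluent Vandermonde determinants with multiplicities at most two do not vanish,
whatever the characteristic. -/
lemma det_confluentVandermonde_ne_zero [DecidableEq F] (Y : Multiset F) (hY : ∀ y, Y.count y ≤ 2)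
    (h : (Finset.Icc 1 Y.card \ ∅).card = Y.card) :
    (confluentVandermonde Y.card ∅ Y h).det ≠ 0 := by
  intro h0
  obtain ⟨v, hv, hv0⟩ := Matrix.exists_vecMul_eq_zero_iff.2 h0
  -- A vector in the left kernel is a polynomial of degree < |Y| annihilated by all column
  -- functionals.
  set p : F[X] := ∑ i, C (v i) * X ^ (Y.card - (1 + (i : ℕ))) with hp
  have hev : ∀ b, evalDeriv (confluentCols Y b) p = 0 := by
    intro b
    refine Eq.trans ?_ (congrFun hv0 b)
    rw [hp, evalDeriv_sum]
    simp only [Matrix.vecMul, dotProduct, confluentVandermonde, Matrix.of_apply,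
      orderEmbOfFin_Icc_sdiff_empty, evalDeriv_C_mul, evalDeriv_X_pow]
  have hcoeff : ∀ i : Fin Y.card, p.coeff (Y.card - (1 + (i : ℕ))) = v i := by
    intro i
    rw [hp, finsetSum_coeff, Finset.sum_eq_single i]
    · simp
    · intro j _ hj
      rw [coeff_C_mul, coeff_X_pow, if_neg, mul_zero]
      intro h
      exact hj (Fin.ext (by omega))
    · simp
  have hp0 : p = 0 := by
    by_contra hne
    -- Multiplicity at most two matters here: p(y) = p'(y) = 0 gives a double root in every
    -- characteristic, while the analogue for higher derivatives can fail in positive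
    -- characteristic.
    have hle : Y ≤ p.roots := by
      rw [Multiset.le_iff_count]
      intro y
      rw [count_roots]
      have h1 : 0 < Y.count y → p.IsRoot y := fun hpos => by
        obtain ⟨b, hb⟩ := exists_confluentCols Y (c := (y, 0)) hpos
        simpa [hb, evalDeriv] using hev b
      have h2 : 1 < Y.count y → (derivative p).IsRoot y := fun hpos => by
        obtain ⟨b, hb⟩ := exists_confluentCols Y (c := (y, 1)) hpos
        simpa [hb, evalDeriv] using hev b
      rcases Nat.lt_or_ge 1 (Y.count y) with h | h
      · have := (one_lt_rootMultiplicity_iff_isRoot hne).2 ⟨h1 (by omega), h2 h⟩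
        have := hY y
        omega
      · rcases Nat.eq_zero_or_pos (Y.count y) with h' | h'
        · omega
        · have := (rootMultiplicity_pos hne).2 (h1 h')
          omega
    have hc := (Multiset.card_le_card hle).trans (card_roots' p)
    have hdeg : p.natDegree < Y.card := by
      have hpos : 0 < Y.card := by
        obtain ⟨i, -⟩ := Function.ne_iff.1 hv
        exact i.pos
      refine lt_of_le_of_lt (natDegree_sum_le_of_forall_le (n := Y.card - 1) _ _ fun i _ => ?_)
        (by omega)
      refine (natDegree_C_mul_X_pow_le _ _).trans (by omega)
    omega
  refine hv (funext fun i => ?_)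
  rw [← hcoeff, hp0, coeff_zero]; rfl

lemma exists_complRows_eq {r x k : ℕ} {R : Finset ℕ} (hr : R.card = r)
    (hx : (Finset.Icc 1 k \ R).card = x) {c : ℕ} (hc : c ∈ Finset.Icc 1 k) :
    ∃ s, complRows k R hr hx s = c := by
  by_cases h : c ∈ R
  · rw [← Finset.mem_coe, ← Finset.range_orderEmbOfFin R hr] at h
    obtain ⟨i, hi⟩ := h
    exact ⟨.inl i, hi⟩
  · have h : c ∈ Finset.Icc 1 k \ R := Finset.mem_sdiff.2 ⟨hc, h⟩
    rw [← Finset.mem_coe, ← Finset.range_orderEmbOfFin _ hx] at h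
    obtain ⟨i, hi⟩ := h
    exact ⟨.inr i, hi⟩

/-- Complementary minors by one product G * P. The columns of P are the coefficients of t ^ j
`rootPoly Y` followed by the monomials of degree < |Y|; its rows list R before the complement,
whence the sign. G keeps the rows in R and applies the confluent functionals below, so det G is the
determinant with the rows R removed. In G * P the functionals kill the multiples of `rootPoly Y`,
which leaves the R-minor and the square confluent Vandermonde matrix as diagonal blocks. -/
lemma det_confluentVandermonde_mul [DecidableEq F] {k : ℕ} {R : Finset ℕ}
    (hRk : R ⊆ Finset.Icc 1 k) {r : ℕ} (hr : R.card = r) (Y : Multiset F)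
    (hx : (Finset.Icc 1 k \ R).card = Y.card) (h₀ : (Finset.Icc 1 Y.card \ ∅).card = Y.card) :
    (-1) ^ (∑ i ∈ R, (i + 1)) * (confluentVandermonde k R Y hx).det =
      rowMinor R (fun i (j : Fin r) => (X ^ (j : ℕ) * rootPoly Y).coeff (k - i)) *
        (confluentVandermonde Y.card ∅ Y h₀).det := by
  have hk := card_add_card_compl hRk hr hx
  have hdeg : ∀ j : ℕ, (X ^ j * rootPoly Y).natDegree = Y.card + j := fun j => by
    rw [(monic_X_pow j).natDegree_mul (rootPoly_monic Y), natDegree_X_pow, natDegree_rootPoly,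
      add_comm]
  let q : Fin r ⊕ Fin Y.card → F[X] := Sum.elim (fun j => X ^ (j : ℕ) * rootPoly Y)
    (fun j => X ^ (Y.card - (1 + (j : ℕ))))
  have hq : ∀ j, (q j).natDegree < k := by
    rintro (j | j)
    · simp only [q, Sum.elim_inl, hdeg]; omega
    · simp only [q, Sum.elim_inr, natDegree_X_pow]; omega
  let P : Matrix (Fin r ⊕ Fin Y.card) (Fin r ⊕ Fin Y.card) F :=
    Matrix.of fun s j => (q j).coeff (k - complRows k R hr hx s)
  let G : Matrix (Fin r ⊕ Fin Y.card) (Fin r ⊕ Fin Y.card) F :=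
    Matrix.of fun t s => Sum.elim (fun i => if (.inl i) = s then 1 else 0)
      (fun b => evalDeriv (confluentCols Y b) (X ^ (k - complRows k R hr hx s))) t
  have hP : P.det = (-1) ^ (∑ i ∈ R, (i + 1)) := by
    rw [det_complRows hRk hr hx (fun i j => (q j).coeff i), det_of_sum_zero₁₂,
      show (Matrix.of fun i j : Fin r => (q (.inl j)).coeff (shiftExp r Y.card (.inl i))).det = 1
        from det_coeff_of_monic (fun j : Fin r => X ^ (j : ℕ) * rootPoly Y)
        (fun j => (monic_X_pow _).mul (rootPoly_monic Y)) (fun j => hdeg j), one_mul]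
    · have : (Matrix.of fun i j : Fin Y.card =>
          (q (.inr j)).coeff (shiftExp r Y.card (.inr i))) = 1 := by
        ext i j
        simp only [q, shiftExp, Sum.elim_inr, Matrix.of_apply, coeff_X_pow, Matrix.one_apply]
        refine if_congr ⟨fun h => Fin.ext (by omega), fun h => by subst h; omega⟩ rfl rfl
      rw [this, Matrix.det_one, mul_one]
    · intro i j
      simp only [q, shiftExp, Sum.elim_inr, Sum.elim_inl, coeff_X_pow]
      exact if_neg (by omega)
  have hG : G.det = (confluentVandermonde k R Y hx).det := by
    rw [det_of_sum_zero₁₂]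
    · have : (Matrix.of fun i j : Fin r => Sum.elim (fun i => if (.inl i) =
          (Sum.inl j : Fin r ⊕ Fin Y.card) then (1 : F) else 0) (fun b : Fin Y.card =>
            evalDeriv (confluentCols Y b)
            (X ^ (k - complRows k R hr hx (.inl j)))) (.inl i)) = 1 := by
        ext i j
        simp [Matrix.one_apply]
      rw [this, Matrix.det_one, one_mul, ← Matrix.det_transpose]
      congr 1
      ext i j
      simp [confluentVandermonde, evalDeriv_X_pow, complRows]
    · intro i j
      simp
  have hGP : (G * P).det =
      rowMinor R (fun i (j : Fin r) => (X ^ (j : ℕ) * rootPoly Y).coeff (k - i)) *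
        (confluentVandermonde Y.card ∅ Y h₀).det := by
    have hl : ∀ i j, (G * P) (.inl i) j = (q j).coeff (k - complRows k R hr hx (.inl i)) := by
      intro i j
      simp [Matrix.mul_apply, G, P]
    have hrr : ∀ b j, (G * P) (.inr b) j = evalDeriv (confluentCols Y b) (q j) := by
      intro b j
      rw [evalDeriv_eq_sum _ (hq j), Matrix.mul_apply]
      refine Finset.sum_bij (fun s _ => k - complRows k R hr hx s) ?_ ?_ ?_ ?_
      · intro s _
        have := Finset.mem_Icc.1 (complRows_mem hRk hr hx s)
        exact Finset.mem_range.2 (by omega)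
      · intro s _ t _ h
        have := Finset.mem_Icc.1 (complRows_mem hRk hr hx s)
        have := Finset.mem_Icc.1 (complRows_mem hRk hr hx t)
        exact complRows_injective hr hx (by omega)
      · intro c hc
        have := Finset.mem_range.1 hc
        obtain ⟨s, hs⟩ := exists_complRows_eq hr hx (c := k - c) (Finset.mem_Icc.2 (by omega))
        exact ⟨s, Finset.mem_univ _, by rw [hs]; omega⟩
      · intro s _
        simp only [G, P, Matrix.of_apply, Sum.elim_inr]
        ring
    rw [show (G * P) = Matrix.of (fun i j => (G * P) i j) from rfl, det_of_sum_zero₂₁]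
    · rw [rowMinor_of_card hr]
      congr 1
      · congr 1
        ext i j
        rw [Matrix.of_apply, hl]
        rfl
      · rw [← Matrix.det_transpose]
        congr 1
        ext i j
        rw [Matrix.transpose_apply, Matrix.of_apply, hrr, confluentVandermonde, Matrix.of_apply,
          orderEmbOfFin_Icc_sdiff_empty]
        exact evalDeriv_X_pow _ _ _
    · intro i j
      rw [hrr]
      exact evalDeriv_confluentCols_mul Y i _
  rw [← hGP, Matrix.det_mul, hP, hG, mul_comm]

/-- A Schur polynomial of a multiset as a minor of the coefficient matrix of the multiples of
`∏ (t - y)`. -/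
lemma schurS_eq_rowMinor {k : ℕ} {R : Finset ℕ} (hRk : R ⊆ Finset.Icc 1 k) {r : ℕ}
    (hr : R.card = r) (Y : Multiset F) [DecidableEq F] (hY : ∀ y, Y.count y ≤ 2)
    (hk : r + Y.card = k) :
    schurS k R Y = (-1) ^ (∑ i ∈ R, (i + 1)) *
      rowMinor R (fun i (j : Fin r) => (X ^ (j : ℕ) * rootPoly Y).coeff (k - i)) := by
  have hx : (Finset.Icc 1 k \ R).card = Y.card := by
    rw [Finset.card_sdiff_of_subset hRk, Nat.card_Icc]; omega
  have hinst : (fun a b => Classical.propDecidable (a = b)) = ‹DecidableEq F› :=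
    Subsingleton.elim _ _
  rw [schurS, dif_pos hx, hinst]
  have h₀ : (Finset.Icc 1 Y.card \ ∅).card = Y.card := by simp
  have h1 := det_confluentVandermonde_ne_zero Y hY h₀
  have h2 := det_confluentVandermonde_mul hRk hr Y hx h₀
  rw [div_eq_iff h1, mul_assoc, ← h2, ← mul_assoc, ← pow_add, Even.neg_one_pow ⟨_, rfl⟩, one_mul]

end ConfluentSchur

/-! ### From sums over partitions to a single determinant. -/

section PartitionSums

variable {F : Type*} [CommRing F]

/-- The case of `det_complRows` where R is everything and the complement is empty. -/
lemma det_reverse_rows {n : ℕ} (M : ℕ → Fin n → F) :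
    (Matrix.of fun i j : Fin n => M (n - (1 + (i : ℕ))) j).det =
      (-1) ^ (∑ i ∈ Finset.Icc 1 n, (i + 1)) * (Matrix.of fun i j : Fin n => M i j).det := by
  have hr : (Finset.Icc 1 n).card = n := by simp
  have hx : (Finset.Icc 1 n \ Finset.Icc 1 n).card = 0 := by simp
  have := det_complRows (Finset.Subset.refl _) hr hx
    (fun i j => M i (Equiv.sumEmpty (Fin n) (Fin 0) j))
  rw [← det_of_reindex (Equiv.sumEmpty (Fin n) (Fin 0)).symm,
    ← det_of_reindex (Equiv.sumEmpty (Fin n) (Fin 0)).symm] at this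
  simpa [complRows, shiftExp, orderEmbOfFin_Icc] using this

lemma det_reverse_rows₃ {a b c : ℕ} (M : ℕ → Fin a ⊕ Fin b ⊕ Fin c → F) :
    (Matrix.of fun i j => M (a + (b + c) - (1 + pos₃ i)) j).det =
      (-1) ^ (∑ i ∈ Finset.Icc 1 (a + (b + c)), (i + 1)) *
        (Matrix.of fun i j => M (pos₃ i) j).det := by
  have := det_reverse_rows (fun i j => M i ((finSumEquiv₃ a b c).symm j))
  rw [← det_of_reindex (finSumEquiv₃ a b c), ← det_of_reindex (finSumEquiv₃ a b c)] at this
  simpa [coe_finSumEquiv₃] using this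

/-- The families `t ^ j h₁`, `t ^ j h₂`, `t ^ j h₃`, one after the other. -/
noncomputable def shifts₃ (r₁ r₂ r₃ : ℕ) (h₁ h₂ h₃ : F[X]) : Fin r₁ ⊕ Fin r₂ ⊕ Fin r₃ → F[X] :=
  Sum.elim (fun j => X ^ (j : ℕ) * h₁)
    (Sum.elim (fun j => X ^ (j : ℕ) * h₂) (fun j => X ^ (j : ℕ) * h₃))

/-- Row i of a partition carries the coefficients of degree L + T - i, where T = r₁ + (r₂ + r₃), so
the rows come in reverse order. The signs attached to the three parts multiply to (-1) to the sum of
i + 1 over {1, …, T}, which is exactly the sign of that reversal. The ε's absorb further signs, such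
as the one from shifting the index set R₁. -/
lemma sum_partitions₃_of_eq_rowMinor {r₁ r₂ r₃ L : ℕ} (h₁ h₂ h₃ : F[X])
    (s₁ s₂ s₃ : Finset ℕ → F) (ε₁ ε₂ ε₃ : F)
    (hs₁ : ∀ R ⊆ Finset.Icc 1 (r₁ + (r₂ + r₃)), R.card = r₁ →
      s₁ R = ε₁ * ((-1) ^ (∑ i ∈ R, (i + 1)) * rowMinor R
        (fun i (j : Fin r₁) => (X ^ (j : ℕ) * h₁).coeff (L + (r₁ + (r₂ + r₃)) - i))))
    (hs₂ : ∀ R ⊆ Finset.Icc 1 (r₁ + (r₂ + r₃)), R.card = r₂ →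
      s₂ R = ε₂ * ((-1) ^ (∑ i ∈ R, (i + 1)) * rowMinor R
        (fun i (j : Fin r₂) => (X ^ (j : ℕ) * h₂).coeff (L + (r₁ + (r₂ + r₃)) - i))))
    (hs₃ : ∀ R ⊆ Finset.Icc 1 (r₁ + (r₂ + r₃)), R.card = r₃ →
      s₃ R = ε₃ * ((-1) ^ (∑ i ∈ R, (i + 1)) * rowMinor R
        (fun i (j : Fin r₃) => (X ^ (j : ℕ) * h₃).coeff (L + (r₁ + (r₂ + r₃)) - i)))) :
    ∑ R ∈ (partitions₃ (r₁ + (r₂ + r₃))).filter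
        (fun R => R.1.card = r₁ ∧ R.2.1.card = r₂ ∧ R.2.2.card = r₃),
      ((partSign [R.1, R.2.1, R.2.2] : ℤˣ) : ℤ) * (s₁ R.1 * s₂ R.2.1 * s₃ R.2.2)
      = ε₁ * ε₂ * ε₃ *
        (Matrix.of fun i j => (shifts₃ r₁ r₂ r₃ h₁ h₂ h₃ j).coeff (L + pos₃ i)).det := by
  set T := r₁ + (r₂ + r₃) with hT
  have key := sum_partitions₃_rowMinor (r₁ := r₁) (r₂ := r₂) (r₃ := r₃)
    (fun i j => (shifts₃ r₁ r₂ r₃ h₁ h₂ h₃ j).coeff (L + T - i))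
  have hrev := det_reverse_rows₃ (a := r₁) (b := r₂) (c := r₃)
    (fun i j => (shifts₃ r₁ r₂ r₃ h₁ h₂ h₃ j).coeff (L + i))
  have hrow : ∀ i : Fin r₁ ⊕ Fin r₂ ⊕ Fin r₃,
      L + T - (1 + pos₃ i) = L + (T - (1 + pos₃ i)) := fun i => by
    have := pos₃_lt i; omega
  simp only [hrow] at key
  rw [hrev] at key
  have h1 : ∀ E : ℕ, ((-1 : F) ^ E) * (-1) ^ E = 1 := fun E => by
    rw [← pow_add]; exact Even.neg_one_pow ⟨_, rfl⟩
  have : (Matrix.of fun i j => (shifts₃ r₁ r₂ r₃ h₁ h₂ h₃ j).coeff (L + pos₃ i)).det =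
      (-1) ^ (∑ i ∈ Finset.Icc 1 T, (i + 1)) * ((-1) ^ (∑ i ∈ Finset.Icc 1 T, (i + 1)) *
        (Matrix.of fun i j => (shifts₃ r₁ r₂ r₃ h₁ h₂ h₃ j).coeff (L + pos₃ i)).det) := by
    rw [← mul_assoc, h1, one_mul]
  rw [this, ← key, Finset.mul_sum, Finset.mul_sum]
  refine Finset.sum_congr rfl fun R hR => ?_
  obtain ⟨hR, c1, c2, c3⟩ := Finset.mem_filter.1 hR
  obtain ⟨h12, h13, h23, hu⟩ := mem_partitions₃.1 hR
  have sub1 : R.1 ⊆ Finset.Icc 1 T := by rw [← hu]; exact fun x hx => by simp [hx]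
  have sub2 : R.2.1 ⊆ Finset.Icc 1 T := by rw [← hu]; exact fun x hx => by simp [hx]
  have sub3 : R.2.2 ⊆ Finset.Icc 1 T := by rw [← hu]; exact fun x hx => by simp [hx]
  rw [hs₁ _ sub1 c1, hs₂ _ sub2 c2, hs₃ _ sub3 c3, ← hu,
    Finset.sum_union (Finset.disjoint_union_left.2 ⟨h13, h23⟩), Finset.sum_union h12, pow_add,
    pow_add]
  simp only [shifts₃, Sum.elim_inl, Sum.elim_inr]
  ring

lemma mem_partitions₂ {r : ℕ} {R : Finset ℕ × Finset ℕ} :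
    R ∈ partitions₂ r ↔ Disjoint R.1 R.2 ∧ R.1 ∪ R.2 = Finset.Icc 1 r := by
  simp only [partitions₂, Finset.mem_filter, Finset.mem_product, Finset.mem_powerset,
    and_iff_right_iff_imp]
  rintro ⟨-, h⟩
  rw [← h]
  exact ⟨Finset.subset_union_left, Finset.subset_union_right⟩

lemma sum_partitions₂_eq_sum_partitions₃ {S : Type*} [AddCommMonoid S] {r r₂ r₃ : ℕ}
    (f : Finset ℕ × Finset ℕ × Finset ℕ → S) :
    ∑ R ∈ (partitions₂ r).filter (fun R => R.1.card = r₂ ∧ R.2.card = r₃), f (∅, R.1, R.2) =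
      ∑ R ∈ (partitions₃ r).filter
        (fun R => R.1.card = 0 ∧ R.2.1.card = r₂ ∧ R.2.2.card = r₃), f R := by
  refine Finset.sum_bij (fun R _ => (∅, R.1, R.2)) ?_ ?_ ?_ ?_
  · intro R hR
    simp only [Finset.mem_filter, mem_partitions₂, mem_partitions₃] at hR ⊢
    simpa using hR
  · intro R _ R' _ h
    simpa [Prod.ext_iff] using h
  · rintro ⟨R₁, R₂, R₃⟩ hR
    simp only [Finset.mem_filter, mem_partitions₃, Finset.card_eq_zero] at hR
    obtain ⟨hR, rfl, h2, h3⟩ := hR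
    refine ⟨(R₂, R₃), ?_, rfl⟩
    simp only [Finset.mem_filter, mem_partitions₂]
    simpa [h2, h3] using hR
  · intro R _
    rfl

lemma partSign_empty_cons (L : List (Finset ℕ)) : partSign (∅ :: L) = partSign L := by
  have h : ((∅ : Finset ℕ) :: L).flatMap (fun R => R.sort (· ≤ ·)) =
      L.flatMap fun R => R.sort (· ≤ ·) := by simp
  have key : ∀ l l' : List ℕ, l = l' →
      Equiv.Perm.sign (Tuple.sort l.get) = Equiv.Perm.sign (Tuple.sort l'.get) := by
    rintro l _ rfl; rfl
  exact key _ _ h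

end PartitionSums

/-! ### Determinants of values and coefficients as sums over subsets of nodes. -/

section Laplace

variable {ι F : Type*} [DecidableEq ι] [Field F]

lemma exists_enumeration {A : Finset ι} {n : ℕ} (hA : A.card = n) :
    ∃ v : Fin n → ι, Function.Injective v ∧ (∀ i, v i ∈ A) ∧ Finset.univ.image v = A := by
  let e := (A.equivFinOfCardEq hA).symm
  refine ⟨fun i => e i, Subtype.val_injective.comp e.injective, fun i => (e i).2, ?_⟩
  ext a
  simp only [Finset.mem_image, Finset.mem_univ, true_and]
  exact ⟨by rintro ⟨i, rfl⟩; exact (e i).2, fun h => ⟨e.symm ⟨a, h⟩, by simp⟩⟩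

/-- The Laplace expansion along two blocks of columns, divided by the Vandermonde determinant:
the quotients do not depend on the order of the rows. -/
lemma det_eq_sum_powersetCard_mul_vdmSum {d e : ℕ} {A : Finset ι} {α : ι → F}
    (hα : Set.InjOn α A) (hA : A.card = d + e) (φ : Fin d → ι → F) (ψ : Fin e → ι → F)
    (Φ Ψ : Finset ι → F)
    (hΦ : ∀ v : Fin d → ι, Function.Injective v → (∀ i, v i ∈ A) →
      (Matrix.of fun i j => φ j (v i)).det =
        Φ (Finset.univ.image v) * (Matrix.vandermonde fun i => α (v i)).det)
    (hΨ : ∀ v : Fin e → ι, Function.Injective v → (∀ i, v i ∈ A) →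
      (Matrix.of fun i j => ψ j (v i)).det =
        Ψ (Finset.univ.image v) * (Matrix.vandermonde fun i => α (v i)).det)
    {w : Fin d ⊕ Fin e → ι} (hw : Function.Injective w) (hwA : ∀ i, w i ∈ A) :
    (Matrix.of fun i j => Sum.elim φ ψ j (w i)).det =
      (∑ A₁ ∈ A.powersetCard d, Φ A₁ * Ψ (A \ A₁) / ∏ a ∈ A₁, ∏ b ∈ A \ A₁, (α b - α a)) *
        vdmSum fun i => α (w i) := by
  have hwim : Finset.univ.image w = A := by
    refine Finset.eq_of_subset_of_card_le (Finset.image_subset_iff.2 fun i _ => hwA i) ?_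
    rw [Finset.card_image_of_injective _ hw, hA]; simp
  -- Permutations are grouped by the set A₁ of nodes met by the first block of columns.
  let g : Equiv.Perm (Fin d ⊕ Fin e) → Finset ι :=
    fun σ => Finset.univ.image fun j => w (σ (.inl j))
  have hg : ∀ σ, g σ ∈ A.powersetCard d := fun σ => by
    rw [Finset.mem_powersetCard]
    refine ⟨Finset.image_subset_iff.2 fun i _ => hwA _, ?_⟩
    rw [Finset.card_image_of_injective _ fun i j h => ?_, Finset.card_univ, Fintype.card_fin]
    simpa using hw h
  rw [det_eq_sum_fiberwise _ g _ hg (fun A₁ i j => (w i ∈ A₁ ↔ j.isLeft = true)), Finset.sum_mul]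
  · refine Finset.sum_congr rfl fun A₁ hA₁ => ?_
    obtain ⟨hsub, hcard⟩ := Finset.mem_powersetCard.1 hA₁
    have hcard' : (A \ A₁).card = e := by rw [Finset.card_sdiff_of_subset hsub]; omega
    obtain ⟨v₁, hv₁, hm₁, hi₁⟩ := exists_enumeration hcard
    obtain ⟨v₂, hv₂, hm₂, hi₂⟩ := exists_enumeration hcard'
    have hm₁' : ∀ i, v₁ i ∈ A := fun i => hsub (hm₁ i)
    have hm₂' : ∀ i, v₂ i ∈ A := fun i => (Finset.mem_sdiff.1 (hm₂ i)).1
    have hm₂'' : ∀ i, v₂ i ∉ A₁ := fun i => (Finset.mem_sdiff.1 (hm₂ i)).2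
    have hv : Function.Injective (Sum.elim v₁ v₂) :=
      hv₁.sumElim hv₂ fun i j h => hm₂'' j (h ▸ hm₁ i)
    have hvA : ∀ i, Sum.elim v₁ v₂ i ∈ A := by rintro (i | i); exacts [hm₁' i, hm₂' i]
    obtain ⟨π, hπ⟩ := exists_perm_comp hv (w := w) fun i => by
      have := hvA i
      rw [← hwim] at this
      simpa using this
    have hdet := det_of_perm_rows hπ
      (fun c j => if (c ∈ A₁ ↔ j.isLeft = true) then Sum.elim φ ψ j c else 0)
    -- The sign of listing A₁ before A ∖ A₁ also occurs in the Vandermonde determinant; dividing by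
    -- the latter removes it.
    have hvdm : vdmSum (fun i => α (Sum.elim v₁ v₂ i)) =
        (Equiv.Perm.sign π : ℤ) * vdmSum fun i => α (w i) :=
      det_of_perm_rows hπ (fun c j => α c ^ pos₂ j)
    have hprod : ∏ i, ∏ j, (α (v₂ j) - α (v₁ i)) = ∏ a ∈ A₁, ∏ b ∈ A \ A₁, (α b - α a) := by
      conv_rhs => rw [← hi₁, Finset.prod_image fun i _ j _ h => hv₁ h]
      refine Finset.prod_congr rfl fun i _ => ?_
      conv_rhs => rw [hi₁, ← hi₂, Finset.prod_image fun i _ j _ h => hv₂ h]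
    have hne : ∏ a ∈ A₁, ∏ b ∈ A \ A₁, (α b - α a) ≠ 0 := by
      refine Finset.prod_ne_zero_iff.2 fun a ha => Finset.prod_ne_zero_iff.2 fun b hb => ?_
      obtain ⟨hb, hb'⟩ := Finset.mem_sdiff.1 hb
      exact sub_ne_zero.2 fun h => hb' (hα hb (hsub ha) h ▸ ha)
    rw [vdmSum_eq_mul] at hvdm
    simp only [Sum.elim_inl, Sum.elim_inr] at hvdm
    rw [hprod] at hvdm
    rw [det_of_sum_zero₂₁] at hdet
    · simp only [Sum.elim_inl, Sum.elim_inr, hm₁, hm₂'', Sum.isLeft_inl, Sum.isLeft_inr,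
        if_true, iff_self, Bool.false_eq_true] at hdet
      rw [hΦ v₁ hv₁ hm₁', hΨ v₂ hv₂ hm₂', hi₁, hi₂] at hdet
      have hs : (((Equiv.Perm.sign π : ℤˣ) : ℤ) : F) ≠ 0 := by
        rcases Int.units_eq_one_or (Equiv.Perm.sign π) with h | h <;> simp [h]
      refine mul_left_cancel₀ hs ?_
      rw [← hdet, mul_left_comm (((Equiv.Perm.sign π : ℤˣ) : ℤ) : F), ← hvdm]
      field_simp
    · intro i j
      simp [hm₂'']
  · intro σ A₁ hA₁
    obtain ⟨hsub, hcard⟩ := Finset.mem_powersetCard.1 hA₁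
    constructor
    · intro h
      refine Finset.eq_of_subset_of_card_le
        (Finset.image_subset_iff.2 fun j _ => (h (.inl j)).2 rfl) ?_
      rw [hcard, (Finset.mem_powersetCard.1 (hg σ)).2]
    · rintro rfl (j | j)
      · simp only [Sum.isLeft_inl, iff_true]
        exact Finset.mem_image_of_mem (fun j => w (σ (.inl j))) (Finset.mem_univ j)
      · simp only [Sum.isLeft_inr, Bool.false_eq_true, iff_false, g, Finset.mem_image,
          Finset.mem_univ, true_and, not_exists]
        intro i h
        simpa using hw h

/-- The determinant of the coefficients of polynomials `χ j` and `t ^ j ∏ (t - y i)` in terms of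
the values `χ j (y i)`. -/
lemma det_coeff_mul_vandermonde {m s : ℕ} (χ : Fin m → F[X]) (y : Fin m → F)
    (hχ : ∀ j, (χ j).natDegree < m + s) :
    (Matrix.of fun i j : Fin m ⊕ Fin s =>
      (Sum.elim χ (fun j : Fin s => X ^ (j : ℕ) * ∏ i, (X - C (y i))) j).coeff (pos₂ i)).det *
        (Matrix.vandermonde y).det = (Matrix.of fun i j => (χ j).eval (y i)).det := by
  set f : F[X] := ∏ i, (X - C (y i)) with hf
  have hfm : f.Monic := monic_prod_of_monic _ _ fun a _ => monic_X_sub_C _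
  have hfd : f.natDegree = m := by
    rw [hf, natDegree_prod_of_monic _ _ fun a _ => monic_X_sub_C _]
    simp
  have hfdj : ∀ j : ℕ, (X ^ j * f).natDegree = m + j := fun j => by
    rw [(monic_X_pow j).natDegree_mul hfm, natDegree_X_pow, hfd, add_comm]
  let q : Fin m ⊕ Fin s → F[X] := Sum.elim χ (fun j => X ^ (j : ℕ) * f)
  have hq : ∀ j, (q j).natDegree < m + s := by
    rintro (j | j)
    · exact hχ j
    · simp only [q, Sum.elim_inr, hfdj]; omega
  let P : Matrix (Fin m ⊕ Fin s) (Fin m ⊕ Fin s) F := Matrix.of fun i j => (q j).coeff (pos₂ i)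
  -- The upper rows of G turn coefficients into values at the y i, the lower rows select the degrees
  -- ≥ m. The shifts of f have value zero at every y i, and their selected coefficients form a
  -- unitriangular block.
  let G : Matrix (Fin m ⊕ Fin s) (Fin m ⊕ Fin s) F :=
    Matrix.of fun i c => Sum.elim (fun x => y x ^ pos₂ c) (fun r => if c = .inr r then 1 else 0) i
  have hG : G.det = (Matrix.vandermonde y).det := by
    rw [det_of_sum_zero₂₁]
    · have : (Matrix.of fun i j : Fin s => Sum.elim (fun x => y x ^ pos₂ (.inr j : Fin m ⊕ Fin s))
          (fun r => if (.inr j : Fin m ⊕ Fin s) = .inr r then (1 : F) else 0)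
          (.inr i : Fin m ⊕ Fin s)) = 1 := by
        ext i j
        simp [Matrix.one_apply, eq_comm]
      rw [this, Matrix.det_one, mul_one]
      rfl
    · intro i j
      simp
  have hl : ∀ x j, (G * P) (.inl x) j = (q j).eval (y x) := by
    intro x j
    rw [eval_eq_sum_range' (hq j), Matrix.mul_apply]
    refine Finset.sum_bij (fun c _ => pos₂ c) ?_ ?_ ?_ ?_
    · intro c _
      exact Finset.mem_range.2 (pos₂_lt _)
    · intro c _ c' _ h
      exact pos₂_injective h
    · intro c hc
      obtain ⟨i, hi⟩ := exists_pos₂_eq (Finset.mem_range.1 hc)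
      exact ⟨i, Finset.mem_univ _, hi⟩
    · intro c _
      simp only [G, P, Matrix.of_apply, Sum.elim_inl]
      ring
  have hr : ∀ r j, (G * P) (.inr r) j = (q j).coeff (m + r) := by
    intro r j
    simp [Matrix.mul_apply, G, P]
  have hGP : (G * P).det = (Matrix.of fun i j => (χ j).eval (y i)).det := by
    rw [show (G * P) = Matrix.of (fun i j => (G * P) i j) from rfl, det_of_sum_zero₁₂]
    · have h1 : (Matrix.of fun i j : Fin s => (G * P) (.inr i) (.inr j)).det = 1 := by
        simp only [hr]
        exact det_coeff_of_monic (fun j : Fin s => X ^ (j : ℕ) * f)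
          (fun j => (monic_X_pow _).mul hfm) (fun j => hfdj j)
      rw [h1, mul_one]
      simp only [hl]
      rfl
    · intro x j
      rw [hl]
      simp [q, hf, eval_prod, Finset.prod_eq_zero (Finset.mem_univ x)]
  rw [← hGP, Matrix.det_mul, hG, mul_comm]

/-- A Sylvester-type determinant of the coefficients of polynomials `φ j`, `t ^ j g` and
`t ^ j ∏ (t - α a)` as a sum over subsets. -/
lemma det_coeff_eq_sum_powersetCard {d e s : ℕ} {A : Finset ι} {α : ι → F}
    (hα : Set.InjOn α A) (hA : A.card = d + e) (φ : Fin d → F[X]) (g : F[X])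
    (hφd : ∀ j, (φ j).natDegree < d + (e + s))
    (hgd : ∀ j : Fin e, (X ^ (j : ℕ) * g).natDegree < d + (e + s)) (Φ : Finset ι → F)
    (hΦ : ∀ v : Fin d → ι, Function.Injective v → (∀ i, v i ∈ A) →
      (Matrix.of fun i j => (φ j).eval (α (v i))).det =
        Φ (Finset.univ.image v) * (Matrix.vandermonde fun i => α (v i)).det) :
    (Matrix.of fun i j : Fin d ⊕ Fin e ⊕ Fin s =>
      (Sum.elim φ (Sum.elim (fun j : Fin e => X ^ (j : ℕ) * g)
        (fun j : Fin s => X ^ (j : ℕ) * ∏ a ∈ A, (X - C (α a)))) j).coeff (pos₃ i)).det =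
      ∑ A₁ ∈ A.powersetCard d, Φ A₁ * (∏ a ∈ A \ A₁, g.eval (α a)) /
        ∏ a ∈ A₁, ∏ b ∈ A \ A₁, (α b - α a) := by
  obtain ⟨v, hv, hvA, hvim⟩ := exists_enumeration hA
  have hf : ∏ a ∈ A, (X - C (α a)) = ∏ i, (X - C (α (v i))) := by
    rw [← hvim, Finset.prod_image fun i _ j _ h => hv h]
  let χ : Fin d ⊕ Fin e → F[X] := Sum.elim φ fun j => X ^ (j : ℕ) * g
  have key := det_coeff_mul_vandermonde (s := s) (fun j => χ (finSumFinEquiv.symm j))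
    (fun i => α (v i)) (fun j => by
      rcases finSumFinEquiv.symm j with j | j
      · exact (hφd j).trans_eq (add_assoc _ _ _).symm
      · exact (hgd j).trans_eq (add_assoc _ _ _).symm)
  have h1 : (Matrix.of fun i j => (χ (finSumFinEquiv.symm j)).eval (α (v i))).det =
      (∑ A₁ ∈ A.powersetCard d, Φ A₁ * (∏ a ∈ A \ A₁, g.eval (α a)) /
        ∏ a ∈ A₁, ∏ b ∈ A \ A₁, (α b - α a)) * (Matrix.vandermonde fun i => α (v i)).det := by
    -- A minor of the block t ^ j g on A₂ is ∏_{a ∈ A₂} g(α a) times a Vandermonde determinant.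
    have h2 := det_eq_sum_powersetCard_mul_vdmSum hα hA (fun j a => (φ j).eval (α a))
        (fun j a => (X ^ (j : ℕ) * g).eval (α a)) Φ (fun A₂ => ∏ a ∈ A₂, g.eval (α a))
        hΦ (fun v hv _ => by
          rw [Finset.prod_image fun i _ j _ h => hv h, Matrix.vandermonde, ← det_of_mul_left]
          congr 1
          ext i j
          simp [mul_comm]) (hv.comp finSumFinEquiv.injective) (fun i => hvA _)
    rw [vdmSum_eq_vandermonde] at h2
    simp only [Function.comp_apply, Equiv.apply_symm_apply] at h2
    rw [← h2, ← det_of_reindex finSumFinEquiv]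
    congr 1
    ext i (j | j) <;> simp [χ]
  have h3 : (Matrix.of fun i j : Fin d ⊕ Fin e ⊕ Fin s =>
      (Sum.elim φ (Sum.elim (fun j : Fin e => X ^ (j : ℕ) * g)
        (fun j : Fin s => X ^ (j : ℕ) * ∏ a ∈ A, (X - C (α a)))) j).coeff (pos₃ i)).det =
      (Matrix.of fun i j : Fin (d + e) ⊕ Fin s => (Sum.elim (fun j => χ (finSumFinEquiv.symm j))
        (fun j : Fin s => X ^ (j : ℕ) * ∏ i, (X - C (α (v i)))) j).coeff (pos₂ i)).det := by
    rw [← det_of_reindex (finSumFinEquiv.sumCongr (Equiv.refl _)),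
      ← det_of_reindex (Equiv.sumAssoc (Fin d) (Fin e) (Fin s))]
    congr 1
    ext ((i | i) | i) ((j | j) | j) <;> simp [χ, hf, add_assoc]
  have hne : (Matrix.vandermonde fun i => α (v i)).det ≠ 0 :=
    Matrix.det_vandermonde_ne_zero_iff.2 fun i j h => hv (hα (hvA i) (hvA j) h)
  rw [h1] at key
  rw [h3]
  exact mul_right_cancel₀ hne key

end Laplace

/-! ### Sylvester determinants: common factors, subset sums, remainders. -/

section SylvesterDeterminants

section CommRing

variable {F : Type*} [CommRing F]

/-- The determinant of the coefficients of degree `≥ d` of the polynomials `t ^ j u` (`j < e`) and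
`t ^ j v` (`j < s`). -/
noncomputable def sylDet (d e s : ℕ) (u v : F[X]) : F :=
  (Matrix.of fun i j : Fin e ⊕ Fin s =>
    (Sum.elim (fun j : Fin e => X ^ (j : ℕ) * u) (fun j : Fin s => X ^ (j : ℕ) * v) j).coeff
      (d + pos₂ i)).det

/-- Multiplication by a monic polynomial does not change a determinant of leading coefficients. -/
lemma det_coeff_monic_mul {d n : ℕ} {q : F[X]} (hq : q.Monic) (p : Fin n → F[X])
    (hp : ∀ j, (p j).natDegree < d + n) :
    (Matrix.of fun i j : Fin n => (q * p j).coeff (d + q.natDegree + i)).det =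
      (Matrix.of fun i j : Fin n => (p j).coeff (d + i)).det := by
  nontriviality F
  -- The Toeplitz matrix of q is unitriangular. Coefficients of p j below degree d only reach
  -- degrees below d + deg q in q * p j, so the truncated matrices multiply exactly.
  have hU : (Matrix.of fun i k : Fin n => (q * X ^ (k : ℕ)).coeff (q.natDegree + i)).det = 1 :=
    det_coeff_of_monic _ (fun k => hq.mul (monic_X_pow _)) fun k => by
      rw [hq.natDegree_mul (monic_X_pow _), natDegree_X_pow]
  rw [← one_mul (Matrix.of fun i j : Fin n => (p j).coeff (d + i)).det, ← hU, ← Matrix.det_mul]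
  congr 1
  ext i j
  rw [Matrix.of_apply, Matrix.mul_apply]
  have h1 : q * p j = ∑ c ∈ Finset.range (d + n), C ((p j).coeff c) * (q * X ^ c) := by
    conv_lhs => rw [(p j).as_sum_range' _ (hp j)]
    rw [Finset.mul_sum]
    refine Finset.sum_congr rfl fun c _ => ?_
    rw [← C_mul_X_pow_eq_monomial]
    ring
  rw [h1, finsetSum_coeff, Finset.sum_range_add, Finset.sum_eq_zero, zero_add,
    ← Fin.sum_univ_eq_sum_range]
  · refine Finset.sum_congr rfl fun c _ => ?_
    rw [coeff_C_mul, Matrix.of_apply, Matrix.of_apply, mul_comm,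
      show X ^ (d + (c : ℕ)) = X ^ (c : ℕ) * (X : F[X]) ^ d by rw [← pow_add, add_comm],
      ← mul_assoc, show d + q.natDegree + (i : ℕ) = q.natDegree + i + d by omega, coeff_mul_X_pow]
  · intro c hc
    have := Finset.mem_range.1 hc
    rw [coeff_C_mul, coeff_eq_zero_of_natDegree_lt (p := q * X ^ c), mul_zero]
    rw [hq.natDegree_mul (monic_X_pow _), natDegree_X_pow]
    omega

lemma sylDet_monic_mul {d e s : ℕ} {q : F[X]} (hq : q.Monic) (u v : F[X])
    (hu : ∀ j : Fin e, (X ^ (j : ℕ) * u).natDegree < d + (e + s))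
    (hv : ∀ j : Fin s, (X ^ (j : ℕ) * v).natDegree < d + (e + s)) :
    sylDet (d + q.natDegree) e s (q * u) (q * v) = sylDet d e s u v := by
  have := det_coeff_monic_mul (d := d) hq (fun j : Fin (e + s) =>
    (Sum.elim (fun j : Fin e => X ^ (j : ℕ) * u) (fun j : Fin s => X ^ (j : ℕ) * v))
      (finSumFinEquiv.symm j)) (fun j => by
        rcases finSumFinEquiv.symm j with j | j
        exacts [hu j, hv j])
  rw [← det_of_reindex finSumFinEquiv, ← det_of_reindex finSumFinEquiv] at this
  simp only [Equiv.symm_apply_apply, coe_finSumFinEquiv] at this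
  rw [sylDet, sylDet, ← this]
  congr 1
  ext i (j | j) <;> simp only [Matrix.of_apply, Sum.elim_inl, Sum.elim_inr] <;> congr 1 <;> ring

/-- The columns φ j form a unitriangular block in the degrees L, …, L + d - 1 and vanish in all
higher rows. -/
lemma det_coeff_strip {L d e s : ℕ} (φ : Fin d → F[X]) (hφ : ∀ j, (φ j).Monic)
    (hφd : ∀ j, (φ j).natDegree = L + j) (ψ : Fin e ⊕ Fin s → F[X]) :
    (Matrix.of fun i j : Fin d ⊕ Fin e ⊕ Fin s => (Sum.elim φ ψ j).coeff (L + pos₃ i)).det =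
      (Matrix.of fun i j => (ψ j).coeff (L + d + pos₂ i)).det := by
  rw [det_of_sum_zero₂₁]
  · simp only [Sum.elim_inl, Sum.elim_inr, pos₃_inl, pos₃_inr]
    rw [det_coeff_of_monic φ hφ hφd, one_mul]
    simp only [add_assoc]
  · intro i j
    simp only [Sum.elim_inl, pos₃_inr]
    exact coeff_eq_zero_of_natDegree_lt (by rw [hφd]; omega)

lemma det_shifts₃_of_monic {L r₁ e s : ℕ} {h₁ : F[X]} (hm : h₁.Monic) (hd : h₁.natDegree = L)
    (h₂ h₃ : F[X]) :
    (Matrix.of fun i j => (shifts₃ r₁ e s h₁ h₂ h₃ j).coeff (L + pos₃ i)).det =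
      sylDet (L + r₁) e s h₂ h₃ := by
  nontriviality F
  refine det_coeff_strip (fun j : Fin r₁ => X ^ (j : ℕ) * h₁) (fun j => (monic_X_pow _).mul hm)
    (fun j => ?_) _
  rw [(monic_X_pow _).natDegree_mul hm, natDegree_X_pow, hd, add_comm]

lemma det_shifts₃_zero {L e s : ℕ} (h₁ h₂ h₃ : F[X]) :
    (Matrix.of fun i j => (shifts₃ 0 e s h₁ h₂ h₃ j).coeff (L + pos₃ i)).det =
      sylDet L e s h₂ h₃ := by
  exact det_coeff_strip (d := 0) (fun j : Fin 0 => X ^ (j : ℕ) * h₁) (fun j => j.elim0)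
    (fun j => j.elim0) _

end CommRing

variable {ι F : Type*} [DecidableEq ι] [Field F]

/-- Prepending the columns 1, t, …, t ^ (d - 1) accounts for the missing rows of degree < d; their
minors are Vandermonde determinants, so Φ = 1 in the subset expansion. -/
lemma sylDet_eq_sum {d e s : ℕ} {A : Finset ι} {α : ι → F} (hα : Set.InjOn α A)
    (hA : A.card = d + e) (u : F[X])
    (hu : ∀ j : Fin e, (X ^ (j : ℕ) * u).natDegree < d + (e + s)) :
    sylDet d e s u (∏ a ∈ A, (X - C (α a))) =
      ∑ A₁ ∈ A.powersetCard d, (∏ a ∈ A \ A₁, u.eval (α a)) /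
        ∏ a ∈ A₁, ∏ b ∈ A \ A₁, (α b - α a) := by
  have := det_coeff_eq_sum_powersetCard (s := s) hα hA (fun j : Fin d => X ^ (j : ℕ)) u
    (fun j => by rw [natDegree_X_pow]; omega) hu (fun _ => 1) (fun v _ _ => by
      rw [one_mul]
      congr 1
      ext i j
      simp [Matrix.vandermonde_apply])
  simp only [one_mul] at this
  rw [← this]
  have h := det_coeff_strip (L := 0) (fun j : Fin d => (X : F[X]) ^ (j : ℕ))
    (fun j => monic_X_pow _) (fun j => by simp)
    (Sum.elim (fun j : Fin e => X ^ (j : ℕ) * u)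
        (fun j : Fin s => X ^ (j : ℕ) * ∏ a ∈ A, (X - C (α a))))
  simp only [zero_add] at h
  rw [h, sylDet]

/-- The sum vanishes if the degree of `u` is less than `d` and `|A| > d`. -/
lemma sum_powersetCard_eq_zero {d : ℕ} {A : Finset ι} {α : ι → F} (hα : Set.InjOn α A)
    (hA : d < A.card) (u : F[X]) (hu : u.natDegree < d) :
    ∑ A₁ ∈ A.powersetCard d, (∏ a ∈ A \ A₁, u.eval (α a)) /
        ∏ a ∈ A₁, ∏ b ∈ A \ A₁, (α b - α a) = 0 := by
  -- The determinant has at least one column of type u, and u itself has no coefficients of degree ≥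
  -- d.
  obtain ⟨e, he⟩ : ∃ e, A.card = d + (e + 1) := ⟨A.card - d - 1, by omega⟩
  rw [← sylDet_eq_sum (s := 0) hα he]
  · refine Matrix.det_eq_zero_of_column_eq_zero (.inl 0) fun i => ?_
    simp only [Matrix.of_apply, Sum.elim_inl]
    exact coeff_eq_zero_of_natDegree_lt (by simp; omega)
  · intro j
    refine natDegree_mul_le.trans_lt ?_
    rw [natDegree_X_pow]
    omega

/-- The families `1, t, …, t ^ (L - 1)` and `t ^ j w` (`j < δ`), one after the other. -/
noncomputable def monomialsAndShifts (L δ : ℕ) (w : F[X]) : Fin L ⊕ Fin δ → F[X] :=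
  Sum.elim (fun j => X ^ (j : ℕ)) (fun j => X ^ (j : ℕ) * w)

lemma natDegree_X_pow_mul {w : F[X]} (hw : w.Monic) (j : ℕ) :
    (X ^ j * w).natDegree = w.natDegree + j := by
  rw [(monic_X_pow j).natDegree_mul hw, natDegree_X_pow, add_comm]

/-- Once the monomials are stripped, ρ lives in degree L only, and the shifts of w start in degree L
+ 1. The sign moves the column ρ in front of the δ shifts. -/
lemma det_coeff_remainder {L δ : ℕ} {w : F[X]} (hw : w.Monic) (hwd : w.natDegree = L + 1)
    (ρ : F[X]) (hρ : ρ.natDegree ≤ L) :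
    (Matrix.of fun i j : Fin L ⊕ Fin δ ⊕ Fin 1 =>
      (Sum.elim (fun j : Fin L => X ^ (j : ℕ)) (Sum.elim (fun j : Fin δ => X ^ (j : ℕ) * w)
        (fun _ => ρ)) j).coeff (pos₃ i)).det = (-1) ^ δ * ρ.coeff L := by
  have h := det_coeff_strip (L := 0) (fun j : Fin L => (X : F[X]) ^ (j : ℕ))
    (fun j => monic_X_pow _) (fun j => by simp)
    (Sum.elim (fun j : Fin δ => X ^ (j : ℕ) * w) (fun _ : Fin 1 => ρ))
  simp only [zero_add] at h
  rw [h]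
  have h2 := det_block_swap (a := 1) (b := δ)
    (fun i j => (Sum.elim (fun _ : Fin 1 => ρ) (fun j : Fin δ => X ^ (j : ℕ) * w) j).coeff (L + i))
  have h3 : (Matrix.of fun i j : Fin 1 ⊕ Fin δ => (Sum.elim (fun _ : Fin 1 => ρ)
      (fun j : Fin δ => X ^ (j : ℕ) * w) j).coeff (L + pos₂ i)).det = ρ.coeff L := by
    rw [det_of_sum_zero₂₁]
    · simp only [Sum.elim_inl, Sum.elim_inr, pos₂_inl, pos₂_inr, ← add_assoc]
      rw [det_coeff_of_monic (fun j : Fin δ => X ^ (j : ℕ) * w)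
        (fun j => (monic_X_pow _).mul hw) (fun j => by rw [natDegree_X_pow_mul hw, hwd])]
      simp
    · intro i j
      simp only [Sum.elim_inl, pos₂_inr]
      exact coeff_eq_zero_of_natDegree_lt (by omega)
  rw [one_mul, h3] at h2
  rw [← h2]
  congr 1
  ext i (j | j) <;> simp

/-- Subtracting quotient times w turns the column p into its remainder: the quotient has degree < δ,
so only available columns t ^ k w are used. The matrix B performs this unimodular column operation.
-/
lemma det_coeff_monomialsAndShifts {L δ : ℕ} {w : F[X]} (hw : w.Monic) (hwd : w.natDegree = L + 1)
    (p : F[X]) (hp : p.natDegree ≤ L + δ) :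
    (Matrix.of fun i j : (Fin L ⊕ Fin δ) ⊕ Fin 1 =>
      (Sum.elim (monomialsAndShifts L δ w) (fun _ => p) j).coeff
        (pos₃ (Equiv.sumAssoc _ _ _ i))).det = (-1) ^ δ * (p %ₘ w).coeff L := by
  have hρ : (p %ₘ w).natDegree ≤ L := by
    have := natDegree_modByMonic_lt p hw (by rintro rfl; simp at hwd)
    omega
  rw [← det_coeff_remainder hw hwd (p %ₘ w) hρ,
    ← det_of_reindex (Equiv.sumAssoc (Fin L) (Fin δ) (Fin 1))]
  let B : Matrix ((Fin L ⊕ Fin δ) ⊕ Fin 1) ((Fin L ⊕ Fin δ) ⊕ Fin 1) F :=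
    Matrix.of fun i j => Sum.elim (fun x => if i = .inl x then 1 else 0)
      (fun _ => Sum.elim (Sum.elim (fun _ => 0) (fun k : Fin δ => (p /ₘ w).coeff k))
        (fun _ => 1) i) j
  have hB : B.det = 1 := by
    rw [det_of_sum_zero₂₁]
    · have h1 : (Matrix.of fun i j : Fin L ⊕ Fin δ => Sum.elim (fun x =>
          if (.inl i : (Fin L ⊕ Fin δ) ⊕ Fin 1) = .inl x then (1 : F) else 0)
          (fun _ : Fin 1 => Sum.elim (Sum.elim (fun _ => 0) (fun k : Fin δ => (p /ₘ w).coeff k))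
        (fun _ : Fin 1 => 1) (.inl i)) (.inl j)) = 1 := by
        ext i j
        simp [Matrix.one_apply]
      rw [h1, Matrix.det_one, one_mul]
      simp
    · intro i j
      simp
  rw [← mul_one (Matrix.det (Matrix.of fun i j : (Fin L ⊕ Fin δ) ⊕ Fin 1 =>
    (Sum.elim (fun j : Fin L => X ^ (j : ℕ)) (Sum.elim (fun j : Fin δ => X ^ (j : ℕ) * w)
        (fun _ => p %ₘ w)) (Equiv.sumAssoc _ _ _ j)).coeff (pos₃ (Equiv.sumAssoc _ _ _ i)))),
    ← hB, ← Matrix.det_mul]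
  congr 1
  ext i j
  rw [Matrix.mul_apply]
  rcases j with (j | j) | j
  · simp [B, monomialsAndShifts]
  · simp [B, monomialsAndShifts]
  · have hdiv : (p /ₘ w) = ∑ k : Fin δ, C ((p /ₘ w).coeff k) * X ^ (k : ℕ) := by
      have hd : (p /ₘ w).natDegree < δ ∨ p /ₘ w = 0 := by
        rcases Nat.lt_or_ge p.natDegree w.natDegree with h | h
        · right
          exact (divByMonic_eq_zero_iff hw).2 (degree_lt_degree h)
        · left
          rw [natDegree_divByMonic p hw]
          omega
      rcases hd with hd | hd
      · rw [Fin.sum_univ_eq_sum_range (fun k => C ((p /ₘ w).coeff k) * X ^ k)]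
        exact (p /ₘ w).as_sum_range_C_mul_X_pow' hd
      · simp [hd]
    have hp' : p = p %ₘ w + ∑ k : Fin δ, C ((p /ₘ w).coeff k) * (X ^ (k : ℕ) * w) := by
      conv_lhs => rw [← modByMonic_add_div p w, hdiv, Finset.mul_sum]
      congr 1
      refine Finset.sum_congr rfl fun k _ => by ring
    simp only [Matrix.of_apply, Sum.elim_inr, B, Fintype.sum_sum_type, Sum.elim_inl, mul_zero,
      Finset.sum_const_zero, zero_add, Equiv.sumAssoc_apply_inl_inr, Equiv.sumAssoc_apply_inr,
      Finset.univ_unique, Finset.sum_singleton, mul_one]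
    conv_lhs => rw [hp']
    rw [coeff_add, finsetSum_coeff, add_comm]
    congr 1
    refine Finset.sum_congr rfl fun k _ => ?_
    rw [coeff_C_mul, mul_comm]

/-- Values at the y i become coefficients once ∏ (t - y i) is added as a last column, that is,
`det_coeff_mul_vandermonde` with one shift. -/
lemma det_eval_monomialsAndShifts {L δ : ℕ} {w : F[X]} (hw : w.Monic) (hwd : w.natDegree = L + 1)
    (y : Fin (L + δ) → F) :
    (Matrix.of fun i j => (monomialsAndShifts L δ w (finSumFinEquiv.symm j)).eval (y i)).det =
      (-1) ^ δ * ((∏ i, (X - C (y i))) %ₘ w).coeff L * (Matrix.vandermonde y).det := by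
  have hpd : (∏ i, (X - C (y i))).natDegree ≤ L + δ := by
    rw [natDegree_prod_of_monic _ _ fun a _ => monic_X_sub_C _]
    simp
  rw [← det_coeff_mul_vandermonde (s := 1), ← det_coeff_monomialsAndShifts hw hwd _ hpd]
  · congr 1
    rw [← det_of_reindex (finSumFinEquiv.sumCongr (Equiv.refl (Fin 1)))]
    congr 1
    ext ((i | i) | i) ((j | j) | j) <;> simp [monomialsAndShifts]
  · intro j
    rcases finSumFinEquiv.symm j with j | j
    · simp only [monomialsAndShifts, Sum.elim_inl, natDegree_X_pow]
      omega
    · simp only [monomialsAndShifts, Sum.elim_inr, natDegree_X_pow_mul hw, hwd]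
      omega

/-- Prepending 1, …, t ^ (L - 1) supplies the rows of degree < L. Together with the δ shifts of w
these are L + δ columns, whose minors on A₁ are remainder coefficients by
`det_eval_monomialsAndShifts`. -/
lemma det_shifts₃_eq_sum {L δ e s : ℕ} {A : Finset ι} {α : ι → F} (hα : Set.InjOn α A)
    (hA : A.card = L + δ + e) {w : F[X]} (hw : w.Monic) (hwd : w.natDegree = L + 1) (g : F[X])
    (hg : ∀ j : Fin e, (X ^ (j : ℕ) * g).natDegree < L + δ + (e + s)) (hs : 0 < e + s) :
    (Matrix.of fun i j =>
      (shifts₃ δ e s w g (∏ a ∈ A, (X - C (α a))) j).coeff (L + pos₃ i)).det =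
      ∑ A₁ ∈ A.powersetCard (L + δ),
        (-1) ^ δ * ((∏ a ∈ A₁, (X - C (α a))) %ₘ w).coeff L * (∏ a ∈ A \ A₁, g.eval (α a)) /
        ∏ a ∈ A₁, ∏ b ∈ A \ A₁, (α b - α a) := by
  rw [← det_coeff_eq_sum_powersetCard (s := s) hα hA
    (fun j => monomialsAndShifts L δ w (finSumFinEquiv.symm j)) g _ hg
    (fun A₁ => (-1) ^ δ * ((∏ a ∈ A₁, (X - C (α a))) %ₘ w).coeff L)]
  · set f := ∏ a ∈ A, (X - C (α a))
    have h : (Matrix.of fun i j : Fin L ⊕ (Fin δ ⊕ Fin e ⊕ Fin s) =>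
        (Sum.elim (fun j : Fin L => X ^ (j : ℕ)) (shifts₃ δ e s w g f) j).coeff
          (Sum.elim (fun i : Fin L => (i : ℕ)) (fun i => L + pos₃ i) i)).det =
        (Matrix.of fun i j => (shifts₃ δ e s w g f j).coeff (L + pos₃ i)).det := by
      rw [det_of_sum_zero₂₁]
      · have h1 := det_coeff_of_monic (x := 0) (fun j : Fin L => (X : F[X]) ^ (j : ℕ))
          (fun j => monic_X_pow _) (fun j => by simp)
        simp only [zero_add] at h1
        simp only [Sum.elim_inl, Sum.elim_inr]
        rw [h1, one_mul]
      · intro i j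
        simp only [Sum.elim_inl, Sum.elim_inr, coeff_X_pow]
        exact if_neg (by omega)
    rw [← h, ← det_of_reindex (finSumFinEquiv.sumCongr (Equiv.refl (Fin e ⊕ Fin s))),
      ← det_of_reindex (Equiv.sumAssoc (Fin L) (Fin δ) (Fin e ⊕ Fin s))]
    congr 1
    ext ((i | i) | i | i) ((j | j) | j | j) <;>
      simp [monomialsAndShifts, shifts₃, add_assoc]
  · intro v hv hvA
    rw [Finset.prod_image fun i _ j _ h => hv h]
    exact det_eval_monomialsAndShifts hw hwd _
  · intro j
    rcases finSumFinEquiv.symm j with j | j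
    · simp only [monomialsAndShifts, Sum.elim_inl, natDegree_X_pow]
      omega
    · simp only [monomialsAndShifts, Sum.elim_inr, natDegree_X_pow_mul hw, hwd]
      omega

end SylvesterDeterminants

/-! ### Symmetric Lagrange interpolation. -/

section Interpolation

variable {κ F : Type*} [DecidableEq κ] [Field F]

lemma det_coeff_eq_eval_mul {d e : ℕ} (g : F[X]) (hg : g.natDegree ≤ d) {x : F} (hx : x ≠ 0) :
    (Matrix.of fun i j : Fin d ⊕ Fin (e + 1) =>
      (Sum.elim (fun j : Fin d => X ^ (j : ℕ) * (C x - X)) (fun j : Fin (e + 1) => X ^ (j : ℕ) * g)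
        j).coeff (pos₂ i)).det = g.eval x * g.coeff d ^ e := by
  let q : Fin d ⊕ Fin (e + 1) → F[X] := Sum.elim (fun j : Fin d => X ^ (j : ℕ) * (C x - X))
    (fun j : Fin (e + 1) => X ^ (j : ℕ) * g)
  have hφd : ∀ j : ℕ, (X ^ j * (C x - X)).natDegree ≤ j + 1 := fun j => by
    refine natDegree_mul_le.trans ?_
    rw [natDegree_X_pow, ← neg_sub X (C x), natDegree_neg, natDegree_X_sub_C]
  have hgd : ∀ j : ℕ, (X ^ j * g).natDegree ≤ j + d := fun j => by
    refine natDegree_mul_le.trans ?_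
    rw [natDegree_X_pow]
    omega
  have hq : ∀ j, (q j).natDegree < d + (e + 1) := by
    rintro (j | j)
    · exact (hφd j).trans_lt (by omega)
    · exact (hgd j).trans_lt (by omega)
  let P : Matrix (Fin d ⊕ Fin (e + 1)) (Fin d ⊕ Fin (e + 1)) F :=
    Matrix.of fun i j => (q j).coeff (pos₂ i)
  -- G replaces the row of degree d, indexed by `.inr 0`, by evaluation at x. This kills all columns
  -- t ^ j (x - t) in that row and puts g(x) into the corner of the second block; both diagonal
  -- blocks become triangular. Since det G = x ^ d, the cancellation needs x ≠ 0.
  let G : Matrix (Fin d ⊕ Fin (e + 1)) (Fin d ⊕ Fin (e + 1)) F :=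
    Matrix.of fun i c => if i = .inr 0 then x ^ pos₂ c else if c = i then 1 else 0
  have hG : G.det = x ^ d := by
    rw [det_of_sum_zero₁₂]
    · have h1 : (Matrix.of fun i j : Fin d => if (.inl i : Fin d ⊕ Fin (e + 1)) = .inr 0 then
          x ^ pos₂ (.inl j : Fin d ⊕ Fin (e + 1)) else
          if (.inl j : Fin d ⊕ Fin (e + 1)) = .inl i then (1 : F) else 0) = 1 := by
        ext i j
        simp [Matrix.one_apply, eq_comm]
      rw [h1, Matrix.det_one, one_mul, Matrix.det_of_isUpperTriangular]
      · simp
      · intro i j hij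
        have h0 : i ≠ 0 := fun h => by subst h; exact absurd hij (by simp)
        have h1 : j ≠ i := ne_of_lt hij
        simp [h0, h1]
    · intro i j
      simp
  have hl : ∀ i j, i ≠ .inr 0 → (G * P) i j = (q j).coeff (pos₂ i) := by
    intro i j hi
    simp [Matrix.mul_apply, G, P, hi]
  have h0 : ∀ j, (G * P) (.inr 0) j = (q j).eval x := by
    intro j
    rw [eval_eq_sum_range' (hq j), Matrix.mul_apply]
    refine Finset.sum_bij (fun c _ => pos₂ c) ?_ ?_ ?_ ?_
    · intro c _
      exact Finset.mem_range.2 (pos₂_lt _)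
    · intro c _ c' _ h
      exact pos₂_injective h
    · intro c hc
      obtain ⟨i, hi⟩ := exists_pos₂_eq (Finset.mem_range.1 hc)
      exact ⟨i, Finset.mem_univ _, hi⟩
    · intro c _
      simp only [G, P, Matrix.of_apply, if_true]
      ring
  have hGP : (G * P).det = x ^ d * (g.eval x * g.coeff d ^ e) := by
    rw [show (G * P) = Matrix.of (fun i j => (G * P) i j) from rfl, det_of_sum_zero₂₁]
    · congr 1
      · rw [Matrix.det_of_isLowerTriangular]
        · have : ∀ i : Fin d, (Matrix.of fun i j : Fin d => (G * P) (.inl i) (.inl j)) i i = x := by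
            intro i
            rw [Matrix.of_apply, hl _ _ (by simp)]
            simp [q, mul_sub, ← pow_succ]
          simp [this]
        · intro i j hij
          have hij' : (i : ℕ) < j := hij
          rw [Matrix.of_apply, hl _ _ (by simp)]
          simp only [q, Sum.elim_inl, pos₂_inl, coeff_X_pow_mul']
          exact if_neg (by omega)
      · rw [Matrix.det_of_isUpperTriangular, Fin.prod_univ_succ]
        · congr 1
          · rw [Matrix.of_apply, h0]
            simp [q]
          · have : ∀ i : Fin e, (Matrix.of fun i j : Fin (e + 1) => (G * P) (.inr i) (.inr j))
                i.succ i.succ = g.coeff d := by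
              intro i
              rw [Matrix.of_apply, hl _ _ (by simp)]
              simp only [q, Sum.elim_inr, pos₂_inr]
              rw [mul_comm, coeff_mul_X_pow]
            simp [this]
        · intro i j hij
          have hij' : (j : ℕ) < i := hij
          have h0 : i ≠ 0 := fun h => by subst h; exact absurd hij (by simp)
          rw [Matrix.of_apply, hl _ _ (by simpa using h0)]
          exact coeff_eq_zero_of_natDegree_lt ((hgd j).trans_lt (by simp; omega))
    · intro i j
      by_cases hi : i = 0
      · subst hi
        rw [h0]
        simp [q]
      · have : (i : ℕ) ≠ 0 := fun h => hi (Fin.ext h)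
        rw [hl _ _ (by simpa using hi)]
        exact coeff_eq_zero_of_natDegree_lt ((hφd j).trans_lt (by simp; omega))
  rw [Matrix.det_mul, hG] at hGP
  exact mul_left_cancel₀ (pow_ne_zero _ hx) hGP

/-- Symmetric multivariate Lagrange interpolation. -/
lemma sum_powersetCard_eq_eval {d e : ℕ} {S : Finset κ} {γ : κ → F} (hγ : Set.InjOn γ S)
    (hS : S.card = d + (e + 1)) (g : F[X]) (hg : g.natDegree ≤ d) {x : F} (hx : x ≠ 0) :
    ∑ S' ∈ S.powersetCard d, (∏ c ∈ S', (x - γ c)) * (∏ c ∈ S \ S', g.eval (γ c)) /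
      ∏ a ∈ S', ∏ b ∈ S \ S', (γ b - γ a) = g.eval x * g.coeff d ^ e := by
  rw [← det_coeff_eq_sum_powersetCard (s := 0) hγ hS
    (fun j : Fin d => X ^ (j : ℕ) * (C x - X)) g, ← det_coeff_eq_eval_mul g hg hx,
    ← det_of_reindex ((Equiv.refl (Fin d)).sumCongr (Equiv.sumEmpty (Fin (e + 1)) (Fin 0)))]
  · congr 1
    ext (i | i | i) (j | j | j) <;> first | exact i.elim0 | exact j.elim0 | simp
  · intro j
    refine natDegree_mul_le.trans_lt ?_
    rw [natDegree_X_pow, ← neg_sub X (C x), natDegree_neg, natDegree_X_sub_C]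
    omega
  · intro j
    refine natDegree_mul_le.trans_lt ?_
    rw [natDegree_X_pow]
    omega
  · intro v hv _
    rw [Finset.prod_image fun i _ j _ h => hv h, Matrix.vandermonde, ← det_of_mul_left]
    congr 1
    ext i j
    simp [mul_comm]

end Interpolation

/-! ### Weighted Sylvester sums and the terms of the expansion. -/

section DiffProd

variable {ι R : Type*} [DecidableEq ι] [CommRing R]

/-- `∏_{a ∈ S} ∏_{b ∈ T} (α a - β b)`. -/
def diffProd (α β : ι → R) (S T : Finset ι) : R := ∏ a ∈ S, ∏ b ∈ T, (α a - β b)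

lemma diffProd_swap (α β : ι → R) (S T : Finset ι) :
    diffProd α β S T = (-1) ^ (S.card * T.card) * diffProd β α T S := by
  rw [diffProd, diffProd, Finset.prod_comm]
  have h : ∀ (b a : ι), α a - β b = (-1) * (β b - α a) := fun b a => by ring
  simp only [h, Finset.prod_mul_distrib, Finset.prod_const]
  rw [← pow_mul]

lemma diffProd_sdiff_mul_left (α β : ι → R) {S U : Finset ι} (h : U ⊆ S) (T : Finset ι) :
    diffProd α β (S \ U) T * diffProd α β U T = diffProd α β S T :=
  Finset.prod_sdiff h

lemma diffProd_sdiff_mul_right (α β : ι → R) (S : Finset ι) {T U : Finset ι} (h : U ⊆ T) :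
    diffProd α β S (T \ U) * diffProd α β S U = diffProd α β S T := by
  rw [diffProd, diffProd, diffProd, ← Finset.prod_mul_distrib]
  exact Finset.prod_congr rfl fun a _ => Finset.prod_sdiff h

lemma diffProd_ne_zero [IsDomain R] {α β : ι → R} {S T : Finset ι}
    (h : ∀ a ∈ S, ∀ b ∈ T, α a ≠ β b) : diffProd α β S T ≠ 0 :=
  Finset.prod_ne_zero_iff.2 fun a ha => Finset.prod_ne_zero_iff.2 fun b hb =>
    sub_ne_zero.2 (h a ha b hb)

lemma diffProd_eq_zero {α β : ι → R} {S T : Finset ι} {a b : ι} (ha : a ∈ S) (hb : b ∈ T)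
    (h : α a = β b) : diffProd α β S T = 0 :=
  Finset.prod_eq_zero ha (Finset.prod_eq_zero hb (sub_eq_zero.2 h))

/-- Weighted Sylvester sums: the weight `ω A₁ A₂` stands for `1 / R(A₁, A₂)`, and `θ A₁` for the
factor depending on the variable. -/
def sylSum (α β : ι → R) (ω : Finset ι → Finset ι → R) (A B : Finset ι) (d : ℕ)
    (θ : Finset ι → R) : R :=
  ∑ A₁ ∈ A.powersetCard d, diffProd α β (A \ A₁) B * ω A₁ (A \ A₁) * θ A₁

/-- The pairs `(A', B')` of subsets of `Ab` and `Bb` with `k` elements together. -/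
def pairs (Ab Bb : Finset ι) (k : ℕ) : Finset (Finset ι × Finset ι) :=
  (Ab.powerset ×ˢ Bb.powerset).filter fun P => P.1.card + P.2.card = k

/-- The contribution of a pair `(A', B')`. -/
def pairTerm (α β : ι → R) (ω ω' : Finset ι → Finset ι → R) (A B Ab Bb : Finset ι) (d : ℕ) (x : R)
    (P : Finset ι × Finset ι) : R :=
  (-1) ^ (d * ((Ab \ P.1).card + (Bb \ P.2).card) + P.1.card * (Ab \ P.1).card +
      P.1.card * (Bb \ P.2).card + P.2.card * (Bb \ P.2).card) *
    (diffProd α β (A \ Ab) (Bb \ P.2) * diffProd α β (Ab \ P.1) (B \ P.2) *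
      (ω P.1 (Ab \ P.1) * ω' P.2 (Bb \ P.2))) *
    (∏ a ∈ P.1, (x - α a)) * (∏ b ∈ P.2, (x - β b)) *
    sylSum α β ω (A \ (Ab \ P.1)) (B \ (Bb \ P.2)) d (fun _ => 1)

/-- The coefficient of `t ^ |Ab ∪ Bb|` in the remainder of `∏_{a ∈ A₁} (t - a)` modulo
`(t - x) ∏_{c ∈ Ab ∪ Bb} (t - c)`. -/
noncomputable def remCoeff (α β : ι → R) (Ab Bb : Finset ι) (x : R) (A₁ : Finset ι) : R :=
  ((∏ a ∈ A₁, (X - C (α a))) %ₘ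
    ((X - C x) * ((∏ a ∈ Ab, (X - C (α a))) * ∏ b ∈ Bb, (X - C (β b))))).coeff (Ab.card + Bb.card)

end DiffProd

/-! ### The expansions when no node of A is a node of B. -/

section PureIdentities

variable {ι F : Type*} [DecidableEq ι] [Field F]

lemma diffProd_disjSum (α β : ι → F) (A' B' U W : Finset ι) :
    ∏ a ∈ A'.disjSum B', ∏ b ∈ U.disjSum W, (Sum.elim α β b - Sum.elim α β a) =
      diffProd α α U A' * diffProd β α W A' * (diffProd α β U B' * diffProd β β W B') := by
  rw [Finset.prod_disjSum]
  simp only [Finset.prod_disjSum, Sum.elim_inl, Sum.elim_inr, Finset.prod_mul_distrib]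
  simp only [diffProd]
  congr 1 <;> congr 1 <;> exact Finset.prod_comm

/-- Symmetric interpolation at two families of points. -/
lemma sum_pairs_eq_eval {α β : ι → F} {Ab Bb : Finset ι} (hα : Set.InjOn α Ab)
    (hβ : Set.InjOn β Bb) (hαβ : ∀ a ∈ Ab, ∀ b ∈ Bb, α a ≠ β b) {k e : ℕ}
    (hk : Ab.card + Bb.card = k + (e + 1)) (g : F[X]) (hg : g.natDegree ≤ k) {x : F} (hx : x ≠ 0) :
    ∑ P ∈ pairs Ab Bb k, (∏ a ∈ P.1, (x - α a)) * (∏ b ∈ P.2, (x - β b)) *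
      ((∏ a ∈ Ab \ P.1, g.eval (α a)) * (∏ b ∈ Bb \ P.2, g.eval (β b))) /
      (diffProd α α (Ab \ P.1) P.1 * diffProd β α (Bb \ P.2) P.1 *
        (diffProd α β (Ab \ P.1) P.2 * diffProd β β (Bb \ P.2) P.2)) =
      g.eval x * g.coeff k ^ e := by
  have hγ : Set.InjOn (Sum.elim α β) (Ab.disjSum Bb : Finset (ι ⊕ ι)) := by
    rintro (a | a) ha (b | b) hb h
    · rw [hα (by simpa using ha) (by simpa using hb) h]
    · exact (hαβ a (by simpa using ha) b (by simpa using hb) h).elim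
    · exact (hαβ b (by simpa using hb) a (by simpa using ha) h.symm).elim
    · rw [hβ (by simpa using ha) (by simpa using hb) h]
  rw [← sum_powersetCard_eq_eval hγ (by rw [Finset.card_disjSum, hk]) g hg hx]
  have hsd : ∀ A' B' : Finset ι, Ab.disjSum Bb \ A'.disjSum B' =
      (Ab \ A').disjSum (Bb \ B') := by
    intro A' B'
    ext (c | c) <;> simp
  refine Finset.sum_bij (fun P _ => P.1.disjSum P.2) ?_ ?_ ?_ ?_
  · rintro ⟨A', B'⟩ hP
    simp only [pairs, Finset.mem_filter, Finset.mem_product, Finset.mem_powerset] at hP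
    rw [Finset.mem_powersetCard, Finset.card_disjSum]
    exact ⟨Finset.disjSum_mono hP.1.1 hP.1.2, hP.2⟩
  · rintro ⟨A', B'⟩ _ ⟨A'', B''⟩ _ h
    have h1 := congrArg Finset.toLeft h
    have h2 := congrArg Finset.toRight h
    simp only [Finset.toLeft_disjSum, Finset.toRight_disjSum] at h1 h2
    rw [h1, h2]
  · intro S hS
    rw [Finset.mem_powersetCard] at hS
    refine ⟨(S.toLeft, S.toRight), ?_, Finset.toLeft_disjSum_toRight⟩
    simp only [pairs, Finset.mem_filter, Finset.mem_product, Finset.mem_powerset]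
    refine ⟨⟨fun a ha => ?_, fun b hb => ?_⟩, by rw [Finset.card_toLeft_add_card_toRight, hS.2]⟩
    · simpa using hS.1 (Finset.mem_toLeft.1 ha)
    · simpa using hS.1 (Finset.mem_toRight.1 hb)
  · rintro ⟨A', B'⟩ _
    simp only [hsd]
    rw [diffProd_disjSum]
    simp only [Finset.prod_disjSum, Sum.elim_inl, Sum.elim_inr]

/-- Restricting a Sylvester sum to subsets avoiding `U`, and splitting off the factors of `W`. -/
lemma sylSum_mul_diffProd {α β : ι → F} {A B U W : Finset ι} (hα : Set.InjOn α A) (hU : U ⊆ A)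
    (hW : W ⊆ B) (d : ℕ) :
    sylSum α β (fun S T => (diffProd α α S T)⁻¹) A B d
        (fun A₁ => diffProd α α U A₁ * diffProd β α W A₁) =
      (-1) ^ (d * (U.card + W.card)) * (diffProd α β U B * diffProd α β (A \ U) W) *
        sylSum α β (fun S T => (diffProd α α S T)⁻¹) (A \ U) (B \ W) d (fun _ => 1) := by
  rw [sylSum, sylSum, Finset.mul_sum]
  -- If A₁ meets U, then R(U, A₁) = 0. Otherwise R(U, B) splits off from R(A ∖ A₁, B), the factor
  -- R(A₁, U) of the denominator cancels up to sign, and R((A ∖ U) ∖ A₁, W) R(A₁, W) = R(A ∖ U, W).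
  have hsub : (A \ U).powersetCard d ⊆ A.powersetCard d :=
    Finset.powersetCard_mono Finset.sdiff_subset
  rw [← Finset.sum_subset hsub]
  · refine Finset.sum_congr rfl fun A₁ hA₁ => ?_
    obtain ⟨hs, hc⟩ := Finset.mem_powersetCard.1 hA₁
    have hd : Disjoint A₁ U := Finset.disjoint_of_subset_left hs Finset.sdiff_disjoint
    have hUA : U ⊆ A \ A₁ := fun u hu =>
      Finset.mem_sdiff.2 ⟨hU hu, fun h => Finset.disjoint_left.1 hd h hu⟩
    have e1 : (A \ U) \ A₁ = (A \ A₁) \ U := by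
      rw [sdiff_sdiff_left, sdiff_sdiff_left, sup_comm]
    rw [e1, diffProd_swap α α U A₁, diffProd_swap β α W A₁,
      ← diffProd_sdiff_mul_left α β hUA B, ← diffProd_sdiff_mul_right α β ((A \ A₁) \ U) hW,
      ← diffProd_sdiff_mul_left α β hs W, e1, ← diffProd_sdiff_mul_right α α A₁ hUA, hc]
    have n1 : diffProd α α A₁ U ≠ 0 := diffProd_ne_zero fun a ha b hb h =>
      Finset.disjoint_left.1 hd ha (hα (hU hb) (Finset.sdiff_subset (hs ha)) h.symm ▸ hb)
    have n2 : diffProd α α A₁ ((A \ A₁) \ U) ≠ 0 := diffProd_ne_zero fun a ha b hb h => by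
      have hb' := Finset.mem_sdiff.1 (Finset.sdiff_subset hb)
      exact hb'.2 (hα hb'.1 (Finset.sdiff_subset (hs ha)) h.symm ▸ ha)
    have hp : (-1 : F) ^ (d * (U.card + W.card)) = (-1) ^ (U.card * d) * (-1) ^ (W.card * d) := by
      rw [← pow_add]
      congr 1
      ring
    rw [hp]
    field_simp
  · intro A₁ h1 h2
    obtain ⟨hs, hc⟩ := Finset.mem_powersetCard.1 h1
    have : ¬ Disjoint A₁ U := fun h => h2 (Finset.mem_powersetCard.2
      ⟨fun a ha => Finset.mem_sdiff.2 ⟨hs ha, Finset.disjoint_left.1 h ha⟩, hc⟩)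
    obtain ⟨a, ha, hau⟩ := Finset.not_disjoint_iff.1 this
    rw [diffProd_eq_zero hau ha rfl]
    ring

/-- Cancelling R(A', W) and R(U, B'), with U = Ab ∖ A' and W = Bb ∖ B', turns the interpolation
summand into `pairTerm`. That form has no denominators mixing α and β, so it still makes sense when
nodes collide. -/
lemma pairTerm_eq {α β : ι → F} {A B Ab Bb : Finset ι} (hα : Set.InjOn α A) (hβ : Set.InjOn β B)
    (hαβ : ∀ a ∈ A, ∀ b ∈ B, α a ≠ β b) (hAb : Ab ⊆ A) (hBb : Bb ⊆ B) (d : ℕ) (x : F)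
    {P : Finset ι × Finset ι} (hP₁ : P.1 ⊆ Ab) (hP₂ : P.2 ⊆ Bb) :
    pairTerm α β (fun S T => (diffProd α α S T)⁻¹) (fun S T => (diffProd β β S T)⁻¹)
      A B Ab Bb d x P =
    (∏ a ∈ P.1, (x - α a)) * (∏ b ∈ P.2, (x - β b)) /
      (diffProd α α (Ab \ P.1) P.1 * diffProd β α (Bb \ P.2) P.1 *
        (diffProd α β (Ab \ P.1) P.2 * diffProd β β (Bb \ P.2) P.2)) *
      sylSum α β (fun S T => (diffProd α α S T)⁻¹) A B d
        (fun A₁ => diffProd α α (Ab \ P.1) A₁ * diffProd β α (Bb \ P.2) A₁) := by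
  obtain ⟨A', B'⟩ := P
  simp only at hP₁ hP₂ ⊢
  have hU : Ab \ A' ⊆ A := Finset.sdiff_subset.trans hAb
  have hW : Bb \ B' ⊆ B := Finset.sdiff_subset.trans hBb
  have hA'U : A' ⊆ A \ (Ab \ A') := fun a ha => by
    simp [hAb (hP₁ ha), ha]
  have e1 : (A \ (Ab \ A')) \ A' = A \ Ab := by
    ext a
    simp only [Finset.mem_sdiff]
    refine ⟨fun h => ⟨h.1.1, fun h' => h.1.2 ⟨h', h.2⟩⟩,
      fun h => ⟨⟨h.1, fun h' => h.2 h'.1⟩, fun h' => h.2 (hP₁ h')⟩⟩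
  rw [sylSum_mul_diffProd hα hU hW, pairTerm, ← diffProd_sdiff_mul_right α β (Ab \ A')
    (hP₂.trans hBb), ← diffProd_sdiff_mul_left α β hA'U (Bb \ B'), e1,
    diffProd_swap α α (Ab \ A') A', diffProd_swap β α (Bb \ B') A',
    diffProd_swap β β (Bb \ B') B']
  have n1 : diffProd α β A' (Bb \ B') ≠ 0 := diffProd_ne_zero fun a ha b hb =>
    hαβ a (hAb (hP₁ ha)) b (hW hb)
  have n2 : diffProd α β (Ab \ A') B' ≠ 0 := diffProd_ne_zero fun a ha b hb =>
    hαβ a (hU ha) b (hBb (hP₂ hb))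
  have n3 : diffProd α α A' (Ab \ A') ≠ 0 := diffProd_ne_zero fun a ha b hb h =>
    (Finset.mem_sdiff.1 hb).2 (hα (hU hb) (hAb (hP₁ ha)) h.symm ▸ ha)
  have n4 : diffProd β β B' (Bb \ B') ≠ 0 := diffProd_ne_zero fun a ha b hb h =>
    (Finset.mem_sdiff.1 hb).2 (hβ (hW hb) (hBb (hP₂ ha)) h.symm ▸ ha)
  have hs : ∀ k : ℕ, ((-1 : F) ^ k)⁻¹ = (-1) ^ k := fun k => by
    rcases neg_one_pow_eq_or F k with h | h <;> rw [h] <;> norm_num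
  rw [pow_add, pow_add, pow_add, mul_comm A'.card, mul_comm A'.card, mul_comm B'.card]
  simp only [div_eq_mul_inv, mul_inv, hs]
  field_simp

/-- After exchanging the sums, the sum over pairs is the interpolation of g A₁. Only the values of g
A₁ at the nodes are prescribed; this freedom serves both ranges of d. -/
lemma sum_pairTerm_eq_sylSum {α β : ι → F} {A B Ab Bb : Finset ι} (hα : Set.InjOn α A)
    (hβ : Set.InjOn β B) (hαβ : ∀ a ∈ A, ∀ b ∈ B, α a ≠ β b) (hAb : Ab ⊆ A) (hBb : Bb ⊆ B)
    {d k e : ℕ} (hk : Ab.card + Bb.card = k + (e + 1)) {x : F} (hx : x ≠ 0)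
    (g : Finset ι → F[X]) (hg : ∀ A₁, A₁.card = d → (g A₁).natDegree ≤ k)
    (hgα : ∀ A₁, ∀ a ∈ Ab, (g A₁).eval (α a) = ∏ b ∈ A₁, (α a - α b))
    (hgβ : ∀ A₁, ∀ b ∈ Bb, (g A₁).eval (β b) = ∏ a ∈ A₁, (β b - α a)) :
    ∑ P ∈ pairs Ab Bb k, pairTerm α β (fun S T => (diffProd α α S T)⁻¹)
      (fun S T => (diffProd β β S T)⁻¹) A B Ab Bb d x P =
    sylSum α β (fun S T => (diffProd α α S T)⁻¹) A B d
      (fun A₁ => (g A₁).eval x * (g A₁).coeff k ^ e) := by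
  rw [sylSum]
  have h1 : ∀ P ∈ pairs Ab Bb k, pairTerm α β (fun S T => (diffProd α α S T)⁻¹)
      (fun S T => (diffProd β β S T)⁻¹) A B Ab Bb d x P =
      ∑ A₁ ∈ A.powersetCard d, diffProd α β (A \ A₁) B * (diffProd α α A₁ (A \ A₁))⁻¹ *
        ((∏ a ∈ P.1, (x - α a)) * (∏ b ∈ P.2, (x - β b)) *
      ((∏ a ∈ Ab \ P.1, (g A₁).eval (α a)) * (∏ b ∈ Bb \ P.2, (g A₁).eval (β b))) /
      (diffProd α α (Ab \ P.1) P.1 * diffProd β α (Bb \ P.2) P.1 *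
        (diffProd α β (Ab \ P.1) P.2 * diffProd β β (Bb \ P.2) P.2))) := by
    intro P hP
    simp only [pairs, Finset.mem_filter, Finset.mem_product, Finset.mem_powerset] at hP
    rw [pairTerm_eq hα hβ hαβ hAb hBb d x hP.1.1 hP.1.2, sylSum, Finset.mul_sum]
    refine Finset.sum_congr rfl fun A₁ _ => ?_
    have e1 : ∏ a ∈ Ab \ P.1, (g A₁).eval (α a) = diffProd α α (Ab \ P.1) A₁ :=
      Finset.prod_congr rfl fun a ha => hgα A₁ a (Finset.sdiff_subset ha)
    have e2 : ∏ b ∈ Bb \ P.2, (g A₁).eval (β b) = diffProd β α (Bb \ P.2) A₁ :=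
      Finset.prod_congr rfl fun a ha => hgβ A₁ a (Finset.sdiff_subset ha)
    rw [e1, e2]
    ring
  rw [Finset.sum_congr rfl h1, Finset.sum_comm]
  refine Finset.sum_congr rfl fun A₁ hA₁ => ?_
  rw [← Finset.mul_sum, sum_pairs_eq_eval (hα.mono hAb) (hβ.mono hBb)
    (fun a ha b hb => hαβ a (hAb ha) b (hBb hb)) hk (g A₁)
    (hg A₁ (Finset.mem_powersetCard.1 hA₁).2) hx]

/-- Here g A₁ is the full product, monic of degree d, so the power of its leading coefficient is 1.
-/
lemma sylSum_eq_sum_pairTerm_of_disjoint {α β : ι → F} {A B Ab Bb : Finset ι}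
    (hα : Set.InjOn α A) (hβ : Set.InjOn β B) (hαβ : ∀ a ∈ A, ∀ b ∈ B, α a ≠ β b) (hAb : Ab ⊆ A)
    (hBb : Bb ⊆ B) {d : ℕ} (hd : d < Ab.card + Bb.card) {x : F} (hx : x ≠ 0) :
    sylSum α β (fun S T => (diffProd α α S T)⁻¹) A B d (fun A₁ => ∏ a ∈ A₁, (x - α a)) =
    ∑ P ∈ pairs Ab Bb d, pairTerm α β (fun S T => (diffProd α α S T)⁻¹)
      (fun S T => (diffProd β β S T)⁻¹) A B Ab Bb d x P := by
  have hdeg : ∀ A₁ : Finset ι, (∏ a ∈ A₁, (X - C (α a))).natDegree = A₁.card := fun A₁ =>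
    natDegree_finsetProd_X_sub_C_eq_card _ _
  have hev : ∀ (A₁ : Finset ι) (y : F),
      (∏ a ∈ A₁, (X - C (α a))).eval y = ∏ a ∈ A₁, (y - α a) := fun A₁ y => by
    simp [eval_prod]
  rw [sum_pairTerm_eq_sylSum hα hβ hαβ hAb hBb (k := d) (e := Ab.card + Bb.card - d - 1) (by omega)
    hx (fun A₁ => ∏ a ∈ A₁, (X - C (α a))) (fun A₁ h => by rw [hdeg, h]) (fun A₁ a _ => hev _ _)
    (fun A₁ a _ => hev _ _), sylSum, sylSum]
  refine Finset.sum_congr rfl fun A₁ hA₁ => ?_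
  have : (∏ a ∈ A₁, (X - C (α a))).coeff d = 1 := by
    rw [← (Finset.mem_powersetCard.1 hA₁).2, ← hdeg A₁]
    exact (monic_prod_X_sub_C α A₁).coeff_natDegree
  rw [hev, this, one_pow, mul_one]

/-- The remainder modulo (t - x) p has the right values at x and at all nodes, but degree up to k +
1. Subtracting `remCoeff` times p lowers the degree to k without changing the values at the nodes;
the value lost at x is the extra summand. -/
lemma sylSum_eq_sum_pairTerm_add_of_disjoint {α β : ι → F} {A B Ab Bb : Finset ι}
    (hα : Set.InjOn α A) (hβ : Set.InjOn β B) (hαβ : ∀ a ∈ A, ∀ b ∈ B, α a ≠ β b) (hAb : Ab ⊆ A)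
    (hBb : Bb ⊆ B) {d k : ℕ} (hk : Ab.card + Bb.card = k + 1) {x : F} (hx : x ≠ 0) :
    sylSum α β (fun S T => (diffProd α α S T)⁻¹) A B d (fun A₁ => ∏ a ∈ A₁, (x - α a)) =
    ∑ P ∈ pairs Ab Bb k, pairTerm α β (fun S T => (diffProd α α S T)⁻¹)
      (fun S T => (diffProd β β S T)⁻¹) A B Ab Bb d x P +
    (∏ a ∈ Ab, (x - α a)) * (∏ b ∈ Bb, (x - β b)) *
      sylSum α β (fun S T => (diffProd α α S T)⁻¹) A B d (remCoeff α β Ab Bb x) := by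
  set pC : F[X] := (∏ a ∈ Ab, (X - C (α a))) * ∏ b ∈ Bb, (X - C (β b)) with hpC
  have hpm : pC.Monic := (monic_prod_X_sub_C α Ab).mul (monic_prod_X_sub_C β Bb)
  have hpd : pC.natDegree = Ab.card + Bb.card := by
    rw [hpC, (monic_prod_X_sub_C α Ab).natDegree_mul (monic_prod_X_sub_C β Bb),
      natDegree_finsetProd_X_sub_C_eq_card, natDegree_finsetProd_X_sub_C_eq_card]
  have hwm : ((X - C x) * pC).Monic := (monic_X_sub_C x).mul hpm
  have hwd : ((X - C x) * pC).natDegree = Ab.card + Bb.card + 1 := by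
    rw [(monic_X_sub_C x).natDegree_mul hpm, natDegree_X_sub_C, hpd, add_comm]
  have hev : ∀ (A₁ : Finset ι) (y : F),
      (∏ a ∈ A₁, (X - C (α a))).eval y = ∏ a ∈ A₁, (y - α a) := fun A₁ y => by
    simp [eval_prod]
  have hrem : ∀ (A₁ : Finset ι) (y : F), ((X - C x) * pC).eval y = 0 →
      ((∏ a ∈ A₁, (X - C (α a))) %ₘ ((X - C x) * pC)).eval y = ∏ a ∈ A₁, (y - α a) := by
    intro A₁ y hy
    rw [← hev]
    conv_rhs => rw [← modByMonic_add_div (∏ a ∈ A₁, (X - C (α a))) ((X - C x) * pC)]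
    rw [eval_add, eval_mul, hy, zero_mul, add_zero]
  set g : Finset ι → F[X] := fun A₁ => (∏ a ∈ A₁, (X - C (α a))) %ₘ ((X - C x) * pC) -
    C (remCoeff α β Ab Bb x A₁) * pC with hg
  have hpα : ∀ a ∈ Ab, pC.eval (α a) = 0 := fun a ha => by
    rw [hpC, eval_mul, hev, Finset.prod_eq_zero ha (sub_self _), zero_mul]
  have hpβ : ∀ b ∈ Bb, pC.eval (β b) = 0 := fun b hb => by
    rw [hpC, eval_mul, eval_prod Bb, Finset.prod_eq_zero hb (by simp), mul_zero]
  have hpx : pC.eval x = (∏ a ∈ Ab, (x - α a)) * (∏ b ∈ Bb, (x - β b)) := by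
    rw [hpC, eval_mul, hev, eval_prod]
    simp
  rw [sum_pairTerm_eq_sylSum hα hβ hαβ hAb hBb (k := k) (e := 0) (by omega) hx g ?_ ?_ ?_]
  · simp only [sylSum, Finset.mul_sum]
    rw [← Finset.sum_add_distrib]
    refine Finset.sum_congr rfl fun A₁ hA₁ => ?_
    simp only [hg, eval_sub, eval_mul, eval_C, hpx]
    rw [hrem A₁ x (by simp)]
    ring
  · intro A₁ _
    rw [natDegree_le_iff_coeff_eq_zero]
    intro i hi
    rw [hg]
    simp only [coeff_sub, coeff_C_mul]
    rcases Nat.lt_or_ge (k + 1) i with h | h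
    · rw [coeff_eq_zero_of_natDegree_lt (p := pC) (by omega), mul_zero, sub_zero]
      refine coeff_eq_zero_of_degree_lt ((degree_modByMonic_lt _ hwm).trans_le ?_)
      rw [degree_eq_natDegree hwm.ne_zero, hwd]
      exact_mod_cast (by omega : Ab.card + Bb.card + 1 ≤ i)
    · have hi' : i = Ab.card + Bb.card := by omega
      have h1 : pC.coeff i = 1 := by
        rw [hi', ← hpd]
        exact hpm.coeff_natDegree
      rw [h1, mul_one, hi', remCoeff, sub_self]
  · intro A₁ a ha
    rw [hg]
    simp only [eval_sub, eval_mul]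
    rw [hrem A₁ _ (by rw [eval_mul, hpα a ha, mul_zero]), hpα a ha, mul_zero, sub_zero]
  · intro A₁ b hb
    rw [hg]
    simp only [eval_sub, eval_mul]
    rw [hrem A₁ _ (by rw [eval_mul, hpβ b hb, mul_zero]), hpβ b hb, mul_zero, sub_zero]

end PureIdentities

/-! ### Removing the distinctness of nodes by a generic translation. -/

section Specialization

variable {ι R S : Type*} [DecidableEq ι] [CommRing R] [CommRing S]

lemma map_diffProd (φ : R →+* S) (α β : ι → R) (U W : Finset ι) :
    φ (diffProd α β U W) = diffProd (φ ∘ α) (φ ∘ β) U W := by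
  simp [diffProd, map_prod]

lemma map_sylSum (φ : R →+* S) (α β : ι → R) (ω : Finset ι → Finset ι → R) (A B : Finset ι) (d : ℕ)
    (θ : Finset ι → R) :
    φ (sylSum α β ω A B d θ) =
      sylSum (φ ∘ α) (φ ∘ β) (fun S T => φ (ω S T)) A B d (fun A₁ => φ (θ A₁)) := by
  simp [sylSum, map_sum, map_diffProd]

lemma map_pairTerm (φ : R →+* S) (α β : ι → R) (ω ω' : Finset ι → Finset ι → R)
    (A B Ab Bb : Finset ι) (d : ℕ) (x : R) (P : Finset ι × Finset ι) :
    φ (pairTerm α β ω ω' A B Ab Bb d x P) =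
      pairTerm (φ ∘ α) (φ ∘ β) (fun S T => φ (ω S T)) (fun S T => φ (ω' S T)) A B Ab Bb d (φ x)
        P := by
  simp [pairTerm, map_sylSum, map_diffProd, map_prod]

lemma map_remCoeff (φ : R →+* S) (α β : ι → R) (Ab Bb : Finset ι) (x : R) (A₁ : Finset ι) :
    φ (remCoeff α β Ab Bb x A₁) = remCoeff (φ ∘ α) (φ ∘ β) Ab Bb (φ x) A₁ := by
  rw [remCoeff, remCoeff, ← coeff_map, map_modByMonic]
  · simp [Polynomial.map_prod]
  · exact (monic_X_sub_C x).mul ((monic_prod_X_sub_C α Ab).mul (monic_prod_X_sub_C β Bb))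

end Specialization

section Perturbation

variable {ι F : Type*} [DecidableEq ι] [Field F]

/-- The weights inside B are invariant under translation, so they stay constants when β moves. -/
lemma diffProd_add_right (β : ι → F) (e : F) (S T : Finset ι) :
    diffProd (fun b => β b + e) (fun b => β b + e) S T = diffProd β β S T := by
  simp [diffProd]

/-- A polynomial identity that holds for a generic translate of `β` holds for `β`. -/
lemma eq_of_generic_translate [Infinite F] {α β : ι → F} {A B : Finset ι} (p q : F[X])
    (h : ∀ e : F, (∀ a ∈ A, ∀ b ∈ B, α a ≠ β b + e) → p.eval e = q.eval e) :
    p = q := by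
  classical
  -- Only the finitely many translations e = α a - β b are excluded.
  refine eq_of_infinite_eval_eq p q (Set.Infinite.mono (s := ((A ×ˢ B).image
    (fun P => α P.1 - β P.2) : Finset F)ᶜ) ?_ (Finset.finite_toSet _).infinite_compl)
  intro e he
  refine h e fun a ha b hb hab => he ?_
  rw [Finset.mem_coe, Finset.mem_image]
  exact ⟨(a, b), Finset.mem_product.2 ⟨ha, hb⟩, by simp [hab]⟩

/-- The expansion of the Sylvester sum for `d < |Ab| + |Bb|`. -/
theorem sylSum_eq_sum_pairTerm [Infinite F] {α β : ι → F} {A B Ab Bb : Finset ι}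
    (hα : Set.InjOn α A) (hβ : Set.InjOn β B) (hAb : Ab ⊆ A)
    (hBb : Bb ⊆ B) {d : ℕ} (hd : d < Ab.card + Bb.card) {x : F} (hx : x ≠ 0) :
    sylSum α β (fun S T => (diffProd α α S T)⁻¹) A B d (fun A₁ => ∏ a ∈ A₁, (x - α a)) =
    ∑ P ∈ pairs Ab Bb d, pairTerm α β (fun S T => (diffProd α α S T)⁻¹)
      (fun S T => (diffProd β β S T)⁻¹) A B Ab Bb d x P := by
  -- β is translated by the variable of F[X]. The inverses enter as constant weights, so both sides
  -- are polynomials, and evaluation at 0 recovers the original nodes.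
  have key := eq_of_generic_translate (α := α) (β := β) (A := A) (B := B)
    (sylSum (fun a => C (α a)) (fun b => C (β b) + X) (fun S T => C (diffProd α α S T)⁻¹) A B d
      (fun A₁ => ∏ a ∈ A₁, (C x - C (α a))))
    (∑ P ∈ pairs Ab Bb d, pairTerm (fun a => C (α a)) (fun b => C (β b) + X)
      (fun S T => C (diffProd α α S T)⁻¹) (fun S T => C (diffProd β β S T)⁻¹) A B Ab Bb d (C x) P)
    (fun e he => by
      have := sylSum_eq_sum_pairTerm_of_disjoint (β := fun b => β b + e) hα
        (fun b hb b' hb' h => hβ hb hb' (add_right_cancel h)) he hAb hBb hd hx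
      simp only [diffProd_add_right] at this
      rw [← coe_evalRingHom, map_sum, map_sylSum]
      simp only [map_pairTerm]
      convert this using 2 <;> simp [Function.comp_def, map_prod])
  have := congrArg (evalRingHom (0 : F)) key
  rw [map_sum, map_sylSum] at this
  simp only [map_pairTerm] at this
  convert this using 2 <;> simp [Function.comp_def, map_prod]

/-- The expansion of the Sylvester sum for `|Ab| + |Bb| ≤ d`. -/
theorem sylSum_eq_sum_pairTerm_add [Infinite F] {α β : ι → F} {A B Ab Bb : Finset ι}
    (hα : Set.InjOn α A) (hβ : Set.InjOn β B) (hAb : Ab ⊆ A)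
    (hBb : Bb ⊆ B) {d k : ℕ} (hk : Ab.card + Bb.card = k + 1) {x : F} (hx : x ≠ 0) :
    sylSum α β (fun S T => (diffProd α α S T)⁻¹) A B d (fun A₁ => ∏ a ∈ A₁, (x - α a)) =
    ∑ P ∈ pairs Ab Bb k, pairTerm α β (fun S T => (diffProd α α S T)⁻¹)
      (fun S T => (diffProd β β S T)⁻¹) A B Ab Bb d x P +
    (∏ a ∈ Ab, (x - α a)) * (∏ b ∈ Bb, (x - β b)) *
      sylSum α β (fun S T => (diffProd α α S T)⁻¹) A B d (remCoeff α β Ab Bb x) := by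
  have key := eq_of_generic_translate (α := α) (β := β) (A := A) (B := B)
    (sylSum (fun a => C (α a)) (fun b => C (β b) + X) (fun S T => C (diffProd α α S T)⁻¹) A B d
      (fun A₁ => ∏ a ∈ A₁, (C x - C (α a))))
    (∑ P ∈ pairs Ab Bb k, pairTerm (fun a => C (α a)) (fun b => C (β b) + X)
      (fun S T => C (diffProd α α S T)⁻¹) (fun S T => C (diffProd β β S T)⁻¹) A B Ab Bb d (C x) P +
      (∏ a ∈ Ab, (C x - C (α a))) * (∏ b ∈ Bb, (C x - (C (β b) + X))) *
      sylSum (fun a => C (α a)) (fun b => C (β b) + X) (fun S T => C (diffProd α α S T)⁻¹) A B d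
        (remCoeff (fun a => C (α a)) (fun b => C (β b) + X) Ab Bb (C x)))
    (fun e he => by
      have := sylSum_eq_sum_pairTerm_add_of_disjoint (β := fun b => β b + e) hα
        (fun b hb b' hb' h => hβ hb hb' (add_right_cancel h)) he hAb hBb (d := d) hk hx
      simp only [diffProd_add_right] at this
      rw [← coe_evalRingHom, map_add, map_mul, map_mul, map_sum, map_sylSum, map_sylSum]
      simp only [map_pairTerm, map_remCoeff]
      convert this using 2 <;> simp [Function.comp_def, map_prod])
  have := congrArg (evalRingHom (0 : F)) key
  rw [map_add, map_mul, map_mul, map_sum, map_sylSum, map_sylSum] at this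
  simp only [map_pairTerm, map_remCoeff] at this
  convert this using 2 <;> simp [Function.comp_def, map_prod]

end Perturbation

/-! ### Base change and index shifts for row minors. -/

section RowMinors

variable {F : Type*} [CommRing F]

lemma map_rowMinor {S : Type*} [CommRing S] (φ : F →+* S) {r : ℕ} (R : Finset ℕ)
    (M : ℕ → Fin r → F) : φ (rowMinor R M) = rowMinor R (fun i j => φ (M i j)) := by
  rw [rowMinor, rowMinor]
  split_ifs
  · rw [RingHom.map_det]
    rfl
  · exact map_zero φ

lemma rowMinor_empty (M : ℕ → Fin 0 → F) : rowMinor ∅ M = 1 := by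
  rw [rowMinor_of_card Finset.card_empty, Matrix.det_isEmpty]

lemma rowMinor_eq_zero {r : ℕ} {R : Finset ℕ} {i : ℕ} (hi : i ∈ R) (M : ℕ → Fin r → F)
    (h : ∀ j, M i j = 0) : rowMinor R M = 0 := by
  rw [rowMinor]
  split_ifs with hc
  · have : i ∈ Set.range (R.orderEmbOfFin hc) := by simpa using hi
    obtain ⟨t, ht⟩ := this
    refine Matrix.det_eq_zero_of_row_eq_zero t fun j => ?_
    rw [Matrix.of_apply, ht, h]
  · rfl

lemma rowMinor_congr {r : ℕ} {R : Finset ℕ} {M M' : ℕ → Fin r → F}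
    (h : ∀ i ∈ R, ∀ j, M i j = M' i j) : rowMinor R M = rowMinor R M' := by
  rw [rowMinor, rowMinor]
  split_ifs with hc
  · congr 1
    ext i j
    exact h _ (Finset.orderEmbOfFin_mem R hc i) j
  · rfl

lemma injOn_sub_right {s : ℕ} {R : Finset ℕ} (hR : ∀ i ∈ R, s < i) :
    Set.InjOn (fun i => i - s) (R : Set ℕ) := by
  intro i hi j hj h
  have := hR i hi
  have := hR j hj
  simp only at h
  omega

lemma rowMinor_image_sub {r s : ℕ} {R : Finset ℕ} (hR : ∀ i ∈ R, s < i) (M : ℕ → Fin r → F) :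
    rowMinor (R.image fun i => i - s) M = rowMinor R (fun i j => M (i - s) j) := by
  have hc : (R.image fun i => i - s).card = R.card := Finset.card_image_of_injOn (injOn_sub_right hR)
  by_cases h : R.card = r
  · rw [rowMinor_of_card (hc.trans h), rowMinor_of_card h]
    congr 1
    ext i j
    rw [Matrix.of_apply, Matrix.of_apply]
    congr 1
    refine (congrFun (Finset.orderEmbOfFin_unique (hc.trans h)
      (f := fun i => R.orderEmbOfFin h i - s) (fun i => ?_) (fun a b hab => ?_)) i).symm
    · exact Finset.mem_image_of_mem _ (Finset.orderEmbOfFin_mem R h i)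
    · have h1 := hR _ (Finset.orderEmbOfFin_mem R h a)
      have h2 := (R.orderEmbOfFin h).strictMono hab
      simp only
      omega
  · rw [rowMinor, rowMinor, dif_neg h, dif_neg (hc ▸ h)]

lemma neg_one_pow_sum_image_sub {s : ℕ} {R : Finset ℕ} (hR : ∀ i ∈ R, s < i) :
    (-1 : F) ^ (∑ i ∈ R.image (fun i => i - s), (i + 1)) =
      (-1) ^ (R.card * s) * (-1) ^ (∑ i ∈ R, (i + 1)) := by
  rw [Finset.sum_image (injOn_sub_right hR)]
  have : ∑ i ∈ R, (i + 1) = ∑ i ∈ R, (i - s + 1) + R.card * s := by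
    rw [← smul_eq_mul, ← Finset.sum_const, ← Finset.sum_add_distrib]
    refine Finset.sum_congr rfl fun i hi => ?_
    have := hR i hi
    omega
  rw [this, pow_add, mul_comm, mul_assoc, ← pow_add, Even.neg_one_pow ⟨_, rfl⟩, mul_one]

end RowMinors

/-! ### The Schur polynomials of the theorem as minors over K(x). -/

section SchurSpecialization

variable {K F : Type*} [Field K] [Field F]

lemma map_rootPoly_add (φ : K →+* F) (S T : Finset K) :
    (rootPoly (S.val + T.val)).map φ =
      (∏ a ∈ S, (X - C (φ a))) * ∏ a ∈ T, (X - C (φ a)) := by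
  rw [rootPoly, Multiset.map_add, Multiset.prod_add, Polynomial.map_mul]
  congr 1
  · exact (Polynomial.map_prod φ (fun a => X - C a) S).trans (by simp)
  · exact (Polynomial.map_prod φ (fun a => X - C a) T).trans (by simp)

lemma count_le_one (S : Finset K) [DecidableEq K] (y : K) : S.val.count y ≤ 1 :=
  Multiset.nodup_iff_count_le_one.1 S.nodup y

/-- Schur polynomials of a union of two finite sets as minors. -/
lemma map_schurS_eq_rowMinor (φ : K →+* F) {k r : ℕ} {R : Finset ℕ} (hRk : R ⊆ Finset.Icc 1 k)
    (hr : R.card = r) (S T : Finset K) (hk : r + (S.card + T.card) = k) :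
    φ (schurS k R (S.val + T.val)) = (-1) ^ (∑ i ∈ R, (i + 1)) * rowMinor R
      (fun i (j : Fin r) => (X ^ (j : ℕ) *
        ((∏ a ∈ S, (X - C (φ a))) * ∏ a ∈ T, (X - C (φ a)))).coeff (k - i)) := by
  classical
  rw [schurS_eq_rowMinor hRk hr _ (fun y => ?_) (by simpa using hk), map_mul, map_rowMinor]
  · congr 1
    · simp
    · congr 1
      ext i j
      rw [← coeff_map, Polynomial.map_mul, map_rootPoly_add, Polynomial.map_pow, map_X]
  · rw [Multiset.count_add]
    have := count_le_one S y
    have := count_le_one T y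
    omega

/-- Schur polynomials of `A' ∪ B' ∪ {x}` with shifted index sets as minors. -/
lemma schurS_image_sub_eq_rowMinor (φ : K →+* F) {x : F} (hx : ∀ a, φ a ≠ x) {k s r : ℕ}
    {R : Finset ℕ} (hR : R ⊆ Finset.Icc (s + 1) (s + k)) (hr : R.card = r) (S T : Finset K)
    (hk : r + (S.card + T.card + 1) = k) :
    schurS k (R.image fun i => i - s) ((S.val + T.val).map φ + {x}) =
      (-1) ^ (r * s) * ((-1) ^ (∑ i ∈ R, (i + 1)) * rowMinor R
      (fun i (j : Fin r) => (X ^ (j : ℕ) *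
        ((X - C x) * ((∏ a ∈ S, (X - C (φ a))) * ∏ a ∈ T, (X - C (φ a))))).coeff (s + k - i))) := by
  classical
  have hs : ∀ i ∈ R, s < i := fun i hi => by
    have := Finset.mem_Icc.1 (hR hi)
    omega
  rw [schurS_eq_rowMinor (r := r) ?_ ?_ _ (fun y => ?_) (by simpa using hk), rowMinor_image_sub hs,
    neg_one_pow_sum_image_sub hs, hr, mul_assoc]
  · congr 2
    refine rowMinor_congr fun i hi j => ?_
    have h1 : rootPoly ((S.val + T.val).map φ + {x}) =
        (X - C x) * ((∏ a ∈ S, (X - C (φ a))) * ∏ a ∈ T, (X - C (φ a))) := by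
      rw [rootPoly, Multiset.map_add, Multiset.prod_add, Multiset.map_singleton,
        Multiset.prod_singleton, mul_comm, Multiset.map_map, Multiset.map_add, Multiset.prod_add]
      rfl
    rw [h1, show k - (i - s) = s + k - i by have := hs i hi; omega]
  · intro i hi
    obtain ⟨t, ht, rfl⟩ := Finset.mem_image.1 hi
    have := Finset.mem_Icc.1 (hR ht)
    rw [Finset.mem_Icc]
    omega
  · rw [Finset.card_image_of_injOn (injOn_sub_right hs), hr]
  · rw [Multiset.count_add, Multiset.map_add, Multiset.count_add, Multiset.count_singleton]
    have h1 : ∀ U : Finset K, (U.val.map φ).count y ≤ 1 := fun U =>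
      Multiset.nodup_iff_count_le_one.1 (U.nodup.map φ.injective) y
    have h2 := h1 S
    have h3 := h1 T
    -- The new element x is not of the form φ a, so it has multiplicity one; every other element has
    -- multiplicity at most two.
    split_ifs with h
    · have h4 : ∀ U : Finset K, (U.val.map φ).count y = 0 := fun U =>
        Multiset.count_eq_zero_of_notMem fun hy => by
          obtain ⟨a, -, ha⟩ := Multiset.mem_map.1 hy
          exact hx a (ha.trans h)
      rw [h4, h4]
      omega
    · omega

end SchurSpecialization

/-! ### The determinants as Sylvester sums in the roots. -/

section Evaluation

variable {ι F : Type*} [DecidableEq ι] [Field F]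

lemma eval_prod_X_sub_C (β : ι → F) (B : Finset ι) (y : F) :
    (∏ b ∈ B, (X - C (β b))).eval y = ∏ b ∈ B, (y - β b) := by
  simp [eval_prod]

lemma inv_neg_one_pow (k : ℕ) : ((-1 : F) ^ k)⁻¹ = (-1) ^ k := by
  rcases neg_one_pow_eq_or F k with h | h <;> rw [h] <;> norm_num

/-- The quotients in the determinant formulas in terms of Sylvester sums. -/
lemma sum_div_eq_sylSum {α β : ι → F} {A B : Finset ι} {d e : ℕ} (hA : A.card = d + e)
    (θ : Finset ι → F) :
    ∑ A₁ ∈ A.powersetCard d, θ A₁ * (∏ a ∈ A \ A₁, (∏ b ∈ B, (X - C (β b))).eval (α a)) /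
        ∏ a ∈ A₁, ∏ b ∈ A \ A₁, (α b - α a) =
      (-1) ^ (d * e) * sylSum α β (fun S T => (diffProd α α S T)⁻¹) A B d θ := by
  rw [sylSum, Finset.mul_sum]
  refine Finset.sum_congr rfl fun A₁ hA₁ => ?_
  obtain ⟨hs, hc⟩ := Finset.mem_powersetCard.1 hA₁
  have h1 : ∏ a ∈ A₁, ∏ b ∈ A \ A₁, (α b - α a) = (-1) ^ (d * e) * diffProd α α A₁ (A \ A₁) := by
    rw [diffProd_swap α α A₁, Finset.card_sdiff_of_subset hs, hA, hc, Nat.add_sub_cancel_left,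
      ← mul_assoc, ← pow_add, Even.neg_one_pow ⟨_, rfl⟩, one_mul, diffProd, Finset.prod_comm]
  have h2 : ∏ a ∈ A \ A₁, (∏ b ∈ B, (X - C (β b))).eval (α a) = diffProd α β (A \ A₁) B :=
    Finset.prod_congr rfl fun a _ => eval_prod_X_sub_C _ _ _
  rw [h1, h2, div_eq_mul_inv, mul_inv, inv_neg_one_pow]
  ring

/-- Disposes of pairs (A', B') that are not indexed by any partition: ∏_{b ∈ B} (t - b) has degree
less than d. -/
lemma sylSum_eq_zero {α β : ι → F} {A B : Finset ι} {d : ℕ} (hα : Set.InjOn α A) (hA : d < A.card)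
    (hB : B.card < d) :
    sylSum α β (fun S T => (diffProd α α S T)⁻¹) A B d (fun _ => 1) = 0 := by
  have h := sum_powersetCard_eq_zero hα hA (∏ b ∈ B, (X - C (β b)))
    (by rwa [natDegree_finsetProd_X_sub_C_eq_card])
  have h' := sum_div_eq_sylSum (α := α) (β := β) (A := A) (B := B) (d := d) (e := A.card - d)
    (by omega) (fun _ => 1)
  simp only [one_mul] at h'
  rw [h] at h'
  exact (mul_eq_zero.1 h'.symm).resolve_left (pow_ne_zero _ (by norm_num))

lemma natDegree_X_pow_mul_prod (β : ι → F) (B : Finset ι) (j : ℕ) :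
    (X ^ j * ∏ b ∈ B, (X - C (β b))).natDegree = B.card + j := by
  rw [natDegree_X_pow_mul (monic_prod_X_sub_C β B), natDegree_finsetProd_X_sub_C_eq_card]

lemma prod_sdiff_X_sub_C (α : ι → F) {A U : Finset ι} (hU : U ⊆ A) :
    (∏ a ∈ U, (X - C (α a))) * ∏ a ∈ A \ U, (X - C (α a)) = ∏ a ∈ A, (X - C (α a)) := by
  rw [mul_comm, Finset.prod_sdiff hU]

/-- Both polynomials contain the factor ∏_U ∏_W of degree |U| + |W|. Removing it leaves the
polynomials with roots B ∖ W and A ∖ U and lowers the first degree to d. -/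
lemma sylDet_eq_sylSum {α β : ι → F} {A B U W : Finset ι} (hα : Set.InjOn α A) (hU : U ⊆ A)
    (hW : W ⊆ B) {d e s : ℕ} (he : e + d = (A \ U).card) (hs : s + d = (B \ W).card) :
    sylDet (d + (U.card + W.card)) e s
        ((∏ a ∈ U, (X - C (α a))) * ∏ b ∈ B, (X - C (β b)))
        ((∏ a ∈ A, (X - C (α a))) * ∏ b ∈ W, (X - C (β b))) =
      (-1) ^ (d * e) *
        sylSum α β (fun S T => (diffProd α α S T)⁻¹) (A \ U) (B \ W) d (fun _ => 1) := by
  have hq : ((∏ a ∈ U, (X - C (α a))) * ∏ b ∈ W, (X - C (β b))).Monic :=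
    (monic_prod_X_sub_C α U).mul (monic_prod_X_sub_C β W)
  have hqd : ((∏ a ∈ U, (X - C (α a))) * ∏ b ∈ W, (X - C (β b))).natDegree = U.card + W.card := by
    rw [(monic_prod_X_sub_C α U).natDegree_mul (monic_prod_X_sub_C β W),
      natDegree_finsetProd_X_sub_C_eq_card, natDegree_finsetProd_X_sub_C_eq_card]
  have e1 : (∏ a ∈ U, (X - C (α a))) * ∏ b ∈ B, (X - C (β b)) =
      ((∏ a ∈ U, (X - C (α a))) * ∏ b ∈ W, (X - C (β b))) * ∏ b ∈ B \ W, (X - C (β b)) := by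
    rw [mul_assoc, prod_sdiff_X_sub_C β hW]
  have e2 : (∏ a ∈ A, (X - C (α a))) * ∏ b ∈ W, (X - C (β b)) =
      ((∏ a ∈ U, (X - C (α a))) * ∏ b ∈ W, (X - C (β b))) * ∏ a ∈ A \ U, (X - C (α a)) := by
    rw [← prod_sdiff_X_sub_C α hU]
    ring
  have hu : ∀ j : Fin e, (X ^ (j : ℕ) * ∏ b ∈ B \ W, (X - C (β b))).natDegree < d + (e + s) :=
    fun j => by
      rw [natDegree_X_pow_mul_prod]
      omega
  rw [e1, e2, ← hqd, sylDet_monic_mul hq _ _ hu fun j => by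
    rw [natDegree_X_pow_mul_prod]
    omega, sylDet_eq_sum (hα.mono (Finset.coe_subset.2 Finset.sdiff_subset)) (by omega) _ hu,
    ← sum_div_eq_sylSum (by omega)]
  simp only [one_mul]

lemma det_shifts₃_eq_sylSum_remCoeff {α β : ι → F} {A B Ab Bb : Finset ι} (hα : Set.InjOn α A)
    {d δ e s : ℕ} (hδ : Ab.card + Bb.card + δ = d) (he : e + d = A.card) (hs : s + d = B.card)
    (hes : 0 < e + s) (x : F) :
    (Matrix.of fun i j => (shifts₃ δ e s
        ((X - C x) * ((∏ a ∈ Ab, (X - C (α a))) * ∏ b ∈ Bb, (X - C (β b))))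
        (∏ b ∈ B, (X - C (β b))) (∏ a ∈ A, (X - C (α a))) j).coeff
          (Ab.card + Bb.card + pos₃ i)).det =
      (-1) ^ (δ + d * e) *
        sylSum α β (fun S T => (diffProd α α S T)⁻¹) A B d (remCoeff α β Ab Bb x) := by
  have hm : ((∏ a ∈ Ab, (X - C (α a))) * ∏ b ∈ Bb, (X - C (β b))).Monic :=
    (monic_prod_X_sub_C α Ab).mul (monic_prod_X_sub_C β Bb)
  rw [det_shifts₃_eq_sum hα (by omega) ((monic_X_sub_C x).mul hm) ?_ _ (fun j => ?_) hes, pow_add,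
    mul_assoc, ← sum_div_eq_sylSum (by omega), Finset.mul_sum, hδ]
  · refine Finset.sum_congr rfl fun A₁ _ => ?_
    rw [remCoeff, mul_assoc, mul_div_assoc]
  · rw [(monic_X_sub_C x).natDegree_mul hm, natDegree_X_sub_C,
      (monic_prod_X_sub_C α Ab).natDegree_mul (monic_prod_X_sub_C β Bb),
      natDegree_finsetProd_X_sub_C_eq_card, natDegree_finsetProd_X_sub_C_eq_card, add_comm]
  · rw [natDegree_X_pow_mul_prod]
    omega

end Evaluation

/-! ### Exchanging the sum over R with the sum over pairs. -/

section Regrouping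

/-- A pair (A', B') determines |R₂| and |R₃|, so for a fixed pair the sum over R is a Laplace
expansion with blocks of fixed size. -/
lemma sum_sum_powersetCard {ρ ι S : Type*} [AddCommMonoid S] (s : Finset ρ) (a b : ρ → ℕ)
    (Ab Bb : Finset ι) (m' n' d : ℕ) (h : ∀ R ∈ s, m' ≤ a R + d ∧ n' ≤ b R + d)
    (f : ρ → Finset ι → Finset ι → S) :
    ∑ R ∈ s, ∑ A' ∈ Ab.powersetCard (a R + d - m'), ∑ B' ∈ Bb.powersetCard (b R + d - n'),
        f R A' B' =
      ∑ P ∈ Ab.powerset ×ˢ Bb.powerset,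
        ∑ R ∈ s.filter (fun R => m' + P.1.card = a R + d ∧ n' + P.2.card = b R + d),
          f R P.1 P.2 := by
  simp only [← Finset.sum_product']
  refine Finset.sum_comm' fun R P => ?_
  simp only [Finset.mem_product, Finset.mem_powersetCard, Finset.mem_filter, Finset.mem_powerset]
  constructor
  · rintro ⟨hR, ⟨h1, h2⟩, h3, h4⟩
    have := h R hR
    exact ⟨⟨hR, by omega, by omega⟩, h1, h3⟩
  · rintro ⟨⟨hR, h1, h2⟩, h3, h4⟩
    exact ⟨hR, ⟨h3, by omega⟩, h4, by omega⟩

end Regrouping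

/-! ### The sum over R for a fixed pair. -/

section InnerSums

variable {K F : Type*} [Field K] [Field F]

lemma sum_partitions₂_schurS (φ : K →+* F) {L r₂ r₃ T N : ℕ} (A B U W : Finset K)
    (hT : r₂ + r₃ = T) (hN : L + T = N) (h₂ : r₂ + (U.card + B.card) = N)
    (h₃ : r₃ + (A.card + W.card) = N) :
    ∑ R ∈ (partitions₂ T).filter (fun R => R.1.card = r₂ ∧ R.2.card = r₃),
      (((partSign [R.1, R.2] : ℤˣ) : ℤ) : F) *
        (φ (schurS N R.1 (U.val + B.val)) * φ (schurS N R.2 (A.val + W.val))) =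
      sylDet L r₂ r₃ ((∏ a ∈ U, (X - C (φ a))) * ∏ b ∈ B, (X - C (φ b)))
        ((∏ a ∈ A, (X - C (φ a))) * ∏ b ∈ W, (X - C (φ b))) := by
  have key := sum_partitions₃_of_eq_rowMinor (F := F) (r₁ := 0) (r₂ := r₂) (r₃ := r₃) (L := L) 0
    ((∏ a ∈ U, (X - C (φ a))) * ∏ b ∈ B, (X - C (φ b)))
    ((∏ a ∈ A, (X - C (φ a))) * ∏ b ∈ W, (X - C (φ b)))
    (fun _ => 1) (fun R => φ (schurS N R (U.val + B.val)))
    (fun R => φ (schurS N R (A.val + W.val))) 1 1 1 ?_ ?_ ?_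
  · rw [det_shifts₃_zero, one_mul, one_mul, one_mul, zero_add, hT,
      ← sum_partitions₂_eq_sum_partitions₃] at key
    rw [← key]
    refine Finset.sum_congr rfl fun R _ => ?_
    rw [partSign_empty_cons, one_mul]
  · intro R _ hc
    rw [Finset.card_eq_zero.1 hc, rowMinor_empty]
    simp
  · intro R hR hc
    rw [zero_add, hT, hN, one_mul]
    refine map_schurS_eq_rowMinor φ (hR.trans (Finset.Icc_subset_Icc_right (by omega))) hc _ _ h₂
  · intro R hR hc
    rw [zero_add, hT, hN, one_mul]
    refine map_schurS_eq_rowMinor φ (hR.trans (Finset.Icc_subset_Icc_right (by omega))) hc _ _ h₃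

lemma sum_partitions₃_schurS (φ : K →+* F) {x : F} (hx : ∀ a, φ a ≠ x) {L r₁ r₂ r₃ T N s k : ℕ}
    (A B U W A' B' : Finset K)
    (hT : r₁ + (r₂ + r₃) = T) (hN : L + T = N) (hk : s + k = N)
    (h₁ : r₁ + (A'.card + B'.card + 1) = k)
    (h₂ : r₂ + (U.card + B.card) = N) (h₃ : r₃ + (A.card + W.card) = N) :
    ∑ R ∈ (partitions₃ T).filter (fun R => R.1 ⊆ Finset.Icc (s + 1) T ∧ R.1.card = r₁ ∧
        R.2.1.card = r₂ ∧ R.2.2.card = r₃),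
      (((partSign [R.1, R.2.1, R.2.2] : ℤˣ) : ℤ) : F) *
        (schurS k (R.1.image fun i => i - s) ((A'.val + B'.val).map φ + {x}) *
          φ (schurS N R.2.1 (U.val + B.val)) * φ (schurS N R.2.2 (A.val + W.val))) =
      (-1) ^ (r₁ * s) * (Matrix.of fun i j => (shifts₃ r₁ r₂ r₃
        ((X - C x) * ((∏ a ∈ A', (X - C (φ a))) * ∏ b ∈ B', (X - C (φ b))))
        ((∏ a ∈ U, (X - C (φ a))) * ∏ b ∈ B, (X - C (φ b)))
        ((∏ a ∈ A, (X - C (φ a))) * ∏ b ∈ W, (X - C (φ b))) j).coeff (L + pos₃ i)).det := by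
  classical
  subst hT
  have key := sum_partitions₃_of_eq_rowMinor (F := F) (r₁ := r₁) (r₂ := r₂) (r₃ := r₃) (L := L)
    ((X - C x) * ((∏ a ∈ A', (X - C (φ a))) * ∏ b ∈ B', (X - C (φ b))))
    ((∏ a ∈ U, (X - C (φ a))) * ∏ b ∈ B, (X - C (φ b)))
    ((∏ a ∈ A, (X - C (φ a))) * ∏ b ∈ W, (X - C (φ b)))
    (fun R => if R ⊆ Finset.Icc (s + 1) (r₁ + (r₂ + r₃)) then
      schurS k (R.image fun i => i - s) ((A'.val + B'.val).map φ + {x}) else 0)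
    (fun R => φ (schurS N R (U.val + B.val)))
    (fun R => φ (schurS N R (A.val + W.val))) ((-1) ^ (r₁ * s)) 1 1 ?_ ?_ ?_
  · rw [mul_one, mul_one] at key
    rw [← key]
    refine Finset.sum_subset_zero_on_sdiff (fun R hR => ?_) (fun R hR => ?_) (fun R hR => ?_)
    · obtain ⟨h, -, h'⟩ := Finset.mem_filter.1 hR
      exact Finset.mem_filter.2 ⟨h, h'⟩
    · obtain ⟨h, h'⟩ := Finset.mem_sdiff.1 hR
      obtain ⟨h1, h2⟩ := Finset.mem_filter.1 h
      rw [if_neg fun h3 => h' (Finset.mem_filter.2 ⟨h1, h3, h2⟩), zero_mul, zero_mul, mul_zero]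
    · rw [if_pos (Finset.mem_filter.1 hR).2.1]
  · intro R hR hc
    rw [hN]
    split_ifs with h
    · rw [← hk]
      exact schurS_image_sub_eq_rowMinor φ hx
        (h.trans (Finset.Icc_subset_Icc_right (by omega))) hc A' B' h₁
    -- The Laplace expansion runs over all R₁. A row i ≤ s holds coefficients of degree N - i ≥ k,
    -- whereas the polynomials of the first block have degree < k; so the additional R₁ contribute
    -- zero.
    · obtain ⟨i, hi, hi'⟩ := Finset.not_subset.1 h
      have hiT := Finset.mem_Icc.1 (hR hi)
      rw [Finset.mem_Icc] at hi'
      rw [rowMinor_eq_zero hi, mul_zero, mul_zero]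
      intro j
      have hm : ((∏ a ∈ A', (X - C (φ a))) * ∏ b ∈ B', (X - C (φ b))).Monic :=
        (monic_prod_X_sub_C φ A').mul (monic_prod_X_sub_C φ B')
      refine coeff_eq_zero_of_natDegree_lt ?_
      rw [natDegree_X_pow_mul ((monic_X_sub_C x).mul hm), (monic_X_sub_C x).natDegree_mul hm,
        natDegree_X_sub_C, (monic_prod_X_sub_C φ A').natDegree_mul (monic_prod_X_sub_C φ B'),
        natDegree_finsetProd_X_sub_C_eq_card, natDegree_finsetProd_X_sub_C_eq_card]
      omega
  · intro R hR hc
    rw [hN, one_mul]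
    refine map_schurS_eq_rowMinor φ (hR.trans (Finset.Icc_subset_Icc_right (by omega))) hc _ _ h₂
  · intro R hR hc
    rw [hN, one_mul]
    refine map_schurS_eq_rowMinor φ (hR.trans (Finset.Icc_subset_Icc_right (by omega))) hc _ _ h₃

end InnerSums

/-! ### Comparison of signs. -/

section Signs

variable {R : Type*} [CommRing R]

lemma neg_one_pow_congr_zmod {a b : ℕ} (h : (a : ZMod 2) = b) : (-1 : R) ^ a = (-1) ^ b := by
  rw [neg_one_pow_eq_pow_mod_two, neg_one_pow_eq_pow_mod_two (n := b),
    (ZMod.natCast_eq_natCast_iff' a b 2).1 h]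

lemma sign_identity_of_add_eq {m n' m' mb T d a b u w r₂ r₃ : ℕ} (hmb : mb = a + u)
    (hm : m = m' + mb) (hmb0 : 0 < mb) (hT : T = r₂ + r₃) (hT0 : 0 < T) (hd : a + b = d)
    (h₂ : m' + a = r₂ + d) (h₃ : n' + b = r₃ + d) :
    (-1 : R) ^ (m' * (m - d) + r₂ * (mb - 1) + r₃ * (T - 1) + r₂ * r₃) * (-1) ^ (d * r₂) =
      (-1) ^ (d * (u + w) + a * u + a * w + b * w) := by
  -- Truncated differences mb - 1 and T - 1 are replaced by c and t, which modulo 2 are mb + 1 and T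
  -- + 1.
  obtain ⟨c, hc⟩ : ∃ c, mb = c + 1 := ⟨mb - 1, by omega⟩
  obtain ⟨t, ht⟩ : ∃ t, T = t + 1 := ⟨T - 1, by omega⟩
  have e1 : m' = r₂ + b := by omega
  have e2 : m - d = r₂ + u := by omega
  have e3 : (c : ZMod 2) = a + u + 1 := by
    have : ((c + 1 : ℕ) : ZMod 2) = ((a + u : ℕ) : ZMod 2) := by rw [← hc, hmb]
    push_cast at this
    rw [← this, add_assoc, CharTwo.add_self_eq_zero, add_zero]
  have e4 : (t : ZMod 2) = r₂ + r₃ + 1 := by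
    have : ((t + 1 : ℕ) : ZMod 2) = ((r₂ + r₃ : ℕ) : ZMod 2) := by rw [← ht, hT]
    push_cast at this
    rw [← this, add_assoc, CharTwo.add_self_eq_zero, add_zero]
  have key : ∀ r₂ r₃ a b u w : ZMod 2, (r₂ + b) * (r₂ + u) + r₂ * (a + u + 1) +
      r₃ * (r₂ + r₃ + 1) + r₂ * r₃ + (a + b) * r₂ =
      (a + b) * (u + w) + a * u + a * w + b * w := by decide
  rw [← pow_add, e1, e2, hc, ht, Nat.add_sub_cancel, Nat.add_sub_cancel, ← hd]
  refine neg_one_pow_congr_zmod ?_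
  push_cast
  rw [e3, e4, key]

/-- The right-hand side covers both remaining cases: for u = w = 0 it is (-1) ^ r₁, the sign in
front of the remainder coefficients, and for u + w = 1 it is the sign in `pairTerm` by
`neg_one_pow_pair`. -/
lemma sign_identity {m n m' n' mb nb T d a b u w r₁ r₂ r₃ : ℕ} (hmb : mb = a + u)
    (hm : m = m' + mb) (hnb : nb = b + w) (hn : n = n' + nb) (hmb0 : 0 < mb)
    (hT : T = r₁ + r₂ + r₃) (hT0 : 0 < T) (hd : a + b + r₁ = d) (hmn : 2 * d < m + n)
    (h₂ : m' + a = r₂ + d) (h₃ : n' + b = r₃ + d) :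
    (-1 : R) ^ (m' * (m - d) + r₁ * (n - d + r₂ + r₃) + r₂ * (mb - 1) + r₃ * (T - 1) + r₂ * r₃) *
        (-1) ^ (r₁ * (m + n - 2 * d - 1)) * (-1) ^ (d * r₂) =
      (-1) ^ (r₁ * (u + 1) + (b + r₁) * u) := by
  obtain ⟨c, hc⟩ : ∃ c, mb = c + 1 := ⟨mb - 1, by omega⟩
  obtain ⟨t, ht⟩ : ∃ t, T = t + 1 := ⟨T - 1, by omega⟩
  obtain ⟨s, hs⟩ : ∃ s, m + n - 2 * d = s + 1 := ⟨m + n - 2 * d - 1, by omega⟩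
  have e1 : m' = r₂ + b + r₁ := by omega
  have e2 : m - d = r₂ + u := by omega
  have e2' : n - d = r₃ + w := by omega
  have e3 : (c : ZMod 2) = a + u + 1 := by
    have : ((c + 1 : ℕ) : ZMod 2) = ((a + u : ℕ) : ZMod 2) := by rw [← hc, hmb]
    push_cast at this
    rw [← this, add_assoc, CharTwo.add_self_eq_zero, add_zero]
  have e4 : (t : ZMod 2) = r₁ + r₂ + r₃ + 1 := by
    have : ((t + 1 : ℕ) : ZMod 2) = ((r₁ + r₂ + r₃ : ℕ) : ZMod 2) := by rw [← ht, hT]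
    push_cast at this
    rw [← this, add_assoc, CharTwo.add_self_eq_zero, add_zero]
  have e5 : (s : ZMod 2) = r₂ + u + (r₃ + w) + 1 := by
    have : ((s + 1 : ℕ) : ZMod 2) = ((r₂ + u + (r₃ + w) : ℕ) : ZMod 2) := by
      rw [← hs, ← e2, ← e2']
      congr 1
      omega
    push_cast at this
    rw [← this, add_assoc, CharTwo.add_self_eq_zero, add_zero]
  have key : ∀ r₁ r₂ r₃ a b u w : ZMod 2, (r₂ + b + r₁) * (r₂ + u) +
      r₁ * (r₃ + w + r₂ + r₃) + r₂ * (a + u + 1) +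
      r₃ * (r₁ + r₂ + r₃ + 1) + r₂ * r₃ + r₁ * (r₂ + u + (r₃ + w) + 1) + (a + b + r₁) * r₂ =
      r₁ * (u + 1) + (b + r₁) * u := by
    intro r₁ r₂ r₃ a b u w
    have h2 : (2 : ZMod 2) = 0 := rfl
    have i2 : r₂ * r₂ = r₂ := by revert r₂; decide
    have i3 : r₃ * r₃ = r₃ := by revert r₃; decide
    linear_combination i2 + i3 + (r₂ * u + b * r₂ + 2 * r₁ * r₂ + 2 * r₁ * r₃ + r₁ * w + r₂ * a +
      r₂ + r₃ + r₂ * r₃) * h2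
  rw [← pow_add, ← pow_add, e1, e2, e2', hc, ht, hs, Nat.add_sub_cancel, Nat.add_sub_cancel,
    Nat.add_sub_cancel, ← hd]
  refine neg_one_pow_congr_zmod ?_
  push_cast
  rw [e3, e4, e5, key]

lemma neg_one_pow_pair {d a b u w r₁ : ℕ} (hd : a + b + r₁ = d) (huw : u + w = 1) :
    (-1 : R) ^ (r₁ * (u + 1) + (b + r₁) * u) = (-1) ^ (d * (u + w) + a * u + a * w + b * w) := by
  refine neg_one_pow_congr ?_
  obtain ⟨rfl, rfl⟩ | ⟨rfl, rfl⟩ : u = 0 ∧ w = 1 ∨ u = 1 ∧ w = 0 := by omega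
  all_goals
    rw [Nat.even_iff, Nat.even_iff]
    omega

end Signs

/-! ### Translation into K(x). -/

section RatFunc

variable {K : Type*} [Field K] [DecidableEq K]

lemma algebraMap_resProdX (Y : Finset K) :
    algebraMap K[X] (RatFunc K) (resProdX Y) = ∏ y ∈ Y, (RatFunc.X - RatFunc.C y) := by
  simp [resProdX, map_prod, RatFunc.algebraMap_X, RatFunc.algebraMap_C]

lemma map_resProd (S T : Finset K) :
    (RatFunc.C (resProd S T) : RatFunc K) = diffProd RatFunc.C RatFunc.C S T := by
  simp [resProd, diffProd, map_prod]

lemma algebraMap_sylSingle (A B : Finset K) (d : ℕ) :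
    algebraMap K[X] (RatFunc K) (sylSingle A B d) =
      sylSum RatFunc.C RatFunc.C (fun S T => (diffProd RatFunc.C RatFunc.C S T)⁻¹) A B d
        (fun A₁ => ∏ a ∈ A₁, (RatFunc.X - RatFunc.C a)) := by
  rw [sylSingle, sylSum, map_sum]
  refine Finset.sum_congr rfl fun A₁ _ => ?_
  rw [map_mul, algebraMap_resProdX, RatFunc.algebraMap_C, map_div₀, map_resProd, map_resProd,
    div_eq_mul_inv]

lemma pairTerm_eq_quotTerm (A B Ab Bb : Finset K) (d : ℕ) (P : Finset K × Finset K) :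
    pairTerm RatFunc.C RatFunc.C (fun S T => (diffProd RatFunc.C RatFunc.C S T)⁻¹)
      (fun S T => (diffProd RatFunc.C RatFunc.C S T)⁻¹) A B Ab Bb d RatFunc.X P =
    (-1) ^ (d * ((Ab \ P.1).card + (Bb \ P.2).card) + P.1.card * (Ab \ P.1).card +
      P.1.card * (Bb \ P.2).card + P.2.card * (Bb \ P.2).card) *
    algebraMap K[X] (RatFunc K) (quotTerm A B Ab Bb P.1 P.2) *
    sylSum RatFunc.C RatFunc.C (fun S T => (diffProd RatFunc.C RatFunc.C S T)⁻¹)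
      (A \ (Ab \ P.1)) (B \ (Bb \ P.2)) d (fun _ => 1) := by
  rw [pairTerm, quotTerm, map_mul, map_mul, algebraMap_resProdX, algebraMap_resProdX,
    RatFunc.algebraMap_C, map_div₀, map_mul, map_mul, map_resProd, map_resProd, map_resProd,
    map_resProd, div_eq_mul_inv, mul_inv]
  ring

lemma algebraMap_quotTerm_self (A B Ab Bb : Finset K) :
    algebraMap K[X] (RatFunc K) (quotTerm A B Ab Bb Ab Bb) =
      (∏ a ∈ Ab, (RatFunc.X - RatFunc.C a)) * ∏ b ∈ Bb, (RatFunc.X - RatFunc.C b) := by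
  rw [quotTerm, map_mul, map_mul, algebraMap_resProdX, algebraMap_resProdX]
  simp [resProd]

lemma RatFunc.C_ne_X (a : K) : (RatFunc.C a : RatFunc K) ≠ RatFunc.X := by
  rw [← RatFunc.algebraMap_C, ← RatFunc.algebraMap_X]
  intro h
  exact (Polynomial.X_ne_C a) (RatFunc.algebraMap_injective K h).symm

end RatFunc

/-! ### Matching the contributions of each pair. -/

section Assembly

variable {K : Type*} [Field K] [DecidableEq K]

lemma card_sdiff_sdiff {A Ab A' : Finset K} (hAb : Ab ⊆ A) (hA' : A' ⊆ Ab) :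
    (A \ (Ab \ A')).card + Ab.card = A.card + A'.card := by
  have h1 := Finset.card_sdiff_add_card_eq_card hA'
  have h2 := Finset.card_sdiff_add_card_eq_card ((Finset.sdiff_subset (s := Ab) (t := A')).trans hAb)
  omega

/-- For such pairs |R₂| or |R₃| would be negative, so the term must vanish. Either there is no A₁ at
all, or `h2` gives |A ∖ U| > d and `sylSum_eq_zero` applies. -/
lemma pairTerm_eq_zero {A B Ab Bb : Finset K} {d : ℕ} {P : Finset K × Finset K}
    (h : (A \ (Ab \ P.1)).card < d ∨ (B \ (Bb \ P.2)).card < d)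
    (h2 : 2 * d ≤ (A \ (Ab \ P.1)).card + (B \ (Bb \ P.2)).card) :
    pairTerm RatFunc.C RatFunc.C (fun S T => (diffProd RatFunc.C RatFunc.C S T)⁻¹)
      (fun S T => (diffProd RatFunc.C RatFunc.C S T)⁻¹) A B Ab Bb d (RatFunc.X : RatFunc K) P
      = 0 := by
  rw [pairTerm_eq_quotTerm]
  rcases Nat.lt_or_ge (A \ (Ab \ P.1)).card d with hA | hA
  · rw [sylSum, Finset.powersetCard_eq_empty.2 hA, Finset.sum_empty, mul_zero]
  · rw [sylSum_eq_zero RatFunc.C_injective.injOn (by omega) (by omega), mul_zero]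

lemma sum_partitions₂_eq_pairTerm {A B Ab Bb : Finset K} (hAb : Ab ⊆ A) (hBb : Bb ⊆ B)
    (hAb0 : Ab.Nonempty) {m n mb nb m' n' d : ℕ} (hm : m = A.card) (hn : n = B.card)
    (hmb : mb = Ab.card) (hnb : nb = Bb.card) (hm' : m' = m - mb) (hn' : n' = n - nb)
    (hdm : d ≤ m) (hdn : d ≤ n) (hd' : d < m' + n')
    {P : Finset K × Finset K} (hP₁ : P.1 ⊆ Ab) (hP₂ : P.2 ⊆ Bb) :
    ∑ R ∈ ((partitions₂ (m' + n' - d)).filter (fun R =>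
            m' ≤ R.1.card + d ∧ R.1.card ≤ m - d ∧ n' ≤ R.2.card + d ∧ R.2.card ≤ n - d)).filter
          (fun R => m' + P.1.card = R.1.card + d ∧ n' + P.2.card = R.2.card + d),
      (-1) ^ (m' * (m - d) + R.1.card * (mb - 1) + R.2.card * (m' + n' - d - 1)
              + R.1.card * R.2.card) * (((partSign [R.1, R.2] : ℤˣ) : ℤ) : RatFunc K) *
        (algebraMap K[X] (RatFunc K) (quotTerm A B Ab Bb P.1 P.2) *
          RatFunc.C (schurS (m + n - d) R.1 ((Ab \ P.1).val + B.val)) *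
          RatFunc.C (schurS (m + n - d) R.2 (A.val + (Bb \ P.2).val))) =
      if P.1.card + P.2.card = d then
        pairTerm RatFunc.C RatFunc.C (fun S T => (diffProd RatFunc.C RatFunc.C S T)⁻¹)
          (fun S T => (diffProd RatFunc.C RatFunc.C S T)⁻¹) A B Ab Bb d RatFunc.X P
      else 0 := by
  have hmb0 : 0 < mb := hmb ▸ hAb0.card_pos
  have cA := card_sdiff_sdiff hAb hP₁
  have cB := card_sdiff_sdiff hBb hP₂
  have cU := Finset.card_sdiff_add_card_eq_card hP₁
  have cW := Finset.card_sdiff_add_card_eq_card hP₂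
  have c1 := Finset.card_le_card hAb
  have c2 := Finset.card_le_card hBb
  rw [Finset.filter_filter]
  split_ifs with hk
  swap
  -- |R₂| + |R₃| = m' + n' - d forces |A'| + |B'| = d.
  · refine Finset.sum_eq_zero fun R hR => ?_
    obtain ⟨hR, h1, h2, h3⟩ := Finset.mem_filter.1 hR
    obtain ⟨hdisj, hu⟩ := mem_partitions₂.1 hR
    have := congrArg Finset.card hu
    rw [Finset.card_union_of_disjoint hdisj, Nat.card_Icc] at this
    omega
  by_cases hz : (A \ (Ab \ P.1)).card < d ∨ (B \ (Bb \ P.2)).card < d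
  · rw [pairTerm_eq_zero hz (by omega)]
    refine Finset.sum_eq_zero fun R hR => ?_
    obtain ⟨hR, h1, h2, h3⟩ := Finset.mem_filter.1 hR
    omega
  obtain ⟨r₂, hr₂⟩ : ∃ r₂, m' + P.1.card = r₂ + d := ⟨m' + P.1.card - d, by omega⟩
  obtain ⟨r₃, hr₃⟩ : ∃ r₃, n' + P.2.card = r₃ + d := ⟨n' + P.2.card - d, by omega⟩
  have hf : (partitions₂ (m' + n' - d)).filter (fun R =>
      (m' ≤ R.1.card + d ∧ R.1.card ≤ m - d ∧ n' ≤ R.2.card + d ∧ R.2.card ≤ n - d) ∧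
      (m' + P.1.card = R.1.card + d ∧ n' + P.2.card = R.2.card + d)) =
      (partitions₂ (m' + n' - d)).filter (fun R => R.1.card = r₂ ∧ R.2.card = r₃) :=
    Finset.filter_congr fun R _ => by omega
  have hsum := sum_partitions₂_schurS (RatFunc.C : K →+* RatFunc K) (L := d + ((Ab \ P.1).card +
    (Bb \ P.2).card)) (r₂ := r₂) (r₃ := r₃) (T := m' + n' - d) (N := m + n - d) A B (Ab \ P.1)
    (Bb \ P.2) (by omega) (by omega) (by omega) (by omega)
  rw [sylDet_eq_sylSum RatFunc.C_injective.injOn (Finset.sdiff_subset.trans hAb)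
    (Finset.sdiff_subset.trans hBb) (by omega) (by omega)] at hsum
  have hsign := sign_identity_of_add_eq (R := RatFunc K) (m := m) (n' := n') (m' := m') (mb := mb)
    (T := m' + n' - d) (d := d) (a := P.1.card) (b := P.2.card) (u := (Ab \ P.1).card)
    (w := (Bb \ P.2).card) (r₂ := r₂) (r₃ := r₃) (by omega) (by omega) (by omega) (by omega)
    (by omega) (by omega) (by omega) (by omega)
  rw [hf, pairTerm_eq_quotTerm, ← hsign]
  have hterm : ∀ R ∈ (partitions₂ (m' + n' - d)).filter (fun R => R.1.card = r₂ ∧ R.2.card = r₃),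
      (-1) ^ (m' * (m - d) + R.1.card * (mb - 1) + R.2.card * (m' + n' - d - 1)
              + R.1.card * R.2.card) * (((partSign [R.1, R.2] : ℤˣ) : ℤ) : RatFunc K) *
        (algebraMap K[X] (RatFunc K) (quotTerm A B Ab Bb P.1 P.2) *
          RatFunc.C (schurS (m + n - d) R.1 ((Ab \ P.1).val + B.val)) *
          RatFunc.C (schurS (m + n - d) R.2 (A.val + (Bb \ P.2).val))) =
      (-1) ^ (m' * (m - d) + r₂ * (mb - 1) + r₃ * (m' + n' - d - 1) + r₂ * r₃) *
        algebraMap K[X] (RatFunc K) (quotTerm A B Ab Bb P.1 P.2) *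
        ((((partSign [R.1, R.2] : ℤˣ) : ℤ) : RatFunc K) *
        (RatFunc.C (schurS (m + n - d) R.1 ((Ab \ P.1).val + B.val)) *
          RatFunc.C (schurS (m + n - d) R.2 (A.val + (Bb \ P.2).val)))) := by
    intro R hR
    obtain ⟨-, h2, h3⟩ := Finset.mem_filter.1 hR
    rw [h2, h3]
    ring
  rw [Finset.sum_congr rfl hterm, ← Finset.mul_sum, hsum]
  ring

lemma sum_partitions₃_eq_pairTerm {A B Ab Bb : Finset K} (hAb : Ab ⊆ A) (hBb : Bb ⊆ B)
    (hAb0 : Ab.Nonempty) {m n mb nb m' n' d k : ℕ} (hm : m = A.card) (hn : n = B.card)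
    (hmb : mb = Ab.card) (hnb : nb = Bb.card) (hm' : m' = m - mb) (hn' : n' = n - nb)
    (hdm : d ≤ m) (hdn : d ≤ n) (hmn : 2 * d < m + n) (hd' : d < m' + n') (hd : mb + nb ≤ d)
    (hk : mb + nb = k + 1)
    {P : Finset K × Finset K} (hP₁ : P.1 ⊆ Ab) (hP₂ : P.2 ⊆ Bb) :
    ∑ R ∈ ((partitions₃ (m' + n' - d)).filter (fun R =>
            R.1 ⊆ Finset.Icc (m + n - 2 * d) (m' + n' - d) ∧
            R.1.card ≤ d - (mb + nb) + 1 ∧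
            m' ≤ R.2.1.card + d ∧ R.2.1.card ≤ m - d ∧
            n' ≤ R.2.2.card + d ∧ R.2.2.card ≤ n - d)).filter
          (fun R => m' + P.1.card = R.2.1.card + d ∧ n' + P.2.card = R.2.2.card + d),
      (-1) ^ (m' * (m - d) + R.1.card * (n - d + R.2.1.card + R.2.2.card)
              + R.2.1.card * (mb - 1) + R.2.2.card * (m' + n' - d - 1)
              + R.2.1.card * R.2.2.card) *
            (((partSign [R.1, R.2.1, R.2.2] : ℤˣ) : ℤ) : RatFunc K) *
        (algebraMap K[X] (RatFunc K) (quotTerm A B Ab Bb P.1 P.2) *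
          schurS (d + 1) (R.1.image (fun i => i - (m + n - 2 * d - 1)))
            ((P.1.val + P.2.val).map RatFunc.C + {RatFunc.X}) *
          RatFunc.C (schurS (m + n - d) R.2.1 ((Ab \ P.1).val + B.val)) *
          RatFunc.C (schurS (m + n - d) R.2.2 (A.val + (Bb \ P.2).val))) =
      (if P.1.card + P.2.card = k then
        pairTerm RatFunc.C RatFunc.C (fun S T => (diffProd RatFunc.C RatFunc.C S T)⁻¹)
          (fun S T => (diffProd RatFunc.C RatFunc.C S T)⁻¹) A B Ab Bb d RatFunc.X P
      else 0) +
      if (Ab, Bb) = P then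
        (∏ a ∈ Ab, (RatFunc.X - RatFunc.C a)) * (∏ b ∈ Bb, (RatFunc.X - RatFunc.C b)) *
          sylSum RatFunc.C RatFunc.C (fun S T => (diffProd RatFunc.C RatFunc.C S T)⁻¹) A B d
            (remCoeff RatFunc.C RatFunc.C Ab Bb RatFunc.X)
      else 0 := by
  have hmb0 : 0 < mb := hmb ▸ hAb0.card_pos
  have cA := card_sdiff_sdiff hAb hP₁
  have cB := card_sdiff_sdiff hBb hP₂
  have cU := Finset.card_sdiff_add_card_eq_card hP₁
  have cW := Finset.card_sdiff_add_card_eq_card hP₂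
  have c1 := Finset.card_le_card hAb
  have c2 := Finset.card_le_card hBb
  have hPeq : (Ab, Bb) = P ↔ P.1.card + P.2.card = k + 1 := by
    constructor
    · rintro rfl
      simp only
      omega
    · intro h
      exact Prod.ext (Finset.eq_of_subset_of_card_le hP₁ (by omega)).symm
        (Finset.eq_of_subset_of_card_le hP₂ (by omega)).symm
  rw [Finset.filter_filter]
  -- The size of the partition gives r₁ = d - |A'| - |B'|, so the bound on r₁ says |A'| + |B'| ≥ k.
  -- Only the totals k and k + 1 remain.
  by_cases hlow : P.1.card + P.2.card < k
  · rw [if_neg (by omega), if_neg (by rw [hPeq]; omega), add_zero]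
    refine Finset.sum_eq_zero fun R hR => ?_
    obtain ⟨hR, h1, h2, h3⟩ := Finset.mem_filter.1 hR
    have := card_of_mem_partitions₃ hR
    omega
  by_cases hz : (A \ (Ab \ P.1)).card < d ∨ (B \ (Bb \ P.2)).card < d
  · rw [pairTerm_eq_zero hz (by omega), ite_self, zero_add, if_neg]
    · refine Finset.sum_eq_zero fun R hR => ?_
      obtain ⟨hR, h1, h2, h3⟩ := Finset.mem_filter.1 hR
      omega
    · rw [hPeq]
      omega
  obtain ⟨r₁, hr₁⟩ : ∃ r₁, P.1.card + P.2.card + r₁ = d := ⟨d - (P.1.card + P.2.card), by omega⟩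
  obtain ⟨r₂, hr₂⟩ : ∃ r₂, m' + P.1.card = r₂ + d := ⟨m' + P.1.card - d, by omega⟩
  obtain ⟨r₃, hr₃⟩ : ∃ r₃, n' + P.2.card = r₃ + d := ⟨n' + P.2.card - d, by omega⟩
  have hs : m + n - 2 * d - 1 + 1 = m + n - 2 * d := by omega
  have hf : (partitions₃ (m' + n' - d)).filter (fun R =>
      (R.1 ⊆ Finset.Icc (m + n - 2 * d) (m' + n' - d) ∧
            R.1.card ≤ d - (mb + nb) + 1 ∧
            m' ≤ R.2.1.card + d ∧ R.2.1.card ≤ m - d ∧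
            n' ≤ R.2.2.card + d ∧ R.2.2.card ≤ n - d) ∧
      (m' + P.1.card = R.2.1.card + d ∧ n' + P.2.card = R.2.2.card + d)) =
      (partitions₃ (m' + n' - d)).filter (fun R =>
        R.1 ⊆ Finset.Icc (m + n - 2 * d - 1 + 1) (m' + n' - d) ∧ R.1.card = r₁ ∧
        R.2.1.card = r₂ ∧ R.2.2.card = r₃) :=
    Finset.filter_congr fun R hR => by
      have := card_of_mem_partitions₃ hR
      rw [hs]
      constructor
      · rintro ⟨⟨h, h1⟩, h2⟩
        exact ⟨h, by omega⟩
      · rintro ⟨h, h1⟩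
        exact ⟨⟨h, by omega⟩, by omega⟩
  have hsum := sum_partitions₃_schurS (RatFunc.C : K →+* RatFunc K) RatFunc.C_ne_X
    (L := Ab.card + Bb.card) (r₁ := r₁) (r₂ := r₂) (r₃ := r₃) (T := m' + n' - d) (N := m + n - d)
    (s := m + n - 2 * d - 1) (k := d + 1) A B (Ab \ P.1)
    (Bb \ P.2) P.1 P.2 (by omega) (by omega) (by omega) (by omega) (by omega) (by omega)
  have hsign := sign_identity (R := RatFunc K) (m := m) (n := n) (n' := n') (m' := m') (mb := mb)
    (nb := nb) (T := m' + n' - d) (d := d) (a := P.1.card) (b := P.2.card) (u := (Ab \ P.1).card)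
    (w := (Bb \ P.2).card) (r₁ := r₁) (r₂ := r₂) (r₃ := r₃) (by omega) (by omega) (by omega)
    (by omega) (by omega) (by omega) (by omega) (by omega) (by omega) (by omega) (by omega)
  have hterm : ∀ R ∈ (partitions₃ (m' + n' - d)).filter (fun R =>
        R.1 ⊆ Finset.Icc (m + n - 2 * d - 1 + 1) (m' + n' - d) ∧ R.1.card = r₁ ∧
        R.2.1.card = r₂ ∧ R.2.2.card = r₃),
      (-1) ^ (m' * (m - d) + R.1.card * (n - d + R.2.1.card + R.2.2.card)
              + R.2.1.card * (mb - 1) + R.2.2.card * (m' + n' - d - 1)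
              + R.2.1.card * R.2.2.card) *
            (((partSign [R.1, R.2.1, R.2.2] : ℤˣ) : ℤ) : RatFunc K) *
        (algebraMap K[X] (RatFunc K) (quotTerm A B Ab Bb P.1 P.2) *
          schurS (d + 1) (R.1.image (fun i => i - (m + n - 2 * d - 1)))
            ((P.1.val + P.2.val).map RatFunc.C + {RatFunc.X}) *
          RatFunc.C (schurS (m + n - d) R.2.1 ((Ab \ P.1).val + B.val)) *
          RatFunc.C (schurS (m + n - d) R.2.2 (A.val + (Bb \ P.2).val))) =
      (-1) ^ (m' * (m - d) + r₁ * (n - d + r₂ + r₃) + r₂ * (mb - 1) + r₃ * (m' + n' - d - 1)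
        + r₂ * r₃) * algebraMap K[X] (RatFunc K) (quotTerm A B Ab Bb P.1 P.2) *
        ((((partSign [R.1, R.2.1, R.2.2] : ℤˣ) : ℤ) : RatFunc K) *
        (schurS (d + 1) (R.1.image (fun i => i - (m + n - 2 * d - 1)))
            ((P.1.val + P.2.val).map RatFunc.C + {RatFunc.X}) *
          RatFunc.C (schurS (m + n - d) R.2.1 ((Ab \ P.1).val + B.val)) *
          RatFunc.C (schurS (m + n - d) R.2.2 (A.val + (Bb \ P.2).val)))) := by
    intro R hR
    obtain ⟨-, -, h1, h2, h3⟩ := Finset.mem_filter.1 hR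
    rw [h1, h2, h3]
    ring
  rw [hf, Finset.sum_congr rfl hterm, ← Finset.mul_sum, hsum]
  -- For (Ā, B̄) the determinant is the sum of remainder coefficients. Otherwise exactly one element
  -- is missing, and (t - x) ∏_{A'} ∏_{B'} is monic of degree |Ā| + |B̄|, the lowest row, so its
  -- shifts strip off.
  by_cases hP : (Ab, Bb) = P
  · rw [if_neg (by have := hPeq.1 hP; omega), if_pos hP, zero_add]
    obtain rfl := hP
    simp only [Finset.sdiff_self, Finset.card_empty, Finset.prod_empty, one_mul, mul_one] at *
    rw [det_shifts₃_eq_sylSum_remCoeff RatFunc.C_injective.injOn hr₁ (by omega) (by omega)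
      (by omega), algebraMap_quotTerm_self]
    rw [mul_zero, add_zero, zero_add, mul_one] at hsign
    rw [pow_add (-1 : RatFunc K) r₁]
    have h1 : (-1 : RatFunc K) ^ r₁ * (-1) ^ r₁ = 1 := by
      rw [← pow_add, Even.neg_one_pow ⟨_, rfl⟩]
    linear_combination ((-1) ^ r₁ * ((∏ a ∈ Ab, (RatFunc.X - RatFunc.C a)) *
      (∏ b ∈ Bb, (RatFunc.X - RatFunc.C b)) *
          sylSum RatFunc.C RatFunc.C (fun S T => (diffProd RatFunc.C RatFunc.C S T)⁻¹) A B d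
            (remCoeff RatFunc.C RatFunc.C Ab Bb RatFunc.X))) * hsign +
      ((∏ a ∈ Ab, (RatFunc.X - RatFunc.C a)) * (∏ b ∈ Bb, (RatFunc.X - RatFunc.C b)) *
          sylSum RatFunc.C RatFunc.C (fun S T => (diffProd RatFunc.C RatFunc.C S T)⁻¹) A B d
            (remCoeff RatFunc.C RatFunc.C Ab Bb RatFunc.X)) * h1
  · have hPk : P.1.card + P.2.card = k := by
      have h1 : ¬ P.1.card + P.2.card = k + 1 := fun h => hP (hPeq.2 h)
      have h2 := Finset.card_le_card hP₁
      have h3 := Finset.card_le_card hP₂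
      omega
    have hm1 : ((∏ a ∈ P.1, (X - C (RatFunc.C a : RatFunc K))) *
        ∏ b ∈ P.2, (X - C (RatFunc.C b))).Monic :=
      (monic_prod_X_sub_C _ P.1).mul (monic_prod_X_sub_C _ P.2)
    have hm2 : ((X - C RatFunc.X) * ((∏ a ∈ P.1, (X - C (RatFunc.C a : RatFunc K))) *
        ∏ b ∈ P.2, (X - C (RatFunc.C b)))).natDegree = Ab.card + Bb.card := by
      rw [(monic_X_sub_C _).natDegree_mul hm1, natDegree_X_sub_C,
        (monic_prod_X_sub_C _ P.1).natDegree_mul (monic_prod_X_sub_C _ P.2),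
        natDegree_finsetProd_X_sub_C_eq_card, natDegree_finsetProd_X_sub_C_eq_card]
      omega
    rw [if_pos hPk, if_neg hP, add_zero, det_shifts₃_of_monic ((monic_X_sub_C _).mul hm1) hm2,
      show Ab.card + Bb.card + r₁ = d + ((Ab \ P.1).card + (Bb \ P.2).card) by omega,
      sylDet_eq_sylSum RatFunc.C_injective.injOn (Finset.sdiff_subset.trans hAb)
        (Finset.sdiff_subset.trans hBb) (by omega) (by omega), pairTerm_eq_quotTerm,
      ← neg_one_pow_pair hr₁ (by omega), ← hsign]
    ring

end Assembly

theorem theorem3p3 {K : Type*} [Field K] [DecidableEq K]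
    (A B Ab Bb : Finset K) (hAb : Ab ⊆ A) (hBb : Bb ⊆ B)
    (hAb0 : Ab.Nonempty) (hBb0 : Bb.Nonempty)
    (m n mb nb m' n' d : ℕ)
    (hm : m = A.card) (hn : n = B.card) (hmb : mb = Ab.card) (hnb : nb = Bb.card)
    (hm' : m' = m - mb) (hn' : n' = n - nb)
    (hd : (m ≠ n ∧ d ≤ min m n) ∨ (m = n ∧ d < m))
    (hd' : d < m' + n') :
    -- (1): an identity in `K[x]`
    (d < mb + nb →
      sylSingle A B d =
        ∑ R ∈ (partitions₂ (m' + n' - d)).filter (fun R =>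
            m' ≤ R.1.card + d ∧ R.1.card ≤ m - d ∧ n' ≤ R.2.card + d ∧ R.2.card ≤ n - d),
          (-1) ^ (m' * (m - d) + R.1.card * (mb - 1) + R.2.card * (m' + n' - d - 1)
              + R.1.card * R.2.card) *
            (((partSign [R.1, R.2] : ℤˣ) : ℤ) : K[X]) *
            ∑ A' ∈ Ab.powersetCard (R.1.card + d - m'),
              ∑ B' ∈ Bb.powersetCard (R.2.card + d - n'),
                quotTerm A B Ab Bb A' B' *
                  Polynomial.C (schurS (m + n - d) R.1 ((Ab \ A').val + B.val)) *
                  Polynomial.C (schurS (m + n - d) R.2 (A.val + (Bb \ B').val))) ∧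
    -- (2): an identity in `K(x)`
    (mb + nb ≤ d →
      algebraMap (Polynomial K) (RatFunc K) (sylSingle A B d) =
        ∑ R ∈ (partitions₃ (m' + n' - d)).filter (fun R =>
            R.1 ⊆ Finset.Icc (m + n - 2 * d) (m' + n' - d) ∧
            R.1.card ≤ d - (mb + nb) + 1 ∧
            m' ≤ R.2.1.card + d ∧ R.2.1.card ≤ m - d ∧
            n' ≤ R.2.2.card + d ∧ R.2.2.card ≤ n - d),
          (-1) ^ (m' * (m - d) + R.1.card * (n - d + R.2.1.card + R.2.2.card)
              + R.2.1.card * (mb - 1) + R.2.2.card * (m' + n' - d - 1)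
              + R.2.1.card * R.2.2.card) *
            (((partSign [R.1, R.2.1, R.2.2] : ℤˣ) : ℤ) : RatFunc K) *
            ∑ A' ∈ Ab.powersetCard (R.2.1.card + d - m'),
              ∑ B' ∈ Bb.powersetCard (R.2.2.card + d - n'),
                algebraMap (Polynomial K) (RatFunc K) (quotTerm A B Ab Bb A' B') *
                  schurS (d + 1) (R.1.image (fun i => i - (m + n - 2 * d - 1)))
                    ((A'.val + B'.val).map RatFunc.C + {RatFunc.X}) *
                  RatFunc.C (schurS (m + n - d) R.2.1 ((Ab \ A').val + B.val)) *
                  RatFunc.C (schurS (m + n - d) R.2.2 (A.val + (Bb \ B').val))) := by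
  -- K may be finite; the translation argument needs the infinite field K(x).
  have : Infinite (RatFunc K) :=
    Infinite.of_injective _ (RatFunc.algebraMap_injective K)
  have hinj : ∀ S : Finset K, Set.InjOn (RatFunc.C : K →+* RatFunc K) S := fun S =>
    RatFunc.C_injective.injOn
  constructor
  · intro hlt
    apply RatFunc.algebraMap_injective K
    rw [algebraMap_sylSingle, sylSum_eq_sum_pairTerm (hinj A) (hinj B) hAb hBb (by omega)
      RatFunc.X_ne_zero, pairs, Finset.sum_filter, map_sum]
    simp only [map_mul, map_sum, map_pow, map_neg, map_one, map_intCast, RatFunc.algebraMap_C,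
      Finset.mul_sum]
    rw [sum_sum_powersetCard]
    · refine Finset.sum_congr rfl fun P hP => ?_
      obtain ⟨hP₁, hP₂⟩ := Finset.mem_product.1 hP
      exact (sum_partitions₂_eq_pairTerm hAb hBb hAb0 hm hn hmb hnb hm' hn' (by omega) (by omega)
        hd' (Finset.mem_powerset.1 hP₁) (Finset.mem_powerset.1 hP₂)).symm
    · intro R hR
      have := (Finset.mem_filter.1 hR).2
      omega
  · intro hle
    obtain ⟨k, hk⟩ : ∃ k, mb + nb = k + 1 := by
      have := hAb0.card_pos
      exact ⟨mb + nb - 1, by omega⟩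
    rw [algebraMap_sylSingle, sylSum_eq_sum_pairTerm_add (hinj A) (hinj B) hAb hBb (k := k)
      (by omega) RatFunc.X_ne_zero, pairs, Finset.sum_filter]
    simp only [Finset.mul_sum]
    rw [sum_sum_powersetCard]
    · have hself : (Ab, Bb) ∈ Ab.powerset ×ˢ Bb.powerset := by simp
      rw [Finset.sum_congr rfl fun P hP => sum_partitions₃_eq_pairTerm hAb hBb hAb0 hm hn hmb hnb
        hm' hn' (by omega) (by omega) (by omega) hd' hle hk
        (Finset.mem_powerset.1 (Finset.mem_product.1 hP).1)
        (Finset.mem_powerset.1 (Finset.mem_product.1 hP).2), Finset.sum_add_distrib,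
        Finset.sum_ite_eq, if_pos hself]
    · intro R hR
      have := (Finset.mem_filter.1 hR).2
      omega
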